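/- Let $m\ge 2$ be even, $\sigma_0=(-1)^{m/2}$, $T>0$, and let $\Omega=\mathbb R/L\mathbb Z$ ($L>0$) be a one-dimensional periodic domain. Let $f\in W^{2,\infty}_{loc}(\mathbb R)$ with $f''\in L^\infty(\mathbb R)$. Let $u\in W^{m,\infty}((0,T)\times\Omega)$ be a (strong) solution of $$\partial_t u+\partial_x f(u)+\sigma_0\,\partial_x^m u=0\quad\text{in }(0,T)\times\Omega,\qquad u|_{t=0}=u_0\in W^{m,\infty}(\Omega).$$ For $\tau>0$ consider the system for $q=(q_0,\dots,q_{m-1})$ on $(0,T)\times\Omega$ $$\partial_t q_0+\partial_x f(q_0)+\sigma_0\,\partial_x q_{m-1}=0,\qquad \tau\,\partial_t q_j+s_j\,\partial_x q_{m-j-1}=s_j\,q_{m-j}\quad(1\le j\le m-1),$$ where $s_j=\sigma_0(-1)^j$ for $j\le \frac m2-1$ and $s_j=\sigma_0(-1)^{j+m-1}$ for $j\ge\frac m2$, with initial data $q|_{t=0}=(u_0,\partial_x u_0,\dots,\partial_x^{m-1}u_0)$. An entropy solution of this Cauchy problem is a $q\in L^2((0,T)\times\Omega)^m$ with $\mu(q_0)\in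 L^1((0,T)\times\Omega)$, where $\mu(a)=\int_0^a s f'(s)\,ds$, which satisfies the system with its initial data in the sense of distributions on $[0,T)\times\Omega$, together with the entropy inequality $$\partial_t\Bigl(\tfrac12 q_0^2+\tfrac\tau2\sum_{j=1}^{m-1}q_j^2\Bigr)+\partial_x\Bigl(\mu(q_0)+\sigma_0\sum_{j=0}^{m/2-1}(-1)^j q_j\,q_{m-1-j}\Bigr)\le -q_{m/2}^2,$$ also in the sense of distributions on $[0,T)\times\Omega$, including the initial data. Then there are constants $C,\tau_0>0$, which do not depend on $\tau$ or $q$, such that for every $\tau\in(0,\tau_0]$ and every entropy solution $q$ $$\|u-q_0\|_{L^\infty(0,T;L^2(\Omega))}+\sum_{j=1}^{m-1}\sqrt\tau\,\|\partial_x^j u-q_j\|_{L^\infty(0,T;L^2(\Omega))}\le C\,\tau .$$ -/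

import Mathlib

noncomputable section

namespace HypApprox

open MeasureTheory Set Filter Topology

/-! ## The periodic domain

The spatial domain is the circle `Ω = ℝ / Lℤ`, represented by the fundamental cell `(0, L)`.
Functions on `(0, T) × Ω` are functions on `ℝ × ℝ` (time first) of which only the values on
`(0, T) × (0, L)`, up to null sets, matter. Periodicity enters through the test functions, which
are smooth and `L`-periodic in space (and need not vanish at `x = 0` and `x = L`). -/

/-- Lebesgue measure on `Ω`. -/
def space (L : ℝ) : Measure ℝ := volume.restrict (Ioo 0 L)

/-- Lebesgue measure on `(0, T) × Ω`. -/
def cyl (T L : ℝ) : Measure (ℝ × ℝ) := volume.restrict (Ioo 0 T ×ˢ Ioo 0 L)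

/-- Time derivative `∂_t φ` of a smooth function. -/
def dt (φ : ℝ × ℝ → ℝ) : ℝ × ℝ → ℝ := fun p => deriv (fun s => φ (s, p.2)) p.1

/-- Space derivative `∂_x φ` of a smooth function. -/
def dx (φ : ℝ × ℝ → ℝ) : ℝ × ℝ → ℝ := fun p => deriv (fun y => φ (p.1, y)) p.2

/-- Smooth functions on `ℝ × Ω`. -/
structure IsSmoothPeriodic (L : ℝ) (φ : ℝ × ℝ → ℝ) : Prop where
  smooth : ContDiff ℝ ((⊤ : ℕ∞) : WithTop ℕ∞) φ
  periodic : ∀ t x, φ (t, x + L) = φ (t, x)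

/-- Test functions in `C_c^∞((0, T) × Ω)`. -/
def IsInteriorTest (T L : ℝ) (φ : ℝ × ℝ → ℝ) : Prop :=
  IsSmoothPeriodic L φ ∧ ∃ a b, 0 < a ∧ b < T ∧ ∀ t x, (t < a ∨ b < t) → φ (t, x) = 0

/-- Test functions in `C_c^∞([0, T) × Ω)`: they may be nonzero at the initial time. -/
def IsCauchyTest (T L : ℝ) (φ : ℝ × ℝ → ℝ) : Prop :=
  IsSmoothPeriodic L φ ∧ ∃ b, b < T ∧ ∀ t x, b < t → φ (t, x) = 0

/-! ## Weak derivatives and Sobolev spaces -/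

/-- `v` is the weak derivative `∂_t^a ∂_x^b u` on `(0, T) × Ω`. -/
structure HasWeakDeriv (T L : ℝ) (a b : ℕ) (u v : ℝ × ℝ → ℝ) : Prop where
  integrable_left : Integrable u (cyl T L)
  integrable_right : Integrable v (cyl T L)
  integral_eq : ∀ φ, IsInteriorTest T L φ →
    ∫ p, u p * (dt^[a] (dx^[b] φ)) p ∂(cyl T L) = (-1) ^ (a + b) * ∫ p, v p * φ p ∂(cyl T L)

/-- `u ∈ W^{m,∞}((0, T) × Ω)`: all weak space-time derivatives of order at most `m` exist and
are essentially bounded. -/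
def MemSobolevInf (T L : ℝ) (m : ℕ) (u : ℝ × ℝ → ℝ) : Prop :=
  ∀ a b : ℕ, a + b ≤ m → ∃ v, MemLp v ⊤ (cyl T L) ∧ HasWeakDeriv T L a b u v

/-- `v` is the `k`-th weak derivative of `u` on the circle `Ω`. -/
structure HasSpaceWeakDeriv (L : ℝ) (k : ℕ) (u v : ℝ → ℝ) : Prop where
  integrable_left : Integrable u (space L)
  integrable_right : Integrable v (space L)
  integral_eq : ∀ ψ : ℝ → ℝ, ContDiff ℝ ((⊤ : ℕ∞) : WithTop ℕ∞) ψ → Function.Periodic ψ L →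
    ∫ x, u x * iteratedDeriv k ψ x ∂(space L) = (-1) ^ k * ∫ x, v x * ψ x ∂(space L)

/-- `u ∈ W^{m,∞}(Ω)`. -/
def MemSpaceSobolevInf (L : ℝ) (m : ℕ) (u : ℝ → ℝ) : Prop :=
  ∀ k ≤ m, ∃ v, MemLp v ⊤ (space L) ∧ HasSpaceWeakDeriv L k u v

/-- `g` is the `k`-th weak derivative of `f` on `ℝ`. -/
structure HasLineWeakDeriv (k : ℕ) (f g : ℝ → ℝ) : Prop where
  locallyIntegrable_left : LocallyIntegrable f
  locallyIntegrable_right : LocallyIntegrable g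
  integral_eq : ∀ ψ : ℝ → ℝ, ContDiff ℝ ((⊤ : ℕ∞) : WithTop ℕ∞) ψ → HasCompactSupport ψ →
    ∫ x, f x * iteratedDeriv k ψ x = (-1) ^ k * ∫ x, g x * ψ x

/-- `f ∈ W^{2,∞}_loc(ℝ)` with `f'' ∈ L^∞(ℝ)`. As `f` is composed with other functions, it is
the continuous representative of its class. -/
structure IsAdmissibleFlux (f : ℝ → ℝ) : Prop where
  continuous : Continuous f
  sobolev_loc : ∀ k ≤ 2, ∃ g, (∀ K, IsCompact K → MemLp g ⊤ (volume.restrict K)) ∧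
    HasLineWeakDeriv k f g
  second_bounded : ∃ g, MemLp g ⊤ volume ∧ HasLineWeakDeriv 2 f g

/-- The (extended) norm of `L^∞(0, T; L²(Ω))`. -/
def normLinfL2 (T L : ℝ) (g : ℝ × ℝ → ℝ) : ENNReal :=
  essSup (fun t => eLpNorm (fun x => g (t, x)) 2 (space L)) (volume.restrict (Ioo 0 T))

/-! ## The limit equation -/

/-- `σ₀ = (-1)^{m/2}` (for even `m`). -/
def sigma (m : ℕ) : ℝ := (-1) ^ (m / 2)

/-- `u` solves `∂_t u + ∂_x f(u) + σ₀ ∂_x^m u = 0` almost everywhere in `(0, T) × Ω`, the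
derivatives being weak ones, and `u(t) → u₀` in `L²(Ω)` as `t → 0` (outside a null set of
times). -/
structure IsLimitSolution (T L : ℝ) (m : ℕ) (f : ℝ → ℝ) (u : ℝ × ℝ → ℝ) (u₀ : ℝ → ℝ) :
    Prop where
  equation : ∃ ut fx um : ℝ × ℝ → ℝ,
    HasWeakDeriv T L 1 0 u ut ∧ HasWeakDeriv T L 0 1 (fun p => f (u p)) fx ∧
    HasWeakDeriv T L 0 m u um ∧ ∀ᵐ p ∂(cyl T L), ut p + fx p + sigma m * um p = 0
  initial : Tendsto (fun t => eLpNorm (fun x => u (t, x) - u₀ x) 2 (space L))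
    (𝓝[>] 0 ⊓ ae volume) (𝓝 0)

/-! ## The hyperbolic approximation

The unknowns are `q 0, …, q (m - 1)`; other indices are not used. -/

/-- The sign `σ₀ (-1)^j` for `j ≤ ⌈m/2⌉ - 1` and `σ₀ (-1)^(j+m-1)` for `j ≥ ⌈m/2⌉` in the
equation `τ ∂_t q_j + sgn_j ∂_x q_{m-j-1} = sgn_j q_{m-j}`. -/
def sgn (m j : ℕ) : ℝ :=
  if j < (m + 1) / 2 then sigma m * (-1) ^ j else sigma m * (-1) ^ (j + m - 1)

/-- The energy density `½ y₀² + (τ/2) ∑_{j=1}^{m-1} y_j²`. -/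
def energy (m : ℕ) (τ : ℝ) (y : ℕ → ℝ) : ℝ :=
  y 0 ^ 2 / 2 + τ / 2 * ∑ j ∈ Finset.Ico 1 m, y j ^ 2

/-- The function `μ` with `μ'(a) = a f'(a)` and `μ(0) = 0`. -/
def mu (f : ℝ → ℝ) (a : ℝ) : ℝ := ∫ s in (0 : ℝ)..a, s * deriv f s

/-- The energy flux `μ(y₀) + σ₀ ∑_{j=0}^{m/2-1} (-1)^j y_j y_{m-1-j}` (for even `m`). Its
divergence is `y₀ ∂_x f(y₀) + σ₀ y₀ ∂_x y_{m-1} + ∑_{j=1}^{m-1} sgn_j y_j ∂_x y_{m-j-1}`. -/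
def energyFlux (m : ℕ) (f : ℝ → ℝ) (y : ℕ → ℝ) : ℝ :=
  mu f (y 0) + sigma m * ∑ j ∈ Finset.range (m / 2), (-1) ^ j * (y j * y (m - 1 - j))

/-- `q` is a weak entropy solution on `(0, T) × Ω`, with initial data `r`, of

`∂_t q₀ + ∂_x f(q₀) + σ₀ ∂_x q_{m-1} = 0`,
`τ ∂_t q_j + sgn_j ∂_x q_{m-j-1} = sgn_j q_{m-j}` for `1 ≤ j ≤ m - 1`.

The components have finite energy, the energy flux is integrable (both hold for bounded `q`),
the equations hold in the sense of distributions with initial data, and so does the inequality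
`∂_t energy(q) + ∂_x energyFlux(q) ≤ - q_{m/2}²`, whose right-hand side is the production
`∑_{j=1}^{m-1} sgn_j q_j q_{m-j}` of energy by the source terms (`m` even). -/
structure IsEntropySolution (T L : ℝ) (m : ℕ) (f : ℝ → ℝ) (τ : ℝ) (r : ℕ → ℝ → ℝ)
    (q : ℕ → ℝ × ℝ → ℝ) : Prop where
  memLp : ∀ j < m, MemLp (q j) 2 (cyl T L)
  integrable_mu : Integrable (fun p => mu f (q 0 p)) (cyl T L)
  equation_zero : ∀ φ, IsCauchyTest T L φ →
    (∫ p, (q 0 p * dt φ p + f (q 0 p) * dx φ p + sigma m * q (m - 1) p * dx φ p) ∂(cyl T L))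
      + ∫ x, r 0 x * φ (0, x) ∂(space L) = 0
  equation : ∀ j, 1 ≤ j → j < m → ∀ φ, IsCauchyTest T L φ →
    (∫ p, (τ * q j p * dt φ p + sgn m j * q (m - j - 1) p * dx φ p
        + sgn m j * q (m - j) p * φ p) ∂(cyl T L))
      + ∫ x, τ * r j x * φ (0, x) ∂(space L) = 0
  entropy : ∀ φ, IsCauchyTest T L φ → (∀ p, 0 ≤ φ p) →
    0 ≤ (∫ p, (energy m τ (fun j => q j p) * dt φ p
          + energyFlux m f (fun j => q j p) * dx φ p
          - q (m / 2) p ^ 2 * φ p) ∂(cyl T L))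
        + ∫ x, energy m τ (fun j => r j x) * φ (0, x) ∂(space L)

end HypApprox

end

/-!
The proof compares an entropy solution `q` with a smooth field `P` through the relative energy
`∫ energy (q - P)`. As the energy is quadratic, its growth is controlled by testing the entropy
inequality with a function `θ` of time and the equations with `θ P_j`
(`IsEntropySolution.relative_energy`). What remains is the production of relative energy, which
consists of an exact space derivative, the damping `-(q_n - P_n)²` with `n = m / 2`, a quadratic
term from the flux, and the residuals of `P` in the equations, paired with `q - P`
(`relative_production_identity`).

For `P_j = ∂_x^j u` the residuals are `τ ∂_t ∂_x^j u`. Since `(q_j - P_j)²` carries the weight `τ`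
in the energy, they would only give a relative energy of order `τ` and an error of order `√τ`. The
right comparison is the corrected profile `P_j = ∂_x^j u + τ w_j`, in which the `w_j` solve
`∂_x w_{j-1} - w_j = sgn_j ∂_t ∂_x^{m-j} u` for `j ≠ n`, starting from `w_{n-1} = w_n = 0` and going
away from the middle in both directions. This reduces the residuals to `τ² ∂_t w_j`
(`residual_eq_of_ne`), except in the middle equation, where the residual `τ ∂_t ∂_x^n u` is absorbed
by the damping (`residual_eq_mid`), and in the zeroth one, where an error of order `τ` is admissible
as `(q_0 - P_0)²` has a weight of order one (`abs_zeroth_residual_le`). Hence the relative energy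
grows at most exponentially up to a source of order `τ²` (`exists_relative_production_bound`), and
it starts at order `τ²`, so it stays of this order. This gives errors of order `τ` in `q_0` and `√τ`
in the other components.

The profile involves derivatives of `u` of order up to `m`, which are merely bounded, whereas test
functions have to be smooth. Therefore `u` is replaced by a mollification at scale `ε`, periodic in
space and looking forward in time, which is defined on `[0, T - ε]` with no boundary effect at the
initial time. The mollified jet satisfies the limit equation up to `O(ε)`: the commutator with the
flux is of this order because `u` is Lipschitz (`abs_moll_comp_sub_le`), and the initial data are
attained with the same accuracy (`ae_abs_initial_sub_moll_le`). All constants depend on the jet only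
through its bounds, and `ε → 0` at the end, for fixed `τ`.

The relative energy is only an integrable function of time. In place of Grönwall's lemma, the
differential inequality is tested with `e^{-Ct}` times a steep cutoff, and Lebesgue's
differentiation theorem gives the bound for almost every time
(`ae_le_of_weak_differential_inequality`).
-/

namespace HypApprox

open MeasureTheory Set Filter Topology

local notation "smoothOrder" => ((⊤ : ℕ∞) : WithTop ℕ∞)

/-! ### Averages against concentrating kernels, and the regularity of the flux -/

/-- Lebesgue's differentiation theorem for kernels `K n` of mass one which live on balls around `z`
and are bounded by a multiple of the reciprocal of the volume of the ball. The kernels need be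
neither nonnegative nor centred, which is what one-sided mollification needs. -/
theorem ae_tendsto_integral_mul_kernel {E : Type*} [MetricSpace E] [ProperSpace E]
    [MeasurableSpace E] [BorelSpace E] [SecondCountableTopology E] (μ : Measure E)
    [IsUnifLocDoublingMeasure μ] [IsLocallyFiniteMeasure μ] {g : E → ℝ}
    (hg : LocallyIntegrable g μ) (C : ℝ) :
    ∀ᵐ z ∂μ, ∀ (r : ℕ → ℝ) (K : ℕ → E → ℝ), Tendsto r atTop (𝓝[>] 0) →
      (∀ᶠ n in atTop, AEStronglyMeasurable (K n) μ ∧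
        (∀ y, |K n y| ≤ C / μ.real (Metric.closedBall z (r n))) ∧
        (∀ y, y ∉ Metric.closedBall z (r n) → K n y = 0) ∧ ∫ y, K n y ∂μ = 1) →
      Tendsto (fun n => ∫ y, g y * K n y ∂μ) atTop (𝓝 (g z)) := by
  filter_upwards [IsUnifLocDoublingMeasure.ae_tendsto_average_norm_sub μ hg 1] with z hz r K hr hK
  have hr0 : ∀ᶠ n in atTop, 0 < r n := hr.eventually self_mem_nhdsWithin
  have h := hz (fun _ : ℕ => z) r hr (by
    filter_upwards [hr0] with n hn
    rw [one_mul]; exact Metric.mem_closedBall_self hn.le)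
  rw [tendsto_iff_norm_sub_tendsto_zero]
  have h' := h.const_mul C
  rw [mul_zero] at h'
  refine squeeze_zero' (Eventually.of_forall fun n => norm_nonneg _) ?_ h'
  filter_upwards [hK] with n ⟨hm, hb, hs, h1⟩
  set B := Metric.closedBall z (r n) with hB
  have hBc : IsCompact B := isCompact_closedBall z (r n)
  have hBm : MeasurableSet B := hBc.measurableSet
  have hgB : IntegrableOn g B μ := hg.integrableOn_isCompact hBc
  have hKB : IntegrableOn (K n) B μ := by
    refine Measure.integrableOn_of_bounded hBc.measure_lt_top.ne hm
      (M := C / μ.real B) ?_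
    exact Eventually.of_forall hb
  have hgK : IntegrableOn (fun y => g y * K n y) B μ :=
    hgB.mul_bdd hm.restrict (Eventually.of_forall hb)
  have e1 : ∫ y, g y * K n y ∂μ = ∫ y in B, g y * K n y ∂μ := by
    rw [setIntegral_eq_integral_of_forall_compl_eq_zero]
    intro y hy; rw [hs y hy, mul_zero]
  have e2 : g z = ∫ y in B, g z * K n y ∂μ := by
    rw [setIntegral_eq_integral_of_forall_compl_eq_zero, integral_const_mul, h1, mul_one]
    intro y hy; rw [hs y hy, mul_zero]
  have e3 : (∫ y, g y * K n y ∂μ) - g z = ∫ y in B, (g y - g z) * K n y ∂μ := by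
    conv_lhs => rw [e1, e2]
    rw [← integral_sub hgK (hKB.const_mul _)]
    simp only [sub_mul]
  have hd : IntegrableOn (fun y => g y - g z) B μ :=
    hgB.sub (integrableOn_const hBc.measure_lt_top.ne)
  rw [e3, setAverage_eq, smul_eq_mul, ← mul_assoc, ← div_eq_mul_inv]
  refine (norm_integral_le_integral_norm _).trans ?_
  rw [← integral_const_mul]
  refine integral_mono_of_nonneg (Eventually.of_forall fun y => norm_nonneg _)
    (hd.norm.const_mul _) (Eventually.of_forall fun y => ?_)
  simp only [norm_mul, Real.norm_eq_abs]
  rw [mul_comm]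
  exact mul_le_mul_of_nonneg_right (hb y) (abs_nonneg _)

theorem lipschitz_const_nonneg {f' : ℝ → ℝ} {K : ℝ}
    (hK : ∀ x y, |f' x - f' y| ≤ K * |x - y|) : 0 ≤ K := by
  have h1 := hK 1 0
  have h2 := abs_nonneg (f' 1 - f' 0)
  norm_num at h1
  linarith

theorem taylor_bound_of_lipschitz_deriv {F F' : ℝ → ℝ} {K : ℝ} (hF : ∀ x, HasDerivAt F (F' x) x)
    (hK : ∀ x y, |F' x - F' y| ≤ K * |x - y|) (x y : ℝ) :
    |F y - F x - F' x * (y - x)| ≤ K * (y - x) ^ 2 := by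
  have hK0 := lipschitz_const_nonneg hK
  have hconv : Convex ℝ (Set.uIcc x y) := convex_uIcc x y
  have key := hconv.norm_image_sub_le_of_norm_hasDerivWithin_le
    (f := fun z => F z - F' x * z) (f' := fun z => F' z - F' x) (C := K * |y - x|)
    (fun z _ => by
      have := ((hF z).fun_sub ((hasDerivAt_id z).const_mul (F' x))).hasDerivWithinAt
        (s := Set.uIcc x y)
      simpa using this)
    (fun z hz => by
      refine (hK z x).trans (mul_le_mul_of_nonneg_left ?_ hK0)
      exact Set.abs_sub_left_of_mem_uIcc hz)
    Set.left_mem_uIcc Set.right_mem_uIcc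
  have e : F y - F x - F' x * (y - x) = (F y - F' x * y) - (F x - F' x * x) := by ring
  rw [e, ← sq_abs (y - x)]
  simpa [Real.norm_eq_abs, pow_two, mul_assoc] using key

theorem lipschitz_of_deriv_bound {F F' : ℝ → ℝ} {K : ℝ} (hF : ∀ x, HasDerivAt F (F' x) x)
    (hK : ∀ x, |F' x| ≤ K) (x y : ℝ) : |F x - F y| ≤ K * |x - y| :=
  convex_univ.norm_image_sub_le_of_norm_hasDerivWithin_le
    (fun z _ => (hF z).hasDerivWithinAt) (fun z _ => hK z) (mem_univ y) (mem_univ x)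

/-- A pointwise limit of `C¹` functions whose derivatives share a Lipschitz constant is `C¹`, and
its derivative has the same Lipschitz constant: by Taylor's formula the difference quotients control
the derivatives, so these converge as well. -/
theorem exists_deriv_of_tendsto {f : ℝ → ℝ} {F F' : ℕ → ℝ → ℝ} {K : ℝ}
    (hF : ∀ n x, HasDerivAt (F n) (F' n x) x)
    (hK : ∀ n x y, |F' n x - F' n y| ≤ K * |x - y|)
    (hlim : ∀ x, Tendsto (fun n => F n x) atTop (𝓝 (f x))) :
    ∃ f' : ℝ → ℝ, (∀ x, HasDerivAt f (f' x) x) ∧ ∀ x y, |f' x - f' y| ≤ K * |x - y| := by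
  have hK0 := lipschitz_const_nonneg (hK 0)
  have hT := fun n => taylor_bound_of_lipschitz_deriv (hF n) (hK n)
  have hcauchy : ∀ x, ∃ l, Tendsto (fun n => F' n x) atTop (𝓝 l) := by
    intro x
    refine cauchySeq_tendsto_of_complete ?_
    rw [Metric.cauchySeq_iff]
    intro ε hε
    -- the step is chosen such that the second order Taylor error is a small part of `ε h`
    set h := ε / (4 * (K + 1)) with hh
    have hpos : 0 < h := by positivity
    have hKh : K * h ≤ ε / 4 := by
      rw [hh, mul_div_assoc', div_le_div_iff₀ (by positivity) (by norm_num)]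
      nlinarith
    obtain ⟨N1, hN1⟩ := (Metric.cauchySeq_iff.1 (hlim x).cauchySeq) (ε / 8 * h) (by positivity)
    obtain ⟨N2, hN2⟩ := (Metric.cauchySeq_iff.1 (hlim (x + h)).cauchySeq) (ε / 8 * h)
      (by positivity)
    refine ⟨max N1 N2, fun a ha b hb => ?_⟩
    have h1 := hN1 a (le_of_max_le_left ha) b (le_of_max_le_left hb)
    have h2 := hN2 a (le_of_max_le_right ha) b (le_of_max_le_right hb)
    have h3 := hT a x (x + h)
    have h4 := hT b x (x + h)
    rw [Real.dist_eq] at *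
    simp only [add_sub_cancel_left] at h3 h4
    have h5 : |F' a x - F' b x| * h < ε * h := by
      rw [← abs_of_pos hpos, ← abs_mul, abs_of_pos hpos]
      rw [abs_lt] at *
      rw [abs_le] at *
      have : K * h ^ 2 ≤ ε / 4 * h := by nlinarith
      constructor <;> nlinarith
    exact lt_of_mul_lt_mul_right h5 hpos.le
  choose f' hf' using hcauchy
  have hTay : ∀ x y, |f y - f x - f' x * (y - x)| ≤ K * (y - x) ^ 2 := fun x y =>
    le_of_tendsto (((((hlim y).sub (hlim x)).sub ((hf' x).mul_const (y - x)))).abs)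
      (Eventually.of_forall fun n => hT n x y)
  refine ⟨f', fun x => ?_, fun x y => ?_⟩
  · rw [hasDerivAt_iff_isLittleO]
    have hO : (fun y => f y - f x - (y - x) • f' x) =O[𝓝 x] fun y => (y - x) ^ 2 := by
      refine Asymptotics.IsBigO.of_bound K (Eventually.of_forall fun y => ?_)
      have := hTay x y
      rw [smul_eq_mul, mul_comm (y - x), Real.norm_eq_abs, Real.norm_eq_abs,
        abs_of_nonneg (sq_nonneg (y - x))]
      exact this
    refine hO.trans_isLittleO ?_
    have h0 : Tendsto (fun y => y - x) (𝓝 x) (𝓝 0) := by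
      have : Tendsto (fun y => y - x) (𝓝 x) (𝓝 (x - x)) :=
        (continuous_id.sub continuous_const).tendsto x
      simpa using this
    exact (Asymptotics.isLittleO_pow_id (by norm_num : 1 < 2)).comp_tendsto h0
  · exact le_of_tendsto (((hf' x).sub (hf' y)).abs) (Eventually.of_forall fun n => hK n x y)

/-- An admissible flux is differentiable with a Lipschitz derivative: the mollified fluxes have
second derivatives bounded by the essential supremum of `f''`, and they converge to `f`. -/
theorem IsAdmissibleFlux.exists_deriv {f : ℝ → ℝ} (hf : IsAdmissibleFlux f) :
    ∃ (f' : ℝ → ℝ) (K : ℝ), (∀ x, HasDerivAt f (f' x) x) ∧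
      ∀ x y, |f' x - f' y| ≤ K * |x - y| := by
  obtain ⟨g, hg, hw⟩ := hf.second_bounded
  set K := (eLpNorm g ⊤ volume).toReal with hKdef
  have hgK : ∀ᵐ x, |g x| ≤ K := by
    filter_upwards [ae_le_eLpNormEssSup (f := g) (μ := volume)] with x hx
    rw [hKdef, eLpNorm_exponent_top]
    have := ENNReal.toReal_mono (by simpa using hg.eLpNorm_ne_top) hx
    simpa using this
  let φ : ℕ → ContDiffBump (0 : ℝ) := fun n =>
    ⟨1 / (2 * ((n : ℝ) + 1)), 1 / ((n : ℝ) + 1), by positivity, by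
      apply one_div_lt_one_div_of_lt <;> linarith [(Nat.cast_nonneg n : (0 : ℝ) ≤ n)]⟩
  let ρ : ℕ → ℝ → ℝ := fun n => (φ n).normed volume
  have hρs : ∀ n, ContDiff ℝ smoothOrder (ρ n) := fun n => (φ n).contDiff_normed
  have hρc : ∀ n, HasCompactSupport (ρ n) := fun n => (φ n).hasCompactSupport_normed
  have hρ's : ∀ n, ContDiff ℝ smoothOrder (deriv (ρ n)) := fun n =>
    (contDiff_infty_iff_deriv.1 (hρs n)).2
  have hfl := hw.locallyIntegrable_left
  let M := ContinuousLinearMap.mul ℝ ℝ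
  have h1 : ∀ n x, HasDerivAt (convolution f (ρ n) M volume)
      (convolution f (deriv (ρ n)) M volume x) x :=
    fun n x => (hρc n).hasDerivAt_convolution_right M hfl
      ((hρs n).of_le (by exact_mod_cast le_top)) x
  have h2 : ∀ n x, HasDerivAt (convolution f (deriv (ρ n)) M volume)
      (convolution f (deriv (deriv (ρ n))) M volume x) x :=
    fun n x => (hρc n).deriv.hasDerivAt_convolution_right M hfl
      ((hρ's n).of_le (by exact_mod_cast le_top)) x
  have h3 : ∀ n x, |convolution f (deriv (deriv (ρ n))) M volume x| ≤ K := by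
    intro n x
    have hψ := hw.integral_eq (fun t => ρ n (x - t)) ((hρs n).comp (contDiff_const.sub contDiff_id))
      ((hρc n).comp_homeomorph (Homeomorph.subLeft x))
    have hd : iteratedDeriv 2 (fun t => ρ n (x - t)) = fun t => deriv (deriv (ρ n)) (x - t) := by
      rw [iteratedDeriv_succ, iteratedDeriv_one]
      have e1 : deriv (fun t => ρ n (x - t)) = fun t => - deriv (ρ n) (x - t) := by
        funext t; rw [deriv_comp_const_sub]
      rw [e1]
      funext t
      rw [deriv.fun_neg, deriv_comp_const_sub (f := deriv (ρ n)), neg_neg]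
    have : convolution f (deriv (deriv (ρ n))) M volume x = ∫ t, g t * ρ n (x - t) := by
      rw [hd] at hψ
      simpa [convolution, M] using hψ
    rw [this]
    have hint : ∫ t, ρ n (x - t) = 1 := by
      rw [integral_sub_left_eq_self (fun t => ρ n t)]
      exact (φ n).integral_normed
    have hρint : Integrable (fun t => ρ n (x - t)) := by
      exact ((hρs n).continuous.integrable_of_hasCompactSupport (hρc n)).comp_sub_left x
    calc |∫ t, g t * ρ n (x - t)| ≤ ∫ t, |g t * ρ n (x - t)| := abs_integral_le_integral_abs
      _ ≤ ∫ t, K * ρ n (x - t) := by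
        refine integral_mono_of_nonneg (Eventually.of_forall fun t => abs_nonneg _)
          (hρint.const_mul K) ?_
        filter_upwards [hgK] with t ht
        rw [abs_mul, abs_of_nonneg ((φ n).nonneg_normed _)]
        exact mul_le_mul_of_nonneg_right ht ((φ n).nonneg_normed _)
      _ = K := by rw [integral_const_mul, hint, mul_one]
  have h4 : ∀ x, Tendsto (fun n => convolution f (ρ n) M volume x) atTop (𝓝 (f x)) := by
    intro x
    have hlim : Tendsto (fun n => (φ n).rOut) atTop (𝓝 0) := tendsto_one_div_add_atTop_nhds_zero_nat
    have := ContDiffBump.convolution_tendsto_right_of_continuous (μ := volume) hlim hf.continuous x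
    refine this.congr fun n => ?_
    rw [← convolution_flip]
    simp [convolution, M, ρ, mul_comm]
  obtain ⟨f', hf', hl⟩ := exists_deriv_of_tendsto h1
    (fun n => lipschitz_of_deriv_bound (h2 n) (h3 n)) h4
  exact ⟨f', K, hf', hl⟩

/-! ### One-sided and periodic bumps -/

/-- A smooth probability density on `ℝ` which vanishes outside `(1/4, 3/4)`. The support lies to the
right of `0`, so that averaging against it only looks forward in time. -/
noncomputable def baseBump : ℝ → ℝ :=
  (⟨1 / 8, 1 / 4, by norm_num, by norm_num⟩ : ContDiffBump (1 / 2 : ℝ)).normed volume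

theorem baseBump_contDiff : ContDiff ℝ smoothOrder baseBump :=
  ContDiffBump.contDiff_normed _

theorem baseBump_nonneg (s : ℝ) : 0 ≤ baseBump s := ContDiffBump.nonneg_normed _ s

theorem baseBump_hasCompactSupport : HasCompactSupport baseBump :=
  ContDiffBump.hasCompactSupport_normed _

theorem integral_baseBump : ∫ s, baseBump s = 1 := ContDiffBump.integral_normed _

theorem baseBump_eq_zero {s : ℝ} (hs : s ≤ 1 / 4 ∨ 3 / 4 ≤ s) : baseBump s = 0 := by
  have h := ContDiffBump.support_normed_eq
    (⟨1 / 8, 1 / 4, by norm_num, by norm_num⟩ : ContDiffBump (1 / 2 : ℝ)) (μ := volume)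
  have : s ∉ Function.support baseBump := by
    unfold baseBump
    rw [h, Metric.mem_ball, Real.dist_eq]
    intro h'
    rw [abs_lt] at h'
    simp only at h'
    rcases hs with hs | hs <;> linarith [h'.1, h'.2]
  simpa using this

theorem exists_baseBump_bound :
    ∃ C : ℝ, 0 < C ∧ (∀ s, baseBump s ≤ C) ∧ ∀ s, |deriv baseBump s| ≤ C := by
  obtain ⟨C₁, h₁⟩ := baseBump_hasCompactSupport.exists_bound_of_continuous
    baseBump_contDiff.continuous
  obtain ⟨C₂, h₂⟩ := baseBump_hasCompactSupport.deriv.exists_bound_of_continuous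
    (contDiff_infty_iff_deriv.1 baseBump_contDiff).2.continuous
  refine ⟨max 1 (max C₁ C₂), lt_max_of_lt_left one_pos, fun s => ?_, fun s => ?_⟩
  · exact ((le_abs_self _).trans (h₁ s)).trans ((le_max_left _ _).trans (le_max_right _ _))
  · exact (h₂ s).trans ((le_max_right _ _).trans (le_max_right _ _))

/-- The rescaled density `ε⁻¹ baseBump (s / ε)`, supported in `(ε/4, 3ε/4)`. -/
noncomputable def bump (ε s : ℝ) : ℝ := ε⁻¹ * baseBump (s / ε)

theorem bump_contDiff (ε : ℝ) : ContDiff ℝ smoothOrder (bump ε) :=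
  contDiff_const.mul (baseBump_contDiff.comp (contDiff_id.div_const ε))

theorem bump_nonneg {ε : ℝ} (hε : 0 < ε) (s : ℝ) : 0 ≤ bump ε s :=
  mul_nonneg (inv_nonneg.2 hε.le) (baseBump_nonneg _)

theorem bump_eq_zero {ε s : ℝ} (hε : 0 < ε) (hs : s ≤ ε / 4 ∨ 3 * ε / 4 ≤ s) : bump ε s = 0 := by
  rw [bump, baseBump_eq_zero, mul_zero]
  rcases hs with h | h
  · left; rw [div_le_iff₀ hε]; linarith
  · right; rw [le_div_iff₀ hε]; linarith

theorem integral_bump {ε : ℝ} (hε : 0 < ε) : ∫ s, bump ε s = 1 := by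
  unfold bump
  rw [integral_const_mul, Measure.integral_comp_div (fun s => baseBump s) ε, integral_baseBump,
    abs_of_pos hε, smul_eq_mul, mul_one, inv_mul_cancel₀ hε.ne']

theorem deriv_bump (ε s : ℝ) : deriv (bump ε) s = ε⁻¹ * (ε⁻¹ * deriv baseBump (s / ε)) := by
  have h : HasDerivAt baseBump (deriv baseBump (s / ε)) (s / ε) :=
    ((baseBump_contDiff.differentiable (by simp)) _).hasDerivAt
  have h2 := (h.comp s ((hasDerivAt_id s).div_const ε)).const_mul ε⁻¹
  have h3 := h2.deriv
  rw [one_div] at h3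
  rw [mul_comm ε⁻¹ (deriv baseBump _)]
  exact h3

theorem bump_le {ε C : ℝ} (hε : 0 < ε) (hC : ∀ s, baseBump s ≤ C) (s : ℝ) :
    bump ε s ≤ C / ε := by
  rw [bump, div_eq_inv_mul C]
  exact mul_le_mul_of_nonneg_left (hC _) (inv_nonneg.2 hε.le)

theorem abs_deriv_bump_le {ε C : ℝ} (hε : 0 < ε) (hC : ∀ s, |deriv baseBump s| ≤ C) (s : ℝ) :
    |deriv (bump ε) s| ≤ C / ε / ε := by
  rw [deriv_bump, abs_mul, abs_mul, abs_of_pos (inv_pos.2 hε), div_eq_inv_mul (C / ε),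
    div_eq_inv_mul C]
  have := hC (s / ε)
  gcongr

theorem setIntegral_bump {ε a b : ℝ} (hε : 0 < ε) (ha : a ≤ 0) (hb : ε ≤ b) :
    ∫ s in Ioo a b, bump ε s = 1 := by
  rw [setIntegral_eq_integral_of_forall_compl_eq_zero, integral_bump hε]
  intro s hs
  apply bump_eq_zero hε
  by_contra! h
  exact hs ⟨by linarith [h.1], by linarith [h.2]⟩

/-- The `L`-periodization of `bump ε` for `ε < L`. As the support of the bump lies inside `(0, L)`,
the sum over the periods reduces to the value at the representative of `y` in `[0, L)`. -/
noncomputable def perBump (L ε y : ℝ) : ℝ := bump ε (L * Int.fract (y / L))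

theorem perBump_periodic {L : ℝ} (hL : 0 < L) (ε : ℝ) : Function.Periodic (perBump L ε) L := by
  intro y
  rw [perBump, perBump, add_div, div_self hL.ne', Int.fract_add_one]

theorem perBump_nonneg {ε : ℝ} (L : ℝ) (hε : 0 < ε) (y : ℝ) : 0 ≤ perBump L ε y :=
  bump_nonneg hε _

/-- On a whole neighbourhood of the cell `[kL, kL + L)` of the period lattice, the periodized bump
is a single translated bump. This gives its smoothness across the lattice points. -/
theorem perBump_eq_bump {L ε y : ℝ} (hL : 0 < L) (hε : 0 < ε) (k : ℤ)
    (h₁ : k * L - L + 3 * ε / 4 ≤ y) (h₂ : y < k * L + L) :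
    perBump L ε y = bump ε (y - k * L) := by
  rw [perBump]
  rcases le_or_gt (k * L) y with h | h
  · have hfl : ⌊y / L⌋ = k := by
      rw [Int.floor_eq_iff, le_div_iff₀ hL, div_lt_iff₀ hL]
      exact ⟨h, by linarith⟩
    rw [Int.fract, hfl]; congr 1; field_simp
  · have hfl : ⌊y / L⌋ = k - 1 := by
      rw [Int.floor_eq_iff, le_div_iff₀ hL, div_lt_iff₀ hL]
      push_cast
      exact ⟨by linarith, by linarith⟩
    rw [Int.fract, hfl, bump_eq_zero (s := y - k * L) hε (Or.inl (by linarith)),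
      bump_eq_zero hε]
    right
    push_cast
    have : L * (y / L - (k - 1)) = y - k * L + L := by field_simp; ring
    rw [this]; linarith

theorem perBump_contDiff {L ε : ℝ} (hL : 0 < L) (hε : 0 < ε) (hεL : ε < L) :
    ContDiff ℝ smoothOrder (perBump L ε) := by
  rw [contDiff_iff_contDiffAt]
  intro y
  set k := ⌊y / L⌋
  have h1 : k * L ≤ y := (le_div_iff₀ hL).1 (Int.floor_le _)
  have h2 : y < k * L + L := by
    have := (div_lt_iff₀ hL).1 (Int.lt_floor_add_one (y / L))
    linarith
  have : ContDiff ℝ smoothOrder (fun z => bump ε (z - k * L)) :=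
    (bump_contDiff ε).comp (contDiff_id.sub contDiff_const)
  refine this.contDiffAt.congr_of_eventuallyEq ?_
  filter_upwards [Ioo_mem_nhds (show k * L - L + 3 * ε / 4 < y by linarith) h2] with z hz
  exact perBump_eq_bump hL hε k hz.1.le hz.2

theorem exists_of_perBump_ne_zero {L ε y : ℝ} (hL : 0 < L) (hε : 0 < ε)
    (hy : perBump L ε y ≠ 0) : ∃ k : ℤ, 0 ≤ y - k * L ∧ y - k * L ≤ ε := by
  refine ⟨⌊y / L⌋, ?_⟩
  have e : L * Int.fract (y / L) = y - ⌊y / L⌋ * L := by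
    rw [Int.fract]; field_simp
  rw [perBump, e] at hy
  by_contra h
  apply hy
  apply bump_eq_zero hε
  by_contra! h'
  exact h ⟨by linarith [h'.1], by linarith [h'.2]⟩

theorem setIntegral_periodic_sub {g : ℝ → ℝ} {L : ℝ} (hL : 0 < L) (hg : Function.Periodic g L)
    (x : ℝ) : ∫ y in Ioo 0 L, g (y - x) = ∫ y in Ioo 0 L, g y := by
  rw [← integral_Ioc_eq_integral_Ioo, ← integral_Ioc_eq_integral_Ioo,
    ← intervalIntegral.integral_of_le hL.le, ← intervalIntegral.integral_of_le hL.le,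
    intervalIntegral.integral_comp_sub_right (fun y => g y) x]
  have := hg.intervalIntegral_add_eq (0 - x) 0
  rw [zero_add] at this
  rw [← this]; congr 1; ring

theorem integral_perBump {L ε : ℝ} (hL : 0 < L) (hε : 0 < ε) (hεL : ε < L) (x : ℝ) :
    ∫ y, perBump L ε (y - x) ∂(space L) = 1 := by
  rw [space, setIntegral_periodic_sub hL (perBump_periodic hL ε),
    ← setIntegral_bump hε le_rfl hεL.le]
  refine setIntegral_congr_fun measurableSet_Ioo fun y hy => ?_
  have := perBump_eq_bump hL hε 0 (y := y) (by simp; linarith [hy.1])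
    (by simpa using hy.2)
  simpa using this

theorem integral_abs_deriv_perBump_le {L ε C : ℝ} (hL : 0 < L) (hε : 0 < ε) (hεL : ε < L)
    (hC : ∀ s, |deriv baseBump s| ≤ C) (x : ℝ) :
    ∫ y, |deriv (perBump L ε) (y - x)| ∂(space L) ≤ C / ε := by
  have hper : Function.Periodic (fun y => |deriv (perBump L ε) y|) L := fun y => by
    have := (perBump_periodic hL ε)
    simp only
    rw [← deriv_comp_add_const, this.funext]
  rw [space, setIntegral_periodic_sub hL hper]
  have e : ∫ y in Ioo 0 L, |deriv (perBump L ε) y| = ∫ y in Ioo 0 L, |deriv (bump ε) y| := by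
    refine setIntegral_congr_fun measurableSet_Ioo fun y hy => ?_
    have : perBump L ε =ᶠ[𝓝 y] bump ε := by
      filter_upwards [Ioo_mem_nhds hy.1 hy.2] with z hz
      have := perBump_eq_bump hL hε 0 (y := z) (by simp; linarith [hz.1])
        (by simpa using hz.2)
      simpa using this
    simp only [this.deriv_eq]
  -- the bump vanishes beyond `3ε/4`, so its derivative vanishes from `ε` on
  have hzero : ∀ y ∈ Ioo 0 L \ Ioo 0 ε, |deriv (bump ε) y| = 0 := by
    intro y hy
    have h1 : ε ≤ y := by
      by_contra! h
      exact hy.2 ⟨hy.1.1, h⟩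
    have : bump ε =ᶠ[𝓝 y] fun _ => 0 := by
      filter_upwards [Ioi_mem_nhds (show 3 * ε / 4 < y by linarith)] with z hz
      exact bump_eq_zero hε (Or.inr (le_of_lt hz))
    rw [this.deriv_eq]; simp
  rw [e, setIntegral_eq_of_subset_of_forall_sdiff_eq_zero measurableSet_Ioo
    (Ioo_subset_Ioo_right hεL.le) hzero]
  have := norm_setIntegral_le_of_norm_le_const (μ := volume) (s := Ioo 0 ε)
    (f := fun y => |deriv (bump ε) y|) (C := C / ε / ε) (by simp)
    (fun y _ => by simpa using abs_deriv_bump_le hε hC y)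
  refine (le_abs_self _).trans (this.trans (le_of_eq ?_))
  rw [Measure.real, Real.volume_Ioo, sub_zero, ENNReal.toReal_ofReal hε.le]
  field_simp

theorem abs_perBump_le {L ε C : ℝ} (hε : 0 < ε) (hC : ∀ s, baseBump s ≤ C) (y : ℝ) :
    |perBump L ε y| ≤ C / ε := by
  rw [abs_of_nonneg (perBump_nonneg L hε y)]; exact bump_le hε hC _

/-! ### Calculus on the cylinder -/

theorem hasDerivAt_dt {φ : ℝ × ℝ → ℝ} (hφ : ContDiff ℝ smoothOrder φ) (t x : ℝ) :
    HasDerivAt (fun s => φ (s, x)) (dt φ (t, x)) t := by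
  have : ContDiff ℝ smoothOrder (fun s => φ (s, x)) := hφ.comp (contDiff_id.prodMk contDiff_const)
  exact (this.differentiable (by simp) t).hasDerivAt

theorem hasDerivAt_dx {φ : ℝ × ℝ → ℝ} (hφ : ContDiff ℝ smoothOrder φ) (t x : ℝ) :
    HasDerivAt (fun y => φ (t, y)) (dx φ (t, x)) x := by
  have : ContDiff ℝ smoothOrder (fun y => φ (t, y)) := hφ.comp (contDiff_const.prodMk contDiff_id)
  exact (this.differentiable (by simp) x).hasDerivAt

theorem dt_eq_fderiv {φ : ℝ × ℝ → ℝ} (hφ : ContDiff ℝ smoothOrder φ) :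
    dt φ = fun z => fderiv ℝ φ z (1, 0) := by
  funext ⟨t, x⟩
  have h := (hφ.differentiable (by simp) (t, x)).hasFDerivAt
  have h2 : HasDerivAt (fun s : ℝ => (s, x)) ((1 : ℝ), (0 : ℝ)) t :=
    (hasDerivAt_id t).prodMk (hasDerivAt_const t x)
  exact (h.comp_hasDerivAt t h2).deriv

theorem dx_eq_fderiv {φ : ℝ × ℝ → ℝ} (hφ : ContDiff ℝ smoothOrder φ) :
    dx φ = fun z => fderiv ℝ φ z (0, 1) := by
  funext ⟨t, x⟩
  have h := (hφ.differentiable (by simp) (t, x)).hasFDerivAt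
  have h2 : HasDerivAt (fun s : ℝ => (t, s)) ((0 : ℝ), (1 : ℝ)) x :=
    (hasDerivAt_const x t).prodMk (hasDerivAt_id x)
  exact (h.comp_hasDerivAt x h2).deriv

theorem contDiff_dt {φ : ℝ × ℝ → ℝ} (hφ : ContDiff ℝ smoothOrder φ) :
    ContDiff ℝ smoothOrder (dt φ) := by
  rw [dt_eq_fderiv hφ]
  exact (hφ.fderiv_right (m := smoothOrder) (by simp)).clm_apply contDiff_const

theorem contDiff_dx {φ : ℝ × ℝ → ℝ} (hφ : ContDiff ℝ smoothOrder φ) :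
    ContDiff ℝ smoothOrder (dx φ) := by
  rw [dx_eq_fderiv hφ]
  exact (hφ.fderiv_right (m := smoothOrder) (by simp)).clm_apply contDiff_const

theorem cyl_eq_prod (T L : ℝ) : cyl T L = (volume.restrict (Ioo 0 T)).prod (space L) := by
  rw [space, Measure.prod_restrict]; rfl

instance (T L : ℝ) : IsFiniteMeasure (cyl T L) := by
  rw [cyl_eq_prod, space]; infer_instance

instance (L : ℝ) : IsFiniteMeasure (space L) := by
  rw [space]; infer_instance

theorem ae_cyl_mem (T L : ℝ) : ∀ᵐ p ∂(cyl T L), p ∈ Ioo 0 T ×ˢ Ioo 0 L :=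
  ae_restrict_mem (measurableSet_Ioo.prod measurableSet_Ioo)

theorem integrable_cyl_mul_continuous {T L : ℝ} {g φ : ℝ × ℝ → ℝ} (hg : Integrable g (cyl T L))
    (hφ : Continuous φ) : Integrable (fun p => g p * φ p) (cyl T L) :=
  IntegrableOn.mul_continuousOn_of_subset (K := Icc 0 T ×ˢ Icc 0 L) hg hφ.continuousOn
    (measurableSet_Ioo.prod measurableSet_Ioo) (isCompact_Icc.prod isCompact_Icc)
    (prod_mono Ioo_subset_Icc_self Ioo_subset_Icc_self)

theorem integrable_cyl_of_continuous {T L : ℝ} {φ : ℝ × ℝ → ℝ} (hφ : Continuous φ) :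
    Integrable φ (cyl T L) := by
  simpa using integrable_cyl_mul_continuous (g := fun _ => (1 : ℝ)) (integrable_const _) hφ

theorem integrable_space_mul_continuous {L : ℝ} {g φ : ℝ → ℝ} (hg : Integrable g (space L))
    (hφ : Continuous φ) : Integrable (fun p => g p * φ p) (space L) :=
  IntegrableOn.mul_continuousOn_of_subset (K := Icc 0 L) hg hφ.continuousOn
    measurableSet_Ioo isCompact_Icc Ioo_subset_Icc_self

theorem integrable_space_of_continuous {L : ℝ} {φ : ℝ → ℝ} (hφ : Continuous φ) :
    Integrable φ (space L) := by
  simpa using integrable_space_mul_continuous (g := fun _ => (1 : ℝ)) (integrable_const _) hφ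

section ParametricIntegral

variable {T L : ℝ} {v K : ℝ × ℝ → ℝ}

/-- Averages of an integrable function against a smooth kernel are smooth, without any condition of
compact support on the kernel, because the cylinder is bounded. -/
theorem contDiff_integral_mul_sub (hv : Integrable v (cyl T L)) (hK : ContDiff ℝ smoothOrder K) :
    ContDiff ℝ smoothOrder (fun z => ∫ p, v p * K (p - z) ∂(cyl T L)) := by
  set S : Set (ℝ × ℝ) := Ioo 0 T ×ˢ Ioo 0 L with hS
  have hSm : MeasurableSet S := measurableSet_Ioo.prod measurableSet_Ioo
  -- a smooth cutoff which makes the kernel compactly supported without changing the integral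
  obtain ⟨χ, hχ1, hχc, hχs⟩ : ∃ χ : ℝ × ℝ → ℝ, (∀ p ∈ S, χ (-p) = 1) ∧ HasCompactSupport χ ∧
      ContDiff ℝ smoothOrder χ := by
    let b : ContDiffBump (0 : ℝ × ℝ) := ⟨|T| + |L| + 1, |T| + |L| + 2, by positivity, by linarith⟩
    refine ⟨b, fun p hp => b.one_of_mem_closedBall ?_, b.hasCompactSupport, b.contDiff⟩
    rw [mem_closedBall_zero_iff, norm_neg, Prod.norm_def]
    obtain ⟨⟨h1, h2⟩, h3, h4⟩ := hp
    have hb : b.rIn = |T| + |L| + 1 := rfl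
    rw [hb, Real.norm_eq_abs, Real.norm_eq_abs, abs_of_pos h1, abs_of_pos h3]
    have := le_abs_self T
    have := le_abs_self L
    have := abs_nonneg T
    have := abs_nonneg L
    exact max_le (by linarith) (by linarith)
  have h := contDiffOn_convolution_right_with_param (𝕜 := ℝ) (μ := (volume : Measure (ℝ × ℝ)))
    (f := S.indicator v) (n := ⊤) (ContinuousLinearMap.mul ℝ ℝ)
    (g := fun (z : ℝ × ℝ) p => χ p * K (-p - z)) (s := univ) (k := tsupport χ) isOpen_univ hχc
    (fun z p _ hp => by rw [image_eq_zero_of_notMem_tsupport hp, zero_mul])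
    ((integrable_indicator_iff hSm).2 hv).locallyIntegrable
    (by
      refine ContDiff.contDiffOn ?_
      exact (hχs.comp contDiff_snd).mul (hK.comp (contDiff_snd.neg.sub contDiff_fst)))
  rw [univ_prod_univ, contDiffOn_univ] at h
  have h2 := h.comp (contDiff_id.prodMk (contDiff_const (c := (0 : ℝ × ℝ))))
  convert h2 using 1
  funext z
  simp only [Function.comp, convolution, id, zero_sub, ContinuousLinearMap.mul_apply', neg_neg]
  rw [cyl, ← integral_indicator hSm]
  refine integral_congr_ae (Eventually.of_forall fun p => ?_)
  by_cases hp : p ∈ S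
  · simp [hp, hχ1 p hp]
  · simp [hp]

theorem dt_integral_mul_sub (hv : Integrable v (cyl T L)) (hK : ContDiff ℝ smoothOrder K) :
    dt (fun z => ∫ p, v p * K (p - z) ∂(cyl T L)) =
      fun z => -∫ p, v p * dt K (p - z) ∂(cyl T L) := by
  funext ⟨t, x⟩
  have hKc := hK.continuous
  have hdc := (contDiff_dt hK).continuous
  have hc : Continuous fun q : (ℝ × ℝ) × ℝ => dt K (q.1 - (q.2, x)) := by fun_prop
  obtain ⟨C, hC⟩ := ((isCompact_Icc (a := (0 : ℝ)) (b := T)).prod (isCompact_Icc (a := 0)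
    (b := L))).prod (isCompact_Icc (a := t - 1) (b := t + 1)) |>.exists_bound_of_continuousOn
      hc.continuousOn
  have h := hasDerivAt_integral_of_dominated_loc_of_deriv_le (μ := cyl T L) (x₀ := t)
    (F := fun s p => v p * K (p - (s, x))) (F' := fun s p => -(v p * dt K (p - (s, x))))
    (bound := fun p => |v p| * C) (Icc_mem_nhds (by linarith : t - 1 < t) (by linarith : t < t + 1))
    (Eventually.of_forall fun s => (integrable_cyl_mul_continuous hv
      (by fun_prop)).aestronglyMeasurable)
    (integrable_cyl_mul_continuous hv (by fun_prop))
    (integrable_cyl_mul_continuous hv (by fun_prop)).neg.aestronglyMeasurable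
    (by
      filter_upwards [ae_cyl_mem T L] with p hp s hs
      rw [norm_neg, norm_mul, Real.norm_eq_abs]
      exact mul_le_mul_of_nonneg_left (hC (p, s)
        ⟨⟨Ioo_subset_Icc_self hp.1, Ioo_subset_Icc_self hp.2⟩, hs⟩) (abs_nonneg _))
    (hv.abs.mul_const C)
    (Eventually.of_forall fun p s _ => by
      have := (hasDerivAt_dt hK (p.1 - s) (p.2 - x)).comp s ((hasDerivAt_id s).const_sub p.1)
      have := this.const_mul (v p)
      simp only [Function.comp_def, mul_neg, mul_one] at this
      exact this)
  have := h.2.deriv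
  rw [integral_neg] at this
  exact this

theorem dx_integral_mul_sub (hv : Integrable v (cyl T L)) (hK : ContDiff ℝ smoothOrder K) :
    dx (fun z => ∫ p, v p * K (p - z) ∂(cyl T L)) =
      fun z => -∫ p, v p * dx K (p - z) ∂(cyl T L) := by
  funext ⟨t, x⟩
  have hKc := hK.continuous
  have hdc := (contDiff_dx hK).continuous
  have hc : Continuous fun q : (ℝ × ℝ) × ℝ => dx K (q.1 - (t, q.2)) := by fun_prop
  obtain ⟨C, hC⟩ := ((isCompact_Icc (a := (0 : ℝ)) (b := T)).prod (isCompact_Icc (a := 0)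
    (b := L))).prod (isCompact_Icc (a := x - 1) (b := x + 1)) |>.exists_bound_of_continuousOn
      hc.continuousOn
  have h := hasDerivAt_integral_of_dominated_loc_of_deriv_le (μ := cyl T L) (x₀ := x)
    (F := fun s p => v p * K (p - (t, s))) (F' := fun s p => -(v p * dx K (p - (t, s))))
    (bound := fun p => |v p| * C) (Icc_mem_nhds (by linarith : x - 1 < x) (by linarith : x < x + 1))
    (Eventually.of_forall fun s => (integrable_cyl_mul_continuous hv
      (by fun_prop)).aestronglyMeasurable)
    (integrable_cyl_mul_continuous hv (by fun_prop))
    (integrable_cyl_mul_continuous hv (by fun_prop)).neg.aestronglyMeasurable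
    (by
      filter_upwards [ae_cyl_mem T L] with p hp s hs
      rw [norm_neg, norm_mul, Real.norm_eq_abs]
      exact mul_le_mul_of_nonneg_left (hC (p, s)
        ⟨⟨Ioo_subset_Icc_self hp.1, Ioo_subset_Icc_self hp.2⟩, hs⟩) (abs_nonneg _))
    (hv.abs.mul_const C)
    (Eventually.of_forall fun p s _ => by
      have := (hasDerivAt_dx hK (p.1 - t) (p.2 - s)).comp s ((hasDerivAt_id s).const_sub p.2)
      have := this.const_mul (v p)
      simp only [Function.comp_def, mul_neg, mul_one] at this
      exact this)
  have := h.2.deriv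
  rw [integral_neg] at this
  exact this

end ParametricIntegral

/-! ### The mollification kernel -/

/-- The kernel `∂_t^i ∂_x^j` of (one-sided bump in time) times (periodic bump in space). -/
noncomputable def kernel (L ε : ℝ) (i j : ℕ) (p : ℝ × ℝ) : ℝ :=
  iteratedDeriv i (bump ε) p.1 * iteratedDeriv j (perBump L ε) p.2

/-- The derivative `∂_t^i ∂_x^j` of the mollification of `v`. The derivatives are put on the kernel,
so that this makes sense for every integrable `v`; the sign accounts for the kernel being evaluated
at `p - z`. The kernel looks forward in time, so for `0 ≤ t ≤ T - ε` the average at `(t, x)` only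
involves the values of `v` on `(0, T)`. -/
noncomputable def moll (T L ε : ℝ) (i j : ℕ) (v : ℝ × ℝ → ℝ) (z : ℝ × ℝ) : ℝ :=
  (-1) ^ (i + j) * ∫ p, v p * kernel L ε i j (p - z) ∂(cyl T L)

theorem contDiff_iteratedDeriv {g : ℝ → ℝ} (hg : ContDiff ℝ smoothOrder g) (i : ℕ) :
    ContDiff ℝ smoothOrder (iteratedDeriv i g) := by
  induction i with
  | zero => simpa using hg
  | succ i ih => rw [iteratedDeriv_succ]; exact (contDiff_infty_iff_deriv.1 ih).2

theorem hasDerivAt_iteratedDeriv {g : ℝ → ℝ} (hg : ContDiff ℝ smoothOrder g) (i : ℕ) (x : ℝ) :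
    HasDerivAt (iteratedDeriv i g) (iteratedDeriv (i + 1) g x) x := by
  rw [iteratedDeriv_succ]
  exact ((contDiff_iteratedDeriv hg i).differentiable (by simp) x).hasDerivAt

theorem periodic_iteratedDeriv {g : ℝ → ℝ} {L : ℝ} (hg : Function.Periodic g L) (i : ℕ) :
    Function.Periodic (iteratedDeriv i g) L := by
  intro y
  have := iteratedDeriv_comp_add_const i g L
  rw [hg.funext] at this
  exact (congrFun this y).symm

section Kernel

variable {L ε : ℝ}

theorem contDiff_kernel (hL : 0 < L) (hε : 0 < ε) (hεL : ε < L) (i j : ℕ) :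
    ContDiff ℝ smoothOrder (kernel L ε i j) :=
  ((contDiff_iteratedDeriv (bump_contDiff ε) i).comp contDiff_fst).mul
    ((contDiff_iteratedDeriv (perBump_contDiff hL hε hεL) j).comp contDiff_snd)

theorem dt_kernel (L ε : ℝ) (i j : ℕ) : dt (kernel L ε i j) = kernel L ε (i + 1) j := by
  funext ⟨t, x⟩
  exact ((hasDerivAt_iteratedDeriv (bump_contDiff ε) i t).mul_const
    (iteratedDeriv j (perBump L ε) x)).deriv

theorem dx_kernel (hL : 0 < L) (hε : 0 < ε) (hεL : ε < L) (i j : ℕ) :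
    dx (kernel L ε i j) = kernel L ε i (j + 1) := by
  funext ⟨t, x⟩
  exact ((hasDerivAt_iteratedDeriv (perBump_contDiff hL hε hεL) j x).const_mul
    (iteratedDeriv i (bump ε) t)).deriv

theorem dt_comp_sub (φ : ℝ × ℝ → ℝ) (z : ℝ × ℝ) :
    dt (fun p => φ (p - z)) = fun p => dt φ (p - z) := by
  funext ⟨t, x⟩
  exact deriv_comp_sub_const (f := fun s => φ (s, x - z.2)) z.1 t

theorem dx_comp_sub (φ : ℝ × ℝ → ℝ) (z : ℝ × ℝ) :
    dx (fun p => φ (p - z)) = fun p => dx φ (p - z) := by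
  funext ⟨t, x⟩
  exact deriv_comp_sub_const (f := fun s => φ (t - z.1, s)) z.2 x

theorem iterate_kernel_sub (hL : 0 < L) (hε : 0 < ε) (hεL : ε < L) (z : ℝ × ℝ) (i j : ℕ) :
    dt^[i] (dx^[j] (fun p => kernel L ε 0 0 (p - z))) = fun p => kernel L ε i j (p - z) := by
  have hx : dx^[j] (fun p => kernel L ε 0 0 (p - z)) = fun p => kernel L ε 0 j (p - z) := by
    induction j with
    | zero => rfl
    | succ j ih =>
      rw [Function.iterate_succ_apply', ih, dx_comp_sub, dx_kernel hL hε hεL]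
  rw [hx]
  induction i with
  | zero => rfl
  | succ i ih => rw [Function.iterate_succ_apply', ih, dt_comp_sub, dt_kernel]

theorem kernel_zero (L ε : ℝ) (p : ℝ × ℝ) : kernel L ε 0 0 p = bump ε p.1 * perBump L ε p.2 := by
  simp [kernel]

theorem kernel_nonneg (L : ℝ) (hε : 0 < ε) (p : ℝ × ℝ) : 0 ≤ kernel L ε 0 0 p := by
  rw [kernel_zero]; exact mul_nonneg (bump_nonneg hε _) (perBump_nonneg _ hε _)

theorem iteratedDeriv_bump_eq_zero (hε : 0 < ε) {s : ℝ} (hs : s < 0 ∨ ε < s) (i : ℕ) :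
    iteratedDeriv i (bump ε) s = 0 := by
  have : bump ε =ᶠ[𝓝 s] fun _ => 0 := by
    rcases hs with h | h
    · filter_upwards [Iio_mem_nhds h] with y hy
      exact bump_eq_zero hε (Or.inl (by have := mem_Iio.1 hy; linarith))
    · filter_upwards [Ioi_mem_nhds h] with y hy
      exact bump_eq_zero hε (Or.inr (by have := mem_Ioi.1 hy; linarith))
  rw [this.iteratedDeriv_eq]
  simp

theorem iteratedDeriv_perBump_eq_zero (hL : 0 < L) (hε : 0 < ε) {y : ℝ}
    (hy : ∀ k : ℤ, y - k * L < 0 ∨ ε < y - k * L) (j : ℕ) :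
    iteratedDeriv j (perBump L ε) y = 0 := by
  set k := ⌊y / L⌋
  have h1 : k * L ≤ y := (le_div_iff₀ hL).1 (Int.floor_le _)
  have h2 : y < k * L + L := by
    have := (div_lt_iff₀ hL).1 (Int.lt_floor_add_one (y / L))
    linarith
  have h3 : ε < y - k * L := by
    rcases hy k with h | h
    · linarith
    · exact h
  have : perBump L ε =ᶠ[𝓝 y] fun _ => 0 := by
    filter_upwards [Ioo_mem_nhds (show k * L + ε < y by linarith) h2] with z hz
    rw [perBump_eq_bump hL hε k (by linarith [hz.1]) hz.2]
    exact bump_eq_zero hε (Or.inr (by linarith [hz.1]))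
  rw [this.iteratedDeriv_eq]
  simp

/-- The kernel is concentrated at distance at most `ε` of the origin, modulo the period in space. -/
theorem kernel_support (hL : 0 < L) (hε : 0 < ε) {i j : ℕ} {p : ℝ × ℝ}
    (hp : kernel L ε i j p ≠ 0) :
    |p.1| ≤ ε ∧ ∃ k : ℤ, |p.2 - k * L| ≤ ε := by
  rw [kernel] at hp
  constructor
  · by_contra h
    apply hp
    rw [iteratedDeriv_bump_eq_zero hε, zero_mul]
    by_contra! h'
    exact h (abs_le.2 ⟨by linarith [h'.1], h'.2⟩)
  · by_contra! h
    apply hp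
    rw [iteratedDeriv_perBump_eq_zero hL hε, mul_zero]
    intro k
    by_contra! h'
    exact absurd (abs_le.2 ⟨by linarith [h'.1], h'.2⟩) (not_le.2 (h k))

theorem integral_kernel {T : ℝ} (hL : 0 < L) (hε : 0 < ε) (hεL : ε < L) {t x : ℝ} (ht : 0 ≤ t)
    (htT : t + ε ≤ T) : ∫ p, kernel L ε 0 0 (p - (t, x)) ∂(cyl T L) = 1 := by
  simp only [kernel_zero, cyl_eq_prod, Prod.fst_sub, Prod.snd_sub]
  rw [integral_prod_mul (fun s => bump ε (s - t)) (fun y => perBump L ε (y - x)),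
    integral_perBump hL hε hεL, mul_one]
  have : ∫ s in Ioo 0 T, bump ε (s - t) = ∫ s in Ioo (0 - t) (T - t), bump ε s := by
    have e := (measurePreserving_sub_right volume t).setIntegral_preimage_emb
      (measurableEmbedding_subRight t) (bump ε) (Ioo (0 - t) (T - t))
    rw [← e]
    congr 2
    ext s; simp
  rw [this]
  exact setIntegral_bump hε (by linarith) (by linarith)

end Kernel

/-! ### Mollification of functions on the cylinder -/

section Moll

variable {T L ε : ℝ} {v : ℝ × ℝ → ℝ}

theorem isSmoothPeriodic_moll (hL : 0 < L) (hε : 0 < ε) (hεL : ε < L)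
    (hv : Integrable v (cyl T L)) (i j : ℕ) : IsSmoothPeriodic L (moll T L ε i j v) where
  smooth := contDiff_const.mul (contDiff_integral_mul_sub hv (contDiff_kernel hL hε hεL i j))
  periodic t x := by
    have h := periodic_iteratedDeriv (perBump_periodic hL ε) j
    unfold moll
    congr 2
    funext p
    simp only [kernel, Prod.fst_sub, Prod.snd_sub]
    rw [← sub_sub, h.sub_eq]

theorem dt_moll (hL : 0 < L) (hε : 0 < ε) (hεL : ε < L)
    (hv : Integrable v (cyl T L)) (i j : ℕ) :
    dt (moll T L ε i j v) = moll T L ε (i + 1) j v := by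
  funext z
  have h := dt_integral_mul_sub hv (contDiff_kernel hL hε hεL i j)
  have hs := contDiff_integral_mul_sub hv (contDiff_kernel hL hε hεL i j)
  have h1 := ((hasDerivAt_dt hs z.1 z.2).const_mul ((-1) ^ (i + j))).deriv
  rw [h, dt_kernel] at h1
  refine h1.trans ?_
  rw [moll, show i + 1 + j = i + j + 1 by ring, pow_succ]
  ring

theorem dx_moll (hL : 0 < L) (hε : 0 < ε) (hεL : ε < L)
    (hv : Integrable v (cyl T L)) (i j : ℕ) :
    dx (moll T L ε i j v) = moll T L ε i (j + 1) v := by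
  funext z
  have h := dx_integral_mul_sub hv (contDiff_kernel hL hε hεL i j)
  have hs := contDiff_integral_mul_sub hv (contDiff_kernel hL hε hεL i j)
  have h1 := ((hasDerivAt_dx hs z.1 z.2).const_mul ((-1) ^ (i + j))).deriv
  rw [h, dx_kernel hL hε hεL] at h1
  refine h1.trans ?_
  rw [moll, show i + (j + 1) = i + j + 1 by ring, pow_succ]
  ring

theorem isInteriorTest_kernel (hL : 0 < L) (hε : 0 < ε) (hεL : ε < L) {t x : ℝ} (ht : 0 ≤ t)
    (htT : t + ε ≤ T) : IsInteriorTest T L (fun p => kernel L ε 0 0 (p - (t, x))) := by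
  refine ⟨⟨(contDiff_kernel hL hε hεL 0 0).comp (contDiff_id.sub contDiff_const), fun s y => ?_⟩,
    t + ε / 4, t + 3 * ε / 4, by linarith, by linarith, fun s y hs => ?_⟩
  · simp only [kernel_zero, Prod.fst_sub, Prod.snd_sub]
    rw [show y + L - x = y - x + L by ring, perBump_periodic hL ε]
  · simp only [kernel_zero, Prod.fst_sub, Prod.snd_sub]
    rw [bump_eq_zero hε, zero_mul]
    rcases hs with h | h
    · left; linarith
    · right; linarith

/-- Mollification commutes with weak derivatives, up to and including the initial time: the
translated kernel is an interior test function because its support in time lies in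
`[t + ε/4, t + 3ε/4]`. -/
theorem moll_eq_of_hasWeakDeriv (hL : 0 < L) (hε : 0 < ε) (hεL : ε < L) {i j : ℕ}
    {w : ℝ × ℝ → ℝ} (h : HasWeakDeriv T L i j v w) {t x : ℝ} (ht : 0 ≤ t) (htT : t + ε ≤ T) :
    moll T L ε i j v (t, x) = moll T L ε 0 0 w (t, x) := by
  have h1 := h.integral_eq _ (isInteriorTest_kernel hL hε hεL (x := x) ht htT)
  rw [iterate_kernel_sub hL hε hεL] at h1
  rw [moll, moll, h1, ← mul_assoc, ← mul_pow]
  norm_num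

/-- If `v` is within `η` of a constant on the support of the kernel, then so is its average. -/
theorem abs_moll_sub_le (hL : 0 < L) (hε : 0 < ε) (hεL : ε < L) (hv : Integrable v (cyl T L))
    {t x c η : ℝ} (ht : 0 ≤ t) (htT : t + ε ≤ T)
    (h : ∀ᵐ p ∂(cyl T L), kernel L ε 0 0 (p - (t, x)) ≠ 0 → |v p - c| ≤ η) :
    |moll T L ε 0 0 v (t, x) - c| ≤ η := by
  have hk : Continuous fun p : ℝ × ℝ => kernel L ε 0 0 (p - (t, x)) :=
    (contDiff_kernel hL hε hεL 0 0).continuous.comp (continuous_id.sub continuous_const)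
  have hi := integral_kernel (x := x) hL hε hεL ht htT
  have hki : Integrable (fun p : ℝ × ℝ => kernel L ε 0 0 (p - (t, x))) (cyl T L) :=
    integrable_cyl_of_continuous hk
  have e : moll T L ε 0 0 v (t, x) - c
      = ∫ p, (v p - c) * kernel L ε 0 0 (p - (t, x)) ∂(cyl T L) := by
    simp only [sub_mul]
    rw [integral_sub (integrable_cyl_mul_continuous hv hk) (hki.const_mul c), integral_const_mul,
      hi, moll]
    simp
  rw [e]
  calc |∫ p, (v p - c) * kernel L ε 0 0 (p - (t, x)) ∂(cyl T L)|
      ≤ ∫ p, |(v p - c) * kernel L ε 0 0 (p - (t, x))| ∂(cyl T L) := abs_integral_le_integral_abs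
    _ ≤ ∫ p, η * kernel L ε 0 0 (p - (t, x)) ∂(cyl T L) := by
      refine integral_mono_of_nonneg (Eventually.of_forall fun _ => abs_nonneg _)
        (hki.const_mul η) ?_
      filter_upwards [h] with p hp
      rw [abs_mul, abs_of_nonneg (kernel_nonneg L hε _)]
      by_cases h0 : kernel L ε 0 0 (p - (t, x)) = 0
      · simp [h0]
      · exact mul_le_mul_of_nonneg_right (hp h0) (kernel_nonneg L hε _)
    _ = η := by rw [integral_const_mul, hi, mul_one]

theorem abs_moll_le (hL : 0 < L) (hε : 0 < ε) (hεL : ε < L) (hv : Integrable v (cyl T L))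
    {t x B : ℝ} (ht : 0 ≤ t) (htT : t + ε ≤ T) (h : ∀ᵐ p ∂(cyl T L), |v p| ≤ B) :
    |moll T L ε 0 0 v (t, x)| ≤ B := by
  have := abs_moll_sub_le (x := x) (c := 0) (η := B) hL hε hεL hv ht htT
    (h.mono fun p hp _ => by simpa using hp)
  simpa using this

theorem tendsto_one_div_succ_nhdsGT :
    Tendsto (fun n : ℕ => 1 / ((n : ℝ) + 1)) atTop (𝓝[>] 0) :=
  tendsto_nhdsWithin_iff.2 ⟨tendsto_one_div_add_atTop_nhds_zero_nat,
    Eventually.of_forall fun n => mem_Ioi.2 (by positivity)⟩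

theorem abs_sub_le_of_perBump_ne_zero (hL : 0 < L) (hε : 0 < ε) {x y : ℝ} (hx : x ∈ Ioo 0 L)
    (hxε : x + ε < L) (hy : y ∈ Ioo 0 L) (h : perBump L ε (y - x) ≠ 0) :
    |y - x| ≤ ε := by
  obtain ⟨k, h1, h2⟩ := exists_of_perBump_ne_zero hL hε h
  have hk1 : (k : ℝ) * L < 1 * L := by linarith [hy.2, hx.1]
  have hk2 : (-1 : ℝ) * L < k * L := by linarith [hy.1]
  have h3 : (k : ℝ) < 1 := lt_of_mul_lt_mul_right hk1 hL.le
  have h4 : (-1 : ℝ) < k := lt_of_mul_lt_mul_right hk2 hL.le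
  have h5 : k = 0 := by
    have : k < 1 := by exact_mod_cast h3
    have : -1 < k := by exact_mod_cast h4
    omega
  subst h5
  simp only [Int.cast_zero, zero_mul, sub_zero] at h1 h2
  rw [abs_of_nonneg h1]; exact h2

theorem ae_tendsto_moll (hL : 0 < L) (hv : Integrable v (cyl T L)) :
    ∀ᵐ z ∂(cyl T L), Tendsto (fun n : ℕ => moll T L (1 / ((n : ℝ) + 1)) 0 0 v z) atTop
      (𝓝 (v z)) := by
  obtain ⟨C, hC0, hC, -⟩ := exists_baseBump_bound
  set S : Set (ℝ × ℝ) := Ioo 0 T ×ˢ Ioo 0 L with hS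
  have hSm : MeasurableSet S := measurableSet_Ioo.prod measurableSet_Ioo
  have hloc : LocallyIntegrable (S.indicator v) (volume : Measure (ℝ × ℝ)) :=
    ((integrable_indicator_iff hSm).2 hv).locallyIntegrable
  have h := ae_tendsto_integral_mul_kernel (volume : Measure (ℝ × ℝ)) hloc (4 * C ^ 2)
  have h' : ∀ᵐ z ∂(cyl T L), _ := ae_restrict_of_ae h
  filter_upwards [h', ae_cyl_mem T L] with z hz hzS
  have hr : ∀ n : ℕ, (0 : ℝ) < 1 / ((n : ℝ) + 1) := fun n => by positivity
  have hlim := tendsto_one_div_succ_nhdsGT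
  have hz2 := hz (fun n => 1 / ((n : ℝ) + 1))
    (fun n => S.indicator fun p => kernel L (1 / ((n : ℝ) + 1)) 0 0 (p - z)) hlim ?_
  · rw [indicator_of_mem hzS] at hz2
    refine hz2.congr fun n => ?_
    simp only [moll, pow_zero, one_mul, add_zero]
    rw [cyl, ← integral_indicator hSm]
    refine integral_congr_ae (Eventually.of_forall fun p => ?_)
    by_cases hp : p ∈ S <;> simp [hp]
  · have hsmall : ∀ᶠ n : ℕ in atTop, 1 / ((n : ℝ) + 1) < min (T - z.1) (L - z.2) :=
      (tendsto_nhdsWithin_iff.1 hlim).1.eventually_lt_const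
        (lt_min (by linarith [hzS.1.2]) (by linarith [hzS.2.2]))
    filter_upwards [hsmall] with n hn
    set ε := 1 / ((n : ℝ) + 1) with hεdef
    have hε : 0 < ε := hr n
    have h1 : z.1 + ε < T := by have := hn.trans_le (min_le_left _ _); linarith
    have h2 : z.2 + ε < L := by have := hn.trans_le (min_le_right _ _); linarith
    have hεL : ε < L := by linarith [hzS.2.1]
    have hk : Continuous fun p : ℝ × ℝ => kernel L ε 0 0 (p - z) :=
      (contDiff_kernel hL hε hεL 0 0).continuous.comp (continuous_id.sub continuous_const)
    have hvol : (volume : Measure (ℝ × ℝ)).real (Metric.closedBall z ε) = (2 * ε) ^ 2 := by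
      obtain ⟨a, b⟩ := z
      rw [← closedBall_prod_same, Measure.volume_eq_prod, measureReal_prod_prod]
      simp only [Measure.real, Real.volume_closedBall]
      rw [ENNReal.toReal_ofReal (by positivity)]; ring
    refine ⟨hk.aestronglyMeasurable.indicator hSm, fun p => ?_, fun p hp => ?_, ?_⟩
    · have hb : |kernel L ε 0 0 (p - z)| ≤ 4 * C ^ 2 / (2 * ε) ^ 2 := by
        rw [kernel_zero, abs_mul, abs_of_nonneg (bump_nonneg hε _)]
        have e : 4 * C ^ 2 / (2 * ε) ^ 2 = C / ε * (C / ε) := by field_simp; ring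
        rw [e]
        exact mul_le_mul (bump_le hε hC _) (abs_perBump_le hε hC _) (abs_nonneg _) (by positivity)
      rw [hvol]
      by_cases hpS : p ∈ S
      · simpa [hpS] using hb
      · simp only [indicator_of_notMem hpS, abs_zero]; positivity
    · by_cases hpS : p ∈ S
      · rw [indicator_of_mem hpS, kernel_zero]
        by_contra hne
        apply hp
        rw [← ne_eq, mul_ne_zero_iff] at hne
        have h3 := abs_sub_le_of_perBump_ne_zero hL hε hzS.2 h2 hpS.2 hne.2
        have h4 : |p.1 - z.1| ≤ ε := by
          by_contra h5
          apply hne.1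
          apply bump_eq_zero hε
          by_contra! h6
          apply h5
          simp only [Prod.fst_sub] at h6
          rw [abs_le]; constructor <;> linarith
        rw [Metric.mem_closedBall, Prod.dist_eq, Real.dist_eq, Real.dist_eq]
        exact max_le h4 h3
      · exact indicator_of_notMem hpS _
    · rw [integral_indicator hSm]
      exact integral_kernel (x := z.2) hL hε hεL hzS.1.1.le h1.le

/-- `v` agrees almost everywhere on the periodic cylinder with a `C`-Lipschitz function. This is
encoded by a set of full measure on which the Lipschitz bound holds; the integer `k` makes the
distance in space the one of the circle. -/
def AELipschitz (T L C : ℝ) (v : ℝ × ℝ → ℝ) : Prop :=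
  ∃ G : Set (ℝ × ℝ), (∀ᵐ p ∂(cyl T L), p ∈ G) ∧ ∀ p ∈ G, ∀ p' ∈ G, ∀ k : ℤ,
    |v p - v p'| ≤ C * (|p.1 - p'.1| + |p.2 - p'.2 - k * L|)

/-- Uniform Lipschitz bounds on the mollifications of `v` pass to `v`, on the set of those points at
which the mollifications converge to `v`. -/
theorem aeLipschitz_of_moll (hL : 0 < L) (hv : Integrable v (cyl T L)) {C : ℝ}
    (h : ∀ ε, 0 < ε → ε < L → ∀ t t', 0 ≤ t → 0 ≤ t' → t + ε ≤ T → t' + ε ≤ T → ∀ x x',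
      |moll T L ε 0 0 v (t, x) - moll T L ε 0 0 v (t', x')| ≤ C * (|t - t'| + |x - x'|)) :
    AELipschitz T L C v := by
  refine ⟨{p | p ∈ Ioo 0 T ×ˢ Ioo 0 L ∧ Tendsto (fun n : ℕ => moll T L (1 / ((n : ℝ) + 1)) 0 0 v p)
    atTop (𝓝 (v p))}, ?_, ?_⟩
  · filter_upwards [ae_tendsto_moll hL hv, ae_cyl_mem T L] with p h1 h2 using ⟨h2, h1⟩
  · rintro ⟨t, x⟩ ⟨hp, hpl⟩ ⟨t', x'⟩ ⟨hp', hpl'⟩ k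
    refine le_of_tendsto ((hpl.sub hpl').abs) ?_
    have hlim := (tendsto_nhdsWithin_iff.1 tendsto_one_div_succ_nhdsGT).1
    have hsmall : ∀ᶠ n : ℕ in atTop, 1 / ((n : ℝ) + 1) < min L (min (T - t) (T - t')) :=
      hlim.eventually_lt_const
        (lt_min hL (lt_min (by linarith [hp.1.2]) (by linarith [hp'.1.2])))
    filter_upwards [hsmall] with n hn
    rw [lt_min_iff, lt_min_iff] at hn
    have hε : (0 : ℝ) < 1 / ((n : ℝ) + 1) := by positivity
    -- periodicity moves the second point to the period cell in which the distance is measured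
    have hper : moll T L (1 / ((n : ℝ) + 1)) 0 0 v (t', x')
        = moll T L (1 / ((n : ℝ) + 1)) 0 0 v (t', x' + k * L) := by
      have hP : Function.Periodic (fun y => moll T L (1 / ((n : ℝ) + 1)) 0 0 v (t', y)) L :=
        (isSmoothPeriodic_moll hL hε hn.1 hv 0 0).periodic t'
      exact (hP.int_mul k x').symm
    rw [hper]
    have := h _ hε hn.1 t t' hp.1.1.le hp'.1.1.le (by linarith [hn.2.1]) (by linarith [hn.2.2])
      x (x' + k * L)
    simpa [sub_sub] using this

theorem AELipschitz.nonneg {C : ℝ} (hT : 0 < T) (hL : 0 < L) (h : AELipschitz T L C v) : 0 ≤ C := by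
  obtain ⟨G, hG, hl⟩ := h
  have : (cyl T L) ≠ 0 := by
    intro h0
    have h1 : cyl T L univ = 0 := by simp [h0]
    rw [cyl, Measure.restrict_apply_univ, Measure.volume_eq_prod, Measure.prod_prod,
      Real.volume_Ioo, Real.volume_Ioo] at h1
    simp at h1
    rcases h1 with h1 | h1 <;> linarith
  have := ae_neBot.2 this
  obtain ⟨p, hp⟩ := hG.exists
  have h1 := hl p hp p hp 1
  have h2 : 0 ≤ C * L := by simpa [abs_of_pos hL] using h1
  exact nonneg_of_mul_nonneg_left h2 hL

theorem AELipschitz.exists_abs_sub_moll_le {C : ℝ} (hT : 0 < T) (hL : 0 < L)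
    (h : AELipschitz T L C v)
    (hv : Integrable v (cyl T L)) :
    ∀ᵐ p ∂(cyl T L), ∀ ε, 0 < ε → ε < L → ∀ t x, 0 ≤ t → t + ε ≤ T → ∀ k : ℤ,
      |v p - moll T L ε 0 0 v (t, x)| ≤ C * (|p.1 - t| + |p.2 - x - k * L| + 2 * ε) := by
  have hC := h.nonneg hT hL
  obtain ⟨G, hG, hl⟩ := h
  filter_upwards [hG] with p hp ε hε hεL t x ht htT k
  rw [abs_sub_comm]
  refine abs_moll_sub_le hL hε hεL hv ht htT ?_
  filter_upwards [hG] with p' hp' hne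
  obtain ⟨h1, k', h2⟩ := kernel_support hL hε hne
  simp only [Prod.fst_sub, Prod.snd_sub] at h1 h2
  refine (hl p' hp' p hp (k' - k)).trans (mul_le_mul_of_nonneg_left ?_ hC)
  have e1 : p'.1 - p.1 = (p'.1 - t) - (p.1 - t) := by ring
  have e2 : p'.2 - p.2 - ((k' - k : ℤ) : ℝ) * L = (p'.2 - x - k' * L) - (p.2 - x - k * L) := by
    push_cast; ring
  rw [e1, e2]
  have := abs_sub (p'.1 - t) (p.1 - t)
  have := abs_sub (p'.2 - x - k' * L) (p.2 - x - k * L)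
  linarith

theorem AELipschitz.abs_moll_sub_moll_le {C δ : ℝ} (hT : 0 < T) (hL : 0 < L)
    (h : AELipschitz T L C v)
    (hv : Integrable v (cyl T L)) (hε : 0 < ε) (hεL : ε < L) (hδ : 0 < δ) (hδL : δ < L) {t : ℝ}
    (ht : 0 ≤ t) (htε : t + ε ≤ T) (htδ : t + δ ≤ T) (x : ℝ) :
    |moll T L ε 0 0 v (t, x) - moll T L δ 0 0 v (t, x)| ≤ C * (2 * ε + 2 * δ) := by
  have hC := h.nonneg hT hL
  rw [abs_sub_comm]
  refine abs_moll_sub_le hL hδ hδL hv ht htδ ?_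
  filter_upwards [h.exists_abs_sub_moll_le hT hL hv] with p hp hne
  obtain ⟨h1, k, h2⟩ := kernel_support hL hδ hne
  simp only [Prod.fst_sub, Prod.snd_sub] at h1 h2
  refine (hp ε hε hεL t x ht htε k).trans (mul_le_mul_of_nonneg_left ?_ hC)
  linarith

end Moll

/-! ### Smooth approximate jets of a Sobolev function -/

/-- A smooth approximation of the jet of a solution of the limit equation: `D i j` is smooth,
periodic and plays the role of `∂_t^i ∂_x^j u`. For `0 ≤ t ≤ T` the entries of order at most `m` are
bounded by `B`, the limit equation holds up to an error `δ`, and so does the initial condition for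
the fields `r j`. -/
structure IsApproxJet (T L : ℝ) (m : ℕ) (f' : ℝ → ℝ) (r : ℕ → ℝ → ℝ) (B δ : ℝ)
    (D : ℕ → ℕ → ℝ × ℝ → ℝ) : Prop where
  smooth : ∀ i j, IsSmoothPeriodic L (D i j)
  dt_eq : ∀ i j, dt (D i j) = D (i + 1) j
  dx_eq : ∀ i j, dx (D i j) = D i (j + 1)
  bound : ∀ i j, i + j ≤ m → ∀ t x, 0 ≤ t → t ≤ T → |D i j (t, x)| ≤ B
  residual : ∀ t x, 0 ≤ t → t ≤ T →
    |D 1 0 (t, x) + sigma m * D 0 m (t, x) + f' (D 0 0 (t, x)) * D 0 1 (t, x)| ≤ δ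
  initial : ∀ j < m, ∀ᵐ x ∂(space L), |r j x - D 0 j (0, x)| ≤ δ

theorem MemSobolevInf.exists_bound {T L : ℝ} {m : ℕ} {u : ℝ × ℝ → ℝ} (hu : MemSobolevInf T L m u) :
    ∃ B : ℝ, ∀ i j, i + j ≤ m → ∃ v, HasWeakDeriv T L i j u v ∧ ∀ᵐ p ∂(cyl T L), |v p| ≤ B := by
  choose v hv1 hv2 using hu
  let b : ℕ → ℕ → ℝ := fun i j =>
    if h : i + j ≤ m then (eLpNorm (v i j h) ⊤ (cyl T L)).toReal else 0
  refine ⟨∑ i ∈ Finset.range (m + 1), ∑ j ∈ Finset.range (m + 1), b i j, fun i j h =>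
    ⟨v i j h, hv2 i j h, ?_⟩⟩
  have hb : ∀ i j, 0 ≤ b i j := fun i j => by
    simp only [b]; split_ifs
    · exact ENNReal.toReal_nonneg
    · exact le_rfl
  have h1 : b i j ≤ ∑ i ∈ Finset.range (m + 1), ∑ j ∈ Finset.range (m + 1), b i j :=
    (Finset.single_le_sum (f := fun j => b i j) (fun j _ => hb i j)
      (Finset.mem_range.2 (by omega : j < m + 1))).trans
    (Finset.single_le_sum (f := fun i => ∑ j ∈ Finset.range (m + 1), b i j)
      (fun i _ => Finset.sum_nonneg fun j _ => hb i j) (Finset.mem_range.2 (by omega : i < m + 1)))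
  filter_upwards [ae_le_eLpNormEssSup (f := v i j h) (μ := cyl T L)] with p hp
  refine le_trans ?_ h1
  simp only [b, dif_pos h, eLpNorm_exponent_top]
  have := ENNReal.toReal_mono (by simpa using (hv1 i j h).eLpNorm_ne_top) hp
  simpa using this

section

variable {T L ε B : ℝ} {m : ℕ} {u : ℝ × ℝ → ℝ}

theorem abs_moll_jet_le (hL : 0 < L) (hε : 0 < ε) (hεL : ε < L)
    (hB : ∀ i j, i + j ≤ m → ∃ v, HasWeakDeriv T L i j u v ∧ ∀ᵐ p ∂(cyl T L), |v p| ≤ B)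
    {i j : ℕ} (hij : i + j ≤ m) {t x : ℝ} (ht : 0 ≤ t) (htT : t + ε ≤ T) :
    |moll T L ε i j u (t, x)| ≤ B := by
  obtain ⟨v, hv, hb⟩ := hB i j hij
  rw [moll_eq_of_hasWeakDeriv hL hε hεL hv ht htT]
  exact abs_moll_le hL hε hεL hv.integrable_right ht htT hb

/-- A function with weak derivatives up to order `m` bounded by `B` has mollified space derivatives
of order less than `m` which are `B`-Lipschitz, uniformly in the scale of mollification. -/
theorem abs_moll_jet_sub_le (hL : 0 < L) (hε : 0 < ε) (hεL : ε < L)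
    (hui : Integrable u (cyl T L))
    (hB : ∀ i j, i + j ≤ m → ∃ v, HasWeakDeriv T L i j u v ∧ ∀ᵐ p ∂(cyl T L), |v p| ≤ B)
    {j : ℕ} (hj : j < m) {t t' : ℝ} (ht : 0 ≤ t) (ht' : 0 ≤ t') (htT : t + ε ≤ T)
    (htT' : t' + ε ≤ T) (x x' : ℝ) :
    |moll T L ε 0 j u (t, x) - moll T L ε 0 j u (t', x')| ≤ B * (|t - t'| + |x - x'|) := by
  have hs := (isSmoothPeriodic_moll hL hε hεL hui 0 j).smooth
  have h1 : |moll T L ε 0 j u (t, x) - moll T L ε 0 j u (t', x)| ≤ B * |t - t'| := by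
    refine (convex_Icc 0 (T - ε)).norm_image_sub_le_of_norm_hasDerivWithin_le
      (f := fun s => moll T L ε 0 j u (s, x)) (f' := fun s => moll T L ε 1 j u (s, x))
      (fun s _ => ?_) (fun s hs => ?_) ⟨ht', by linarith⟩ ⟨ht, by linarith⟩
    · have := hasDerivAt_dt hs s x
      rw [dt_moll hL hε hεL hui] at this
      exact this.hasDerivWithinAt
    · exact abs_moll_jet_le hL hε hεL hB (by omega) hs.1 (by linarith [hs.2])
  have h2 : |moll T L ε 0 j u (t', x) - moll T L ε 0 j u (t', x')| ≤ B * |x - x'| := by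
    refine lipschitz_of_deriv_bound
      (F := fun y => moll T L ε 0 j u (t', y)) (F' := fun y => moll T L ε 0 (j + 1) u (t', y))
      (fun y => ?_) (fun y => ?_) x x'
    · have := hasDerivAt_dx hs t' y
      rwa [dx_moll hL hε hεL hui] at this
    · exact abs_moll_jet_le hL hε hεL hB (by omega) ht' htT'
  calc _ ≤ _ := abs_sub_le _ (moll T L ε 0 j u (t', x)) _
    _ ≤ _ := add_le_add h1 h2
    _ = _ := by ring

theorem aeLipschitz_of_hasWeakDeriv (hL : 0 < L)
    (hB : ∀ i j, i + j ≤ m → ∃ v, HasWeakDeriv T L i j u v ∧ ∀ᵐ p ∂(cyl T L), |v p| ≤ B)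
    {j : ℕ} (hj : j < m) {v : ℝ × ℝ → ℝ} (hv : HasWeakDeriv T L 0 j u v) :
    AELipschitz T L B v := by
  refine aeLipschitz_of_moll hL hv.integrable_right
    fun ε hε hεL t t' ht ht' htT htT' x x' => ?_
  rw [← moll_eq_of_hasWeakDeriv hL hε hεL hv ht htT,
    ← moll_eq_of_hasWeakDeriv hL hε hεL hv ht' htT']
  exact abs_moll_jet_sub_le hL hε hεL hv.integrable_left hB hj ht ht' htT htT' x x'

theorem hasWeakDeriv_zero (hu : Integrable u (cyl T L)) : HasWeakDeriv T L 0 0 u u :=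
  ⟨hu, hu, fun φ _ => by simp⟩

theorem integral_kernel_zero_one (hL : 0 < L) (hε : 0 < ε) (hεL : ε < L) (z : ℝ × ℝ) :
    ∫ p, kernel L ε 0 1 (p - z) ∂(cyl T L) = 0 := by
  simp only [kernel, cyl_eq_prod, Prod.fst_sub, Prod.snd_sub]
  rw [integral_prod_mul (fun s => iteratedDeriv 0 (bump ε) (s - z.1))
    (fun y => iteratedDeriv 1 (perBump L ε) (y - z.2))]
  have hp := perBump_periodic hL ε
  refine mul_eq_zero_of_right _ ?_
  rw [space, setIntegral_periodic_sub hL (periodic_iteratedDeriv hp 1),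
    ← integral_Ioc_eq_integral_Ioo, ← intervalIntegral.integral_of_le hL.le]
  have hs := perBump_contDiff hL hε hεL
  rw [intervalIntegral.integral_eq_sub_of_hasDerivAt (f := perBump L ε)
    (fun x _ => by simpa using hasDerivAt_iteratedDeriv hs 0 x)
    ((contDiff_iteratedDeriv hs 1).continuous.intervalIntegrable _ _), hp.eq]
  simp

/-- The commutator of mollification with the nonlinear flux is of order `ε`. Expanding `f (u p)`
around the mean value `c` of `u`, the constant term drops out as `∂_x` of the kernel has integral
zero, the linear term is `f' c` times the mollified `∂_x u`, and the quadratic remainder is `O(ε²)`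
as `u` is Lipschitz, against a kernel of mass `O(1/ε)`. -/
theorem abs_moll_comp_sub_le (hT : 0 < T) (hL : 0 < L) (hε : 0 < ε) (hεL : ε < L)
    {f f' : ℝ → ℝ} {K C Cb : ℝ}
    (hf : ∀ x, HasDerivAt f (f' x) x) (hK : ∀ x y, |f' x - f' y| ≤ K * |x - y|)
    (hCb : ∀ s, |deriv baseBump s| ≤ Cb)
    (hui : Integrable u (cyl T L)) (hfu : Integrable (fun p => f (u p)) (cyl T L))
    (hlip : AELipschitz T L C u) {t x : ℝ} (ht : 0 ≤ t) (htT : t + ε ≤ T) :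
    |moll T L ε 0 1 (fun p => f (u p)) (t, x)
      - f' (moll T L ε 0 0 u (t, x)) * moll T L ε 0 1 u (t, x)| ≤ K * (4 * C) ^ 2 * Cb * ε := by
  have hC := hlip.nonneg hT hL
  have hK0 := lipschitz_const_nonneg hK
  set c := moll T L ε 0 0 u (t, x) with hc
  have hk : Continuous fun p : ℝ × ℝ => kernel L ε 0 1 (p - (t, x)) :=
    (contDiff_kernel hL hε hεL 0 1).continuous.comp (continuous_id.sub continuous_const)
  have hki : Integrable (fun p : ℝ × ℝ => kernel L ε 0 1 (p - (t, x))) (cyl T L) :=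
    integrable_cyl_of_continuous hk
  -- Taylor expansion at the mean value, using that `∂_x` of the kernel integrates to zero
  have e : moll T L ε 0 1 (fun p => f (u p)) (t, x) - f' c * moll T L ε 0 1 u (t, x)
      = -∫ p, (f (u p) - f c - f' c * (u p - c)) * kernel L ε 0 1 (p - (t, x)) ∂(cyl T L) := by
    have e1 : ∀ p, (f (u p) - f c - f' c * (u p - c)) * kernel L ε 0 1 (p - (t, x))
        = f (u p) * kernel L ε 0 1 (p - (t, x)) - f' c * (u p * kernel L ε 0 1 (p - (t, x)))
          - (f c - f' c * c) * kernel L ε 0 1 (p - (t, x)) := fun p => by ring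
    simp only [e1]
    have i1 := integrable_cyl_mul_continuous hfu hk
    have i2 := (integrable_cyl_mul_continuous hui hk).const_mul (f' c)
    have i3 : Integrable (fun p => f (u p) * kernel L ε 0 1 (p - (t, x))
        - f' c * (u p * kernel L ε 0 1 (p - (t, x)))) (cyl T L) := i1.sub i2
    rw [integral_sub i3 (hki.const_mul _), integral_sub i1 i2, integral_const_mul,
      integral_const_mul, integral_kernel_zero_one hL hε hεL]
    simp only [moll]
    ring
  rw [e, abs_neg]
  have hpt : ∀ᵐ p ∂(cyl T L),
      |(f (u p) - f c - f' c * (u p - c)) * kernel L ε 0 1 (p - (t, x))|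
        ≤ K * (4 * C * ε) ^ 2 * (bump ε (p.1 - t) * |deriv (perBump L ε) (p.2 - x)|) := by
    filter_upwards [hlip.exists_abs_sub_moll_le hT hL hui] with p hp
    have ek : |kernel L ε 0 1 (p - (t, x))|
        = bump ε (p.1 - t) * |deriv (perBump L ε) (p.2 - x)| := by
      simp [kernel, abs_mul, abs_of_nonneg (bump_nonneg hε _)]
    rw [abs_mul, ek]
    by_cases hne : kernel L ε 0 1 (p - (t, x)) = 0
    · rw [← ek, hne]; simp
    obtain ⟨h1, k, h2⟩ := kernel_support hL hε hne
    simp only [Prod.fst_sub, Prod.snd_sub] at h1 h2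
    refine mul_le_mul_of_nonneg_right ?_ (by rw [← ek]; exact abs_nonneg _)
    refine (taylor_bound_of_lipschitz_deriv hf hK c (u p)).trans ?_
    refine mul_le_mul_of_nonneg_left ?_ hK0
    have h3 : |u p - c| ≤ 4 * C * ε := by
      refine (hp ε hε hεL t x ht htT k).trans ?_
      nlinarith
    rw [← sq_abs]
    exact pow_le_pow_left₀ (abs_nonneg _) h3 2
  have hcont : Continuous fun p : ℝ × ℝ => bump ε (p.1 - t) * |deriv (perBump L ε) (p.2 - x)| := by
    have h1 := (bump_contDiff ε).continuous
    have h2 := (contDiff_infty_iff_deriv.1 (perBump_contDiff hL hε hεL)).2.continuous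
    fun_prop
  have hint := integrable_cyl_of_continuous (T := T) (L := L) hcont
  refine (abs_integral_le_integral_abs.trans (integral_mono_of_nonneg
    (Eventually.of_forall fun _ => abs_nonneg _) (hint.const_mul _) hpt)).trans ?_
  rw [integral_const_mul, cyl_eq_prod, integral_prod_mul (fun s => bump ε (s - t))
    (fun y => |deriv (perBump L ε) (y - x)|)]
  have hb1 : ∫ s in Ioo 0 T, bump ε (s - t) ≤ 1 := by
    have hi : Integrable (fun s => bump ε s) := by
      by_contra hni
      have := integral_bump hε
      rw [integral_undef hni] at this
      norm_num at this
    calc _ ≤ ∫ s, bump ε (s - t) := setIntegral_le_integral (hi.comp_sub_right t)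
            (Eventually.of_forall fun s => bump_nonneg hε _)
      _ = 1 := by rw [integral_sub_right_eq_self (fun s => bump ε s), integral_bump hε]
  have hb0 : 0 ≤ ∫ s in Ioo 0 T, bump ε (s - t) := integral_nonneg fun s => bump_nonneg hε _
  have hd := integral_abs_deriv_perBump_le hL hε hεL hCb x
  have hd0 : 0 ≤ ∫ y, |deriv (perBump L ε) (y - x)| ∂(space L) :=
    integral_nonneg fun s => abs_nonneg _
  calc K * (4 * C * ε) ^ 2 * _ ≤ K * (4 * C * ε) ^ 2 * (1 * (Cb / ε)) := by
        refine mul_le_mul_of_nonneg_left ?_ (by positivity)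
        exact mul_le_mul hb1 hd hd0 zero_le_one
    _ = K * (4 * C) ^ 2 * Cb * ε := by field_simp

theorem integral_deriv_mul_periodic (hL : 0 < L) {h h' ψ ψ' : ℝ → ℝ}
    (hh : ∀ x, HasDerivAt h (h' x) x) (hψ : ∀ x, HasDerivAt ψ (ψ' x) x)
    (hh'c : Continuous h') (hψ'c : Continuous ψ')
    (hper : h L = h 0) (hψper : ψ L = ψ 0) :
    ∫ x, h' x * ψ x ∂(space L) = -∫ x, h x * ψ' x ∂(space L) := by
  simp only [space]
  rw [← integral_Ioc_eq_integral_Ioo, ← integral_Ioc_eq_integral_Ioo,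
    ← intervalIntegral.integral_of_le hL.le, ← intervalIntegral.integral_of_le hL.le,
    intervalIntegral.integral_mul_deriv_eq_deriv_mul (fun x _ => hh x) (fun x _ => hψ x)
      (hh'c.intervalIntegrable _ _) (hψ'c.intervalIntegrable _ _), hper, hψper]
  ring

/-- Integration by parts in space, on a time slice of the mollification. -/
theorem integral_moll_zero_mul (hL : 0 < L) (hε : 0 < ε) (hεL : ε < L)
    (hu : Integrable u (cyl T L)) {ψ : ℝ → ℝ} (hψ : ContDiff ℝ smoothOrder ψ)
    (hper : Function.Periodic ψ L) (t : ℝ) (i j : ℕ) :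
    ∫ x, moll T L ε i j u (t, x) * ψ x ∂(space L)
      = (-1) ^ j * ∫ x, moll T L ε i 0 u (t, x) * iteratedDeriv j ψ x ∂(space L) := by
  induction j generalizing ψ with
  | zero => simp
  | succ j ih =>
    have hs := isSmoothPeriodic_moll hL hε hεL hu i j
    have hs' := isSmoothPeriodic_moll hL hε hεL hu i (j + 1)
    have hψ' := contDiff_infty_iff_deriv.1 hψ
    rw [integral_deriv_mul_periodic hL (h := fun x => moll T L ε i j u (t, x))
      (h' := fun x => moll T L ε i (j + 1) u (t, x)) (ψ' := deriv ψ)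
      (fun x => by have := hasDerivAt_dx hs.smooth t x; rwa [dx_moll hL hε hεL hu] at this)
      (fun x => (hψ'.1 x).hasDerivAt)
      (hs'.smooth.continuous.comp (Continuous.prodMk_right t)) hψ'.2.continuous
      (by simpa using hs.periodic t 0) (by simpa using hper 0),
      ih hψ'.2 (by simpa using periodic_iteratedDeriv hper 1), iteratedDeriv_succ']
    ring

/-- The filter of the initial trace is proper, so limits along it can be evaluated. -/
theorem neBot_nhdsGT_inf_ae : (𝓝[>] (0 : ℝ) ⊓ ae (volume : Measure ℝ)).NeBot := by
  rw [inf_neBot_iff]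
  intro s hs s' hs'
  obtain ⟨b, hb, hbs⟩ := mem_nhdsGT_iff_exists_Ioo_subset.1 hs
  by_contra hne
  have h1 : Ioo 0 b ⊆ s'ᶜ := fun x hx hx' => hne ⟨x, hbs hx, hx'⟩
  have h2 := measure_mono_null h1 (mem_ae_iff.1 hs')
  rw [Real.volume_Ioo] at h2
  simp at h2
  exact absurd hb (not_lt.2 h2)

theorem eventually_of_ae_Ioo {T : ℝ} (hT : 0 < T) {P : ℝ → Prop}
    (h : ∀ᵐ t ∂(volume.restrict (Ioo 0 T)), P t) :
    ∀ᶠ t in 𝓝[>] (0 : ℝ) ⊓ ae volume, P t := by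
  rw [ae_restrict_iff' measurableSet_Ioo] at h
  have h1 : ∀ᶠ t in 𝓝[>] (0 : ℝ) ⊓ ae volume, t ∈ Ioo 0 T :=
    Eventually.filter_mono inf_le_left (Ioo_mem_nhdsGT hT)
  filter_upwards [h1, Eventually.filter_mono inf_le_right h] with t ht h2 using h2 ht

/-- The mollification at time `0` is close to the initial value. The initial condition on `u` only
concerns almost every small time, and is transported to time `0` by the Lipschitz bound. -/
theorem integral_abs_moll_sub_initial_le (hT : 0 < T) (hL : 0 < L) (hε : 0 < ε) (hεL : ε < L)
    (hεT : ε ≤ T) (hui : Integrable u (cyl T L)) {C : ℝ} (hlip : AELipschitz T L C u)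
    {u₀ : ℝ → ℝ} (hu₀ : Integrable u₀ (space L))
    (hinit : Tendsto (fun t => eLpNorm (fun x => u (t, x) - u₀ x) 2 (space L))
      (𝓝[>] 0 ⊓ ae volume) (𝓝 0)) :
    ∫ x, |moll T L ε 0 0 u (0, x) - u₀ x| ∂(space L) ≤ 2 * C * L * ε := by
  have hC := hlip.nonneg hT hL
  have hmc : Continuous fun x => moll T L ε 0 0 u (0, x) :=
    (isSmoothPeriodic_moll hL hε hεL hui 0 0).smooth.continuous.comp (Continuous.prodMk_right 0)
  have hmi := integrable_space_of_continuous (L := L) hmc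
  have hvol : space L univ = ENNReal.ofReal L := by
    rw [space, Measure.restrict_apply_univ, Real.volume_Ioo, sub_zero]
  have hslice : ∀ᵐ t ∂(volume.restrict (Ioo 0 T)),
      AEStronglyMeasurable (fun x => u (t, x)) (space L) := by
    have := hui.aestronglyMeasurable
    rw [cyl_eq_prod] at this
    exact this.prodMk_left
  have hptw : ∀ᵐ t ∂(volume.restrict (Ioo 0 T)), ∀ᵐ x ∂(space L),
      |u (t, x) - moll T L ε 0 0 u (0, x)| ≤ C * (|t| + 2 * ε) := by
    have h1 := hlip.exists_abs_sub_moll_le hT hL hui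
    rw [cyl_eq_prod] at h1
    filter_upwards [Measure.ae_ae_of_ae_prod h1] with t ht
    filter_upwards [ht] with x hx
    have := hx ε hε hεL 0 x le_rfl (by linarith) 0
    simpa using this
  have key : ∀ᶠ t in 𝓝[>] (0 : ℝ) ⊓ ae volume,
      eLpNorm (fun x => moll T L ε 0 0 u (0, x) - u₀ x) 1 (space L)
        ≤ ENNReal.ofReal L * ENNReal.ofReal (C * (|t| + 2 * ε))
          + eLpNorm (fun x => u (t, x) - u₀ x) 2 (space L) * ENNReal.ofReal L ^ (1 / 2 : ℝ) := by
    filter_upwards [eventually_of_ae_Ioo hT hslice, eventually_of_ae_Ioo hT hptw] with t h1 h2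
    have e : (fun x => moll T L ε 0 0 u (0, x) - u₀ x)
        = (fun x => moll T L ε 0 0 u (0, x) - u (t, x)) + fun x => u (t, x) - u₀ x := by
      funext x; simp
    rw [e]
    refine (eLpNorm_add_le (hmc.aestronglyMeasurable.sub h1)
      (h1.sub hu₀.aestronglyMeasurable) le_rfl).trans (add_le_add ?_ ?_)
    · have := eLpNorm_le_of_ae_bound (p := 1) (f := fun x => moll T L ε 0 0 u (0, x) - u (t, x))
        (μ := space L) (C := C * (|t| + 2 * ε))
        (by filter_upwards [h2] with x hx; rwa [Real.norm_eq_abs, abs_sub_comm])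
      rw [hvol] at this
      simp only [ENNReal.toReal_one, inv_one, ENNReal.rpow_one] at this
      exact this
    · have := eLpNorm_le_eLpNorm_mul_rpow_measure_univ (p := 1) (q := 2) (μ := space L)
        (by norm_num) (h1.sub hu₀.aestronglyMeasurable)
      rw [hvol] at this
      refine this.trans (le_of_eq ?_)
      norm_num
      rfl
  have hlim : Tendsto (fun t : ℝ => ENNReal.ofReal L * ENNReal.ofReal (C * (|t| + 2 * ε))
      + eLpNorm (fun x => u (t, x) - u₀ x) 2 (space L) * ENNReal.ofReal L ^ (1 / 2 : ℝ))
      (𝓝[>] (0 : ℝ) ⊓ ae volume) (𝓝 (ENNReal.ofReal L * ENNReal.ofReal (C * (|0| + 2 * ε))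
        + 0 * ENNReal.ofReal L ^ (1 / 2 : ℝ))) := by
    refine Tendsto.add ?_ ?_
    · refine ENNReal.Tendsto.const_mul ?_ (Or.inr ENNReal.ofReal_ne_top)
      refine ENNReal.tendsto_ofReal ?_
      have hc : Continuous fun t : ℝ => C * (|t| + 2 * ε) := by fun_prop
      exact (hc.tendsto 0).mono_left (inf_le_left.trans nhdsWithin_le_nhds)
    · refine ENNReal.Tendsto.mul_const hinit (Or.inr ?_)
      exact (ENNReal.rpow_lt_top_of_nonneg (by norm_num) ENNReal.ofReal_ne_top).ne
  have := neBot_nhdsGT_inf_ae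
  have hfin := ge_of_tendsto hlim key
  rw [zero_mul, add_zero, abs_zero, zero_add, ← ENNReal.ofReal_mul hL.le] at hfin
  have e1 : ∫ x, |moll T L ε 0 0 u (0, x) - u₀ x| ∂(space L)
      = (eLpNorm (fun x => moll T L ε 0 0 u (0, x) - u₀ x) 1 (space L)).toReal := by
    rw [eLpNorm_one_eq_lintegral_enorm]
    exact integral_norm_eq_lintegral_enorm (hmi.sub hu₀).aestronglyMeasurable
  rw [e1]
  refine ENNReal.toReal_le_of_le_ofReal (by positivity) (hfin.trans (le_of_eq ?_))
  congr 1; ring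

/-- A function whose averages against all smooth periodic probability densities are bounded by `c`
is bounded by `c` almost everywhere. -/
theorem ae_abs_le_of_forall_integral_mul_le (hL : 0 < L) {g : ℝ → ℝ} {c : ℝ}
    (hg : Integrable g (space L))
    (h : ∀ ψ : ℝ → ℝ, ContDiff ℝ smoothOrder ψ → Function.Periodic ψ L → (∀ x, 0 ≤ ψ x) →
      ∫ x, ψ x ∂(space L) = 1 → |∫ x, g x * ψ x ∂(space L)| ≤ c) :
    ∀ᵐ x ∂(space L), |g x| ≤ c := by
  obtain ⟨C, hC0, hC, -⟩ := exists_baseBump_bound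
  set S : Set ℝ := Ioo 0 L with hS
  have hSm : MeasurableSet S := measurableSet_Ioo
  have hloc : LocallyIntegrable (S.indicator g) volume :=
    ((integrable_indicator_iff hSm).2 hg).locallyIntegrable
  have h1 : ∀ᵐ x ∂(space L), _ := ae_restrict_of_ae
    (ae_tendsto_integral_mul_kernel volume hloc (2 * C))
  filter_upwards [h1, ae_restrict_mem hSm] with x hx hxS
  have hlim := tendsto_one_div_succ_nhdsGT
  have hlim0 := (tendsto_nhdsWithin_iff.1 hlim).1
  have hsmall : ∀ᶠ n : ℕ in atTop, 1 / ((n : ℝ) + 1) < L - x :=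
    hlim0.eventually_lt_const (by linarith [hxS.2])
  have hx2 := hx (fun n => 1 / ((n : ℝ) + 1))
    (fun n => S.indicator fun y => perBump L (1 / ((n : ℝ) + 1)) (y - x)) hlim ?_
  · rw [indicator_of_mem hxS] at hx2
    refine le_of_tendsto hx2.abs ?_
    filter_upwards [hsmall] with n hn
    have hε : (0 : ℝ) < 1 / ((n : ℝ) + 1) := by positivity
    have hεL : 1 / ((n : ℝ) + 1) < L := by linarith [hxS.1]
    have := h (fun y => perBump L (1 / ((n : ℝ) + 1)) (y - x))
      ((perBump_contDiff hL hε hεL).comp (contDiff_id.sub contDiff_const))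
      ((perBump_periodic hL _).sub_const x) (fun y => perBump_nonneg L hε _)
      (integral_perBump hL hε hεL x)
    have e : ∫ y, S.indicator g y * S.indicator (fun y => perBump L (1 / ((n : ℝ) + 1)) (y - x)) y
        = ∫ y, g y * perBump L (1 / ((n : ℝ) + 1)) (y - x) ∂(space L) := by
      rw [space, ← integral_indicator hSm]
      refine integral_congr_ae (Eventually.of_forall fun p => ?_)
      by_cases hp : p ∈ S <;> simp [hp]
    rw [e]
    exact this
  · filter_upwards [hsmall] with n hn
    have hε : (0 : ℝ) < 1 / ((n : ℝ) + 1) := by positivity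
    set ε := 1 / ((n : ℝ) + 1)
    have hεL : ε < L := by linarith [hxS.1]
    have hk : Continuous fun y : ℝ => perBump L ε (y - x) :=
      (perBump_contDiff hL hε hεL).continuous.comp (continuous_id.sub continuous_const)
    refine ⟨hk.aestronglyMeasurable.indicator hSm, fun p => ?_, fun p hp => ?_, ?_⟩
    · have hb : |perBump L ε (p - x)| ≤ 2 * C / (2 * ε) := by
        refine (abs_perBump_le hε hC _).trans (le_of_eq ?_)
        field_simp
      have hvol : (volume : Measure ℝ).real (Metric.closedBall x ε) = 2 * ε := by
        rw [Measure.real, Real.volume_closedBall, ENNReal.toReal_ofReal (by positivity)]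
      rw [hvol]
      by_cases hpS : p ∈ S
      · simpa [hpS] using hb
      · simp only [indicator_of_notMem hpS, abs_zero]; positivity
    · by_cases hpS : p ∈ S
      · rw [indicator_of_mem hpS]
        by_contra hne
        apply hp
        rw [Metric.mem_closedBall, Real.dist_eq]
        exact abs_sub_le_of_perBump_ne_zero hL hε hxS (by linarith) hpS hne
      · exact indicator_of_notMem hpS _
    · rw [integral_indicator hSm]
      exact integral_perBump hL hε hεL x

/-- The mollified derivatives at time `0` are close to the derivatives of the initial value. After
testing with `ψ`, a mollification at a second scale `δ` is inserted: its `j` derivatives are moved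
onto `ψ`, where the bound for `j = 0` applies and vanishes as `δ → 0`, whereas the change of the
scale from `ε` to `δ` costs `O(ε + δ)` by the Lipschitz bound on `∂_x^j u`. -/
theorem ae_abs_initial_sub_moll_le (hT : 0 < T) (hL : 0 < L) (hε : 0 < ε) (hεL : ε < L)
    (hεT : ε ≤ T) (hB : ∀ i j, i + j ≤ m → ∃ v, HasWeakDeriv T L i j u v ∧
      ∀ᵐ p ∂(cyl T L), |v p| ≤ B) (hui : Integrable u (cyl T L))
    {u₀ r : ℝ → ℝ} (hinit : Tendsto (fun t => eLpNorm (fun x => u (t, x) - u₀ x) 2 (space L))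
      (𝓝[>] 0 ⊓ ae volume) (𝓝 0)) {j : ℕ} (hj : j < m) (hr : HasSpaceWeakDeriv L j u₀ r) :
    ∀ᵐ x ∂(space L), |r x - moll T L ε 0 j u (0, x)| ≤ 2 * B * ε := by
  obtain ⟨v, hv, -⟩ := hB 0 j (by omega)
  have hlipv := aeLipschitz_of_hasWeakDeriv hL hB hj hv
  have hlip := aeLipschitz_of_hasWeakDeriv hL hB (by omega) (hasWeakDeriv_zero hui)
  have hB0 := hlip.nonneg hT hL
  have hcont : ∀ ε, 0 < ε → ε < L → ∀ j, Continuous fun x => moll T L ε 0 j u (0, x) :=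
    fun ε hε hεL j => (isSmoothPeriodic_moll hL hε hεL hui 0 j).smooth.continuous.comp
      (Continuous.prodMk_right 0)
  have hri := hr.integrable_right
  have hint : Integrable (fun x => r x - moll T L ε 0 j u (0, x)) (space L) :=
    hri.sub (integrable_space_of_continuous (hcont ε hε hεL j))
  refine ae_abs_le_of_forall_integral_mul_le hL hint fun ψ hψ hper hψ0 hψ1 => ?_
  have hψc := hψ.continuous
  have hψi := integrable_space_of_continuous (L := L) hψc
  have hψjc := (contDiff_iteratedDeriv hψ j).continuous
  obtain ⟨M, hM⟩ := (isCompact_Icc (a := (0 : ℝ)) (b := L)).exists_bound_of_continuousOn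
    hψjc.continuousOn
  have hM0 : 0 ≤ M := (norm_nonneg _).trans (hM 0 ⟨le_rfl, hL.le⟩)
  -- compare with the mollification at a second scale `δ`, which is then sent to zero
  have key : ∀ δ, 0 < δ → δ < min L T →
      |∫ x, (r x - moll T L ε 0 j u (0, x)) * ψ x ∂(space L)|
        ≤ M * (2 * B * L * δ) + B * (2 * ε + 2 * δ) := by
    intro δ hδ hδm
    have hδL : δ < L := hδm.trans_le (min_le_left _ _)
    have hδT : δ < T := hδm.trans_le (min_le_right _ _)
    have hmi := integrable_space_of_continuous (L := L) (hcont δ hδ hδL j)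
    have e : ∫ x, (r x - moll T L ε 0 j u (0, x)) * ψ x ∂(space L)
        = (-1) ^ j * -∫ x, (moll T L δ 0 0 u (0, x) - u₀ x) * iteratedDeriv j ψ x ∂(space L)
          - ∫ x, (moll T L ε 0 j u (0, x) - moll T L δ 0 j u (0, x)) * ψ x ∂(space L) := by
      have h1 : ∫ x, r x * ψ x ∂(space L)
          = (-1) ^ j * ∫ x, u₀ x * iteratedDeriv j ψ x ∂(space L) := by
        rw [hr.integral_eq ψ hψ hper, ← mul_assoc, ← mul_pow]; norm_num
      have h2 := integral_moll_zero_mul hL hδ hδL hui hψ hper 0 0 j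
      have i1 := integrable_space_mul_continuous hri hψc
      have i2 := integrable_space_mul_continuous
        (integrable_space_of_continuous (L := L) (hcont ε hε hεL j)) hψc
      have i3 := integrable_space_mul_continuous hmi hψc
      have i4 := integrable_space_mul_continuous
        (integrable_space_of_continuous (L := L) (hcont δ hδ hδL 0)) hψjc
      have i5 := integrable_space_mul_continuous hr.integrable_left hψjc
      simp only [sub_mul]
      rw [integral_sub i1 i2, integral_sub i4 i5, integral_sub i2 i3, h1, h2]
      ring
    rw [e]
    have b1 : |∫ x, (moll T L δ 0 0 u (0, x) - u₀ x) * iteratedDeriv j ψ x ∂(space L)|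
        ≤ M * (2 * B * L * δ) := by
      have i0 : Integrable (fun x => moll T L δ 0 0 u (0, x) - u₀ x) (space L) :=
        (integrable_space_of_continuous (L := L) (hcont δ hδ hδL 0)).sub hr.integrable_left
      calc _ ≤ ∫ x, |(moll T L δ 0 0 u (0, x) - u₀ x) * iteratedDeriv j ψ x| ∂(space L) :=
            abs_integral_le_integral_abs
        _ ≤ ∫ x, M * |moll T L δ 0 0 u (0, x) - u₀ x| ∂(space L) := by
            refine integral_mono_of_nonneg (Eventually.of_forall fun _ => abs_nonneg _)
              (i0.abs.const_mul M) ?_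
            filter_upwards [ae_restrict_mem measurableSet_Ioo] with x hx
            rw [abs_mul, mul_comm]
            exact mul_le_mul_of_nonneg_right (hM x (Ioo_subset_Icc_self hx)) (abs_nonneg _)
        _ ≤ _ := by
            rw [integral_const_mul]
            exact mul_le_mul_of_nonneg_left (integral_abs_moll_sub_initial_le hT hL hδ hδL
              hδT.le hui hlip hr.integrable_left hinit) hM0
    have b2 : |∫ x, (moll T L ε 0 j u (0, x) - moll T L δ 0 j u (0, x)) * ψ x ∂(space L)|
        ≤ B * (2 * ε + 2 * δ) := by
      calc _ ≤ ∫ x, |(moll T L ε 0 j u (0, x) - moll T L δ 0 j u (0, x)) * ψ x| ∂(space L) :=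
            abs_integral_le_integral_abs
        _ ≤ ∫ x, B * (2 * ε + 2 * δ) * ψ x ∂(space L) := by
            refine integral_mono_of_nonneg (Eventually.of_forall fun _ => abs_nonneg _)
              (hψi.const_mul _) (Eventually.of_forall fun x => ?_)
            simp only [abs_mul, abs_of_nonneg (hψ0 x)]
            refine mul_le_mul_of_nonneg_right ?_ (hψ0 x)
            rw [moll_eq_of_hasWeakDeriv hL hε hεL hv le_rfl (by linarith),
              moll_eq_of_hasWeakDeriv hL hδ hδL hv le_rfl (by linarith)]
            exact hlipv.abs_moll_sub_moll_le hT hL hv.integrable_right hε hεL hδ hδL le_rfl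
              (by linarith) (by linarith) x
        _ = _ := by rw [integral_const_mul, hψ1, mul_one]
    refine (abs_sub _ _).trans (add_le_add ?_ b2)
    rw [abs_mul, abs_pow, abs_neg, abs_neg, abs_one, one_pow, one_mul]
    exact b1
  have hlim : Tendsto (fun δ => M * (2 * B * L * δ) + B * (2 * ε + 2 * δ)) (𝓝[>] 0)
      (𝓝 (M * (2 * B * L * 0) + B * (2 * ε + 2 * 0))) :=
    ((by fun_prop : Continuous fun δ => M * (2 * B * L * δ) + B * (2 * ε + 2 * δ)).tendsto
      0).mono_left nhdsWithin_le_nhds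
  have h := ge_of_tendsto hlim (by
    filter_upwards [Ioo_mem_nhdsGT (lt_min hL hT)] with δ hδ using key δ hδ.1 hδ.2)
  refine h.trans (le_of_eq (by ring))

end

/-! ### The mollified jet of a solution of the limit equation -/

/-- Mollification at scale `ε` of the solution of the limit equation gives an approximate jet with
an error `O(ε)`, uniformly close to the derivatives of `u` of order less than `m`. -/
theorem exists_isApproxJet {T L : ℝ} {m : ℕ} (hm0 : 0 < m) (hT : 0 < T) (hL : 0 < L)
    {f f' : ℝ → ℝ} {K : ℝ}
    (hf : ∀ x, HasDerivAt f (f' x) x) (hK : ∀ x y, |f' x - f' y| ≤ K * |x - y|)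
    {u : ℝ × ℝ → ℝ} (hu : MemSobolevInf T L m u) {u₀ : ℝ → ℝ}
    (hsol : IsLimitSolution T L m f u u₀)
    {du₀ : ℕ → ℝ → ℝ} (hdu₀ : ∀ j < m, HasSpaceWeakDeriv L j u₀ (du₀ j)) :
    ∃ B C : ℝ, 0 ≤ B ∧ 0 ≤ C ∧ ∀ ε, 0 < ε → ε < min L T →
      ∃ D, IsApproxJet (T - ε) L m f' du₀ B (C * ε) D ∧
        ∀ j < m, ∀ v, HasWeakDeriv T L 0 j u v →
          ∀ᵐ p ∂(cyl T L), p.1 ≤ T - ε → |v p - D 0 j p| ≤ C * ε := by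
  obtain ⟨B, hB⟩ := hu.exists_bound
  obtain ⟨Cb, hCb0, -, hCb⟩ := exists_baseBump_bound
  obtain ⟨ut, fx, um, hut, hfx, hum, heq⟩ := hsol.equation
  have hui := hut.integrable_left
  have hlip := aeLipschitz_of_hasWeakDeriv hL hB hm0 (hasWeakDeriv_zero hui)
  have hB0 := hlip.nonneg hT hL
  have hK0 := lipschitz_const_nonneg hK
  have hC0 : 0 ≤ K * (4 * B) ^ 2 * Cb := by positivity
  refine ⟨B, 2 * B + K * (4 * B) ^ 2 * Cb, hB0, by positivity, fun ε hε hεm => ?_⟩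
  have hεL : ε < L := hεm.trans_le (min_le_left _ _)
  have hεT : ε < T := hεm.trans_le (min_le_right _ _)
  refine ⟨fun i j => moll T L ε i j u, ⟨isSmoothPeriodic_moll hL hε hεL hui,
    dt_moll hL hε hεL hui, dx_moll hL hε hεL hui,
    fun i j hij t x ht htT => abs_moll_jet_le hL hε hεL hB hij ht (by linarith),
    fun t x ht htT => ?_, fun j hj => ?_⟩, fun j hj v hv => ?_⟩
  · have htε : t + ε ≤ T := by linarith
    have h1 := abs_moll_comp_sub_le (x := x) hT hL hε hεL hf hK hCb hui hfx.integrable_left hlip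
      ht htε
    rw [moll_eq_of_hasWeakDeriv hL hε hεL hfx ht htε] at h1
    have h2 : moll T L ε 1 0 u (t, x) + moll T L ε 0 0 fx (t, x)
        + sigma m * moll T L ε 0 m u (t, x) = 0 := by
      rw [moll_eq_of_hasWeakDeriv hL hε hεL hut ht htε,
        moll_eq_of_hasWeakDeriv hL hε hεL hum ht htε]
      have hk : Continuous fun p : ℝ × ℝ => kernel L ε 0 0 (p - (t, x)) :=
        (contDiff_kernel hL hε hεL 0 0).continuous.comp (continuous_id.sub continuous_const)
      have i1 := integrable_cyl_mul_continuous hut.integrable_right hk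
      have i2 := integrable_cyl_mul_continuous hfx.integrable_right hk
      have i3 := (integrable_cyl_mul_continuous hum.integrable_right hk).const_mul (sigma m)
      simp only [moll, add_zero, pow_zero, one_mul]
      have i12 : Integrable (fun p => ut p * kernel L ε 0 0 (p - (t, x))
          + fx p * kernel L ε 0 0 (p - (t, x))) (cyl T L) := i1.add i2
      rw [← integral_const_mul, ← integral_add i1 i2, ← integral_add i12 i3]
      refine integral_eq_zero_of_ae ?_
      filter_upwards [heq] with p hp
      simp only [Pi.zero_apply]
      linear_combination kernel L ε 0 0 (p - (t, x)) * hp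
    have h3 : moll T L ε 1 0 u (t, x) + sigma m * moll T L ε 0 m u (t, x)
        + f' (moll T L ε 0 0 u (t, x)) * moll T L ε 0 1 u (t, x)
        = -(moll T L ε 0 0 fx (t, x)
          - f' (moll T L ε 0 0 u (t, x)) * moll T L ε 0 1 u (t, x)) := by
      linear_combination h2
    rw [h3, abs_neg]
    refine h1.trans ?_
    have := mul_nonneg hB0 hε.le
    linarith
  · filter_upwards [ae_abs_initial_sub_moll_le hT hL hε hεL hεT.le hB hui hsol.initial hj
      (hdu₀ j hj)] with x hx
    refine hx.trans ?_
    have := mul_nonneg hC0 hε.le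
    linarith
  · filter_upwards [(aeLipschitz_of_hasWeakDeriv hL hB hj hv).exists_abs_sub_moll_le hT hL
      hv.integrable_right, ae_cyl_mem T L] with p hp hpm hpt
    rw [← Prod.mk.eta (p := p), moll_eq_of_hasWeakDeriv hL hε hεL hv hpm.1.1.le (by linarith)]
    have := hp ε hε hεL p.1 p.2 hpm.1.1.le (by linarith) 0
    simp only [sub_self, abs_zero, Int.cast_zero, zero_mul, zero_add] at this
    refine this.trans ?_
    have := mul_nonneg hC0 hε.le
    linarith

/-! ### Signs and reindexing -/

theorem neg_one_pow_congr {a b c : ℕ} (h : a + b = 2 * c) : (-1 : ℝ) ^ a = (-1) ^ b := by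
  have h1 : (-1 : ℝ) ^ a * (-1) ^ b = 1 := by rw [← pow_add, h, pow_mul]; norm_num
  rcases neg_one_pow_eq_or ℝ a with ha | ha <;> rcases neg_one_pow_eq_or ℝ b with hb | hb <;>
    rw [ha, hb] at h1 ⊢ <;> norm_num at h1

theorem sgn_of_lt {n j : ℕ} (hj : j < n) : sgn (2 * n) j = (-1) ^ (n + j) := by
  rw [sgn, if_pos (by omega), sigma, ← pow_add]; congr 2; omega

theorem sgn_of_le {n j : ℕ} (hn : 0 < n) (hj : n ≤ j) : sgn (2 * n) j = (-1) ^ (n + j + 1) := by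
  rw [sgn, if_neg (by omega), sigma, ← pow_add]
  exact neg_one_pow_congr (c := 2 * n + j) (by omega)

theorem sgn_mid {n : ℕ} (hn : 0 < n) : sgn (2 * n) n = -1 := by
  rw [sgn_of_le hn le_rfl, neg_one_pow_congr (b := 1) (c := n + 1) (by omega), pow_one]

theorem sgn_zero {n : ℕ} (hn : 0 < n) : sgn (2 * n) 0 = sigma (2 * n) := by
  rw [sgn_of_lt hn, sigma]; congr 1; omega

theorem sgn_reflect {n j : ℕ} (hj : j < 2 * n) : sgn (2 * n) (2 * n - 1 - j) = sgn (2 * n) j := by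
  rcases lt_or_ge j n with h | h
  · rw [sgn_of_lt h, sgn_of_le (by omega) (by omega)]
    exact neg_one_pow_congr (c := 2 * n) (by omega)
  · rw [sgn_of_le (by omega) h, sgn_of_lt (by omega)]
    exact neg_one_pow_congr (c := 2 * n) (by omega)

theorem sgn_compl {n k : ℕ} (hk : 1 ≤ k) (hk2 : k < 2 * n) (hkn : k ≠ n) :
    sgn (2 * n) (2 * n - k) = -sgn (2 * n) k := by
  rcases lt_or_gt_of_ne hkn with h | h
  · rw [sgn_of_lt h, sgn_of_le (by omega) (by omega),
      show -((-1 : ℝ) ^ (n + k)) = (-1) ^ (n + k + 1) by rw [pow_succ]; ring]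
    exact neg_one_pow_congr (c := 2 * n + 1) (by omega)
  · rw [sgn_of_le (by omega) h.le, sgn_of_lt (by omega),
      show -((-1 : ℝ) ^ (n + k + 1)) = (-1) ^ (n + k + 1 + 1) by rw [pow_succ _ (n + k + 1)]; ring]
    exact neg_one_pow_congr (c := 2 * n + 1) (by omega)

theorem sgn_mul_self (m j : ℕ) : sgn m j * sgn m j = 1 := by
  have h : ∀ a b : ℕ, ((-1 : ℝ) ^ a * (-1) ^ b) * ((-1) ^ a * (-1) ^ b) = 1 := fun a b => by
    rw [← pow_add, ← pow_add, ← two_mul, pow_mul]; norm_num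
  unfold sgn sigma
  split_ifs
  · exact h _ _
  · exact h _ _

theorem abs_sgn (m j : ℕ) : |sgn m j| = 1 := by
  have h := sgn_mul_self m j
  rw [← abs_mul_abs_self] at h
  nlinarith [abs_nonneg (sgn m j)]

theorem abs_sigma (m : ℕ) : |sigma m| = 1 := by
  rw [sigma, abs_pow, abs_neg, abs_one, one_pow]

theorem sum_Ico_compl {m : ℕ} (g : ℕ → ℕ → ℝ) :
    ∑ j ∈ Finset.Ico 1 m, g j (m - j) = ∑ k ∈ Finset.Ico 1 m, g (m - k) k := by
  refine Finset.sum_nbij' (fun j => m - j) (fun j => m - j) ?_ ?_ ?_ ?_ ?_ <;>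
    intro j hj <;> rw [Finset.mem_Ico] at hj
  · rw [Finset.mem_Ico]; omega
  · rw [Finset.mem_Ico]; omega
  · omega
  · omega
  · rw [show m - (m - j) = j by omega]

theorem sum_range_refl {m : ℕ} (g : ℕ → ℕ → ℝ) :
    ∑ j ∈ Finset.range m, g j (m - 1 - j) = ∑ k ∈ Finset.range m, g (m - 1 - k) k := by
  refine Finset.sum_nbij' (fun j => m - 1 - j) (fun j => m - 1 - j) ?_ ?_ ?_ ?_ ?_ <;>
    intro j hj <;> rw [Finset.mem_range] at hj
  · rw [Finset.mem_range]; omega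
  · rw [Finset.mem_range]; omega
  · omega
  · omega
  · rw [show m - 1 - (m - 1 - j) = j by omega]

theorem sum_range_eq_zero_add_Ico {m : ℕ} (hm : 0 < m) (g : ℕ → ℝ) :
    ∑ j ∈ Finset.range m, g j = g 0 + ∑ j ∈ Finset.Ico 1 m, g j := by
  rw [Finset.range_eq_Ico, Finset.sum_eq_sum_Ico_succ_bot hm]

/-- The source terms produce only the middle component: the contributions of `k` and `2n - k` cancel
unless `k = n`. -/
theorem sum_sgn_mul_compl {n : ℕ} (hn : 0 < n) (P : ℕ → ℝ) :
    ∑ k ∈ Finset.Ico 1 (2 * n), sgn (2 * n) (2 * n - k) * P k * P (2 * n - k) = -P n ^ 2 := by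
  have h1 := sum_Ico_compl (m := 2 * n) (fun j k => sgn (2 * n) j * P k * P j)
  have hn' : n ∈ Finset.Ico 1 (2 * n) := Finset.mem_Ico.2 ⟨hn, by omega⟩
  have h3 : ∑ k ∈ Finset.Ico 1 (2 * n), (sgn (2 * n) (2 * n - k) + sgn (2 * n) k)
      * P k * P (2 * n - k) = -2 * P n ^ 2 := by
    rw [Finset.sum_eq_single_of_mem n hn']
    · rw [show 2 * n - n = n by omega, sgn_mid hn]; ring
    · intro k hk hkn
      rw [Finset.mem_Ico] at hk
      rw [sgn_compl hk.1 hk.2 hkn]; ring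
  simp only [add_mul, Finset.sum_add_distrib] at h3
  have h4 : ∑ k ∈ Finset.Ico 1 (2 * n), sgn (2 * n) k * P k * P (2 * n - k)
      = ∑ k ∈ Finset.Ico 1 (2 * n), sgn (2 * n) (2 * n - k) * P k * P (2 * n - k) := by
    rw [← h1]
    exact Finset.sum_congr rfl fun k _ => by ring
  linarith

/-- The production of relative energy, written in terms of the difference `y - P`: an exact space
derivative (the first bracket, for `F₀ = f (P 0)` and `P`, `Pt`, `Px` the values and derivatives of
a smooth field), the damping `-(y n - P n)²`, the residuals of the linear equations for `P` paired
with `y k - P k`, and the terms of the zeroth equation. In the middle equation `2 * P n` is added to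
the residual, because the source terms of the entropy inequality have been replaced by `-(y n)²`. -/
theorem relative_production_identity {n : ℕ} (hn : 0 < n) (τ F F₀ : ℝ) (y P Pt Px : ℕ → ℝ) :
    -(y n) ^ 2 - y 0 * Pt 0 - F * Px 0 - sigma (2 * n) * y (2 * n - 1) * Px 0
      - ∑ j ∈ Finset.Ico 1 (2 * n), (τ * y j * Pt j + sgn (2 * n) j * y (2 * n - j - 1) * Px j
          + sgn (2 * n) j * y (2 * n - j) * P j)
      + P 0 * Pt 0 + τ * ∑ j ∈ Finset.Ico 1 (2 * n), P j * Pt j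
    = (-F₀ * Px 0 - ∑ k ∈ Finset.range (2 * n), sgn (2 * n) k * P k * Px (2 * n - 1 - k))
      - (y n - P n) ^ 2
      - ∑ k ∈ Finset.Ico 1 (2 * n), (y k - P k) * (τ * Pt k + sgn (2 * n) k * Px (2 * n - 1 - k)
          + sgn (2 * n) (2 * n - k) * P (2 * n - k) + if k = n then 2 * P n else 0)
      - (y 0 - P 0) * (Pt 0 + sigma (2 * n) * Px (2 * n - 1)) - (F - F₀) * Px 0 := by
  have h1 : sigma (2 * n) * y (2 * n - 1) * Px 0
      + ∑ j ∈ Finset.Ico 1 (2 * n), sgn (2 * n) j * y (2 * n - j - 1) * Px j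
      = ∑ k ∈ Finset.range (2 * n), sgn (2 * n) k * y k * Px (2 * n - 1 - k) := by
    have := sum_range_refl (m := 2 * n) (fun j k => sgn (2 * n) j * y j * Px k)
    rw [this, sum_range_eq_zero_add_Ico (by omega)]
    rw [sgn_reflect (by omega : 0 < 2 * n), sgn_zero hn, Nat.sub_zero]
    congr 1
    refine Finset.sum_congr rfl fun j hj => ?_
    rw [Finset.mem_Ico] at hj
    rw [sgn_reflect hj.2, show 2 * n - j - 1 = 2 * n - 1 - j by omega]
  have h2 := sum_Ico_compl (m := 2 * n) (fun j k => sgn (2 * n) j * y k * P j)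
  have h3 := sum_sgn_mul_compl hn P
  have hn' : n ∈ Finset.Ico 1 (2 * n) := Finset.mem_Ico.2 ⟨hn, by omega⟩
  have h4 : ∑ k ∈ Finset.Ico 1 (2 * n), (y k - P k) * (if k = n then 2 * P n else 0)
      = (y n - P n) * (2 * P n) := by
    rw [Finset.sum_eq_single_of_mem n hn']
    · simp
    · intro k _ hkn; simp [hkn]
  have h5 := sum_range_eq_zero_add_Ico (m := 2 * n) (by omega)
    (fun k => sgn (2 * n) k * y k * Px (2 * n - 1 - k))
  have h6 := sum_range_eq_zero_add_Ico (m := 2 * n) (by omega)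
    (fun k => sgn (2 * n) k * P k * Px (2 * n - 1 - k))
  rw [sgn_zero hn, Nat.sub_zero] at h5 h6
  have e1 : ∑ j ∈ Finset.Ico 1 (2 * n), (τ * y j * Pt j + sgn (2 * n) j * y (2 * n - j - 1) * Px j
          + sgn (2 * n) j * y (2 * n - j) * P j)
      = τ * ∑ j ∈ Finset.Ico 1 (2 * n), y j * Pt j
        + ∑ j ∈ Finset.Ico 1 (2 * n), sgn (2 * n) j * y (2 * n - j - 1) * Px j
        + ∑ j ∈ Finset.Ico 1 (2 * n), sgn (2 * n) j * y (2 * n - j) * P j := by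
    rw [Finset.sum_add_distrib, Finset.sum_add_distrib, Finset.mul_sum]
    congr 2
    exact Finset.sum_congr rfl fun j _ => by ring
  have e2 : ∑ k ∈ Finset.Ico 1 (2 * n), (y k - P k) * (τ * Pt k
          + sgn (2 * n) k * Px (2 * n - 1 - k)
          + sgn (2 * n) (2 * n - k) * P (2 * n - k) + if k = n then 2 * P n else 0)
      = τ * ∑ j ∈ Finset.Ico 1 (2 * n), y j * Pt j - τ * ∑ j ∈ Finset.Ico 1 (2 * n), P j * Pt j
        + ∑ k ∈ Finset.Ico 1 (2 * n), sgn (2 * n) k * y k * Px (2 * n - 1 - k)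
        - ∑ k ∈ Finset.Ico 1 (2 * n), sgn (2 * n) k * P k * Px (2 * n - 1 - k)
        + ∑ k ∈ Finset.Ico 1 (2 * n), sgn (2 * n) (2 * n - k) * y k * P (2 * n - k)
        - ∑ k ∈ Finset.Ico 1 (2 * n), sgn (2 * n) (2 * n - k) * P k * P (2 * n - k)
        + ∑ k ∈ Finset.Ico 1 (2 * n), (y k - P k) * (if k = n then 2 * P n else 0) := by
    simp only [Finset.mul_sum, ← Finset.sum_add_distrib, ← Finset.sum_sub_distrib]
    exact Finset.sum_congr rfl fun j _ => by ring
  rw [e1, e2, h4, h3]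
  linear_combination h6 - h5 - h1 - h2

/-! ### The corrected profile -/

section SmoothPeriodic

variable {L : ℝ}

theorem IsSmoothPeriodic.add {φ ψ : ℝ × ℝ → ℝ} (hφ : IsSmoothPeriodic L φ)
    (hψ : IsSmoothPeriodic L ψ) : IsSmoothPeriodic L (fun z => φ z + ψ z) :=
  ⟨hφ.smooth.add hψ.smooth, fun t x => by rw [hφ.periodic, hψ.periodic]⟩

theorem IsSmoothPeriodic.const_mul {φ : ℝ × ℝ → ℝ} (hφ : IsSmoothPeriodic L φ) (c : ℝ) :
    IsSmoothPeriodic L (fun z => c * φ z) :=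
  ⟨contDiff_const.mul hφ.smooth, fun t x => by rw [hφ.periodic]⟩

theorem IsSmoothPeriodic.sum {ι : Type*} {s : Finset ι} {φ : ι → ℝ × ℝ → ℝ}
    (hφ : ∀ i ∈ s, IsSmoothPeriodic L (φ i)) : IsSmoothPeriodic L (fun z => ∑ i ∈ s, φ i z) :=
  ⟨ContDiff.sum fun i hi => (hφ i hi).smooth,
    fun t x => Finset.sum_congr rfl fun i hi => (hφ i hi).periodic t x⟩

end SmoothPeriodic

/-- The coefficients in the recursion of `corrector`: below the middle index `n` the sum runs over
`i < k < n`, from `n` on over `n < k ≤ i`, with the opposite sign. -/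
noncomputable def corrCoeff (n i k : ℕ) : ℝ :=
  if i < k ∧ k < n then sgn (2 * n) k else if n < k ∧ k ≤ i then -sgn (2 * n) k else 0

/-- The derivative `∂_t^a ∂_x^b` of the first order correction `w_i` to `∂_x^i u`, where
`w_i = ∑_{i < k < n} sgn_k ∂_t ∂_x^{2n+i-2k} u` for `i < n` and
`w_i = -∑_{n < k ≤ i} sgn_k ∂_t ∂_x^{2n+i-2k} u` for `i ≥ n`. It solves
`∂_x w_{i-1} - w_i = sgn_i ∂_t ∂_x^{2n-i} u` for `1 ≤ i < 2n`, `i ≠ n`. For `i < 2n`,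
`2n + i - 2k ≥ 0` whenever the coefficient does not vanish, so the truncated subtraction is the true
one. -/
noncomputable def corrector (n : ℕ) (D : ℕ → ℕ → ℝ × ℝ → ℝ) (a b i : ℕ) (z : ℝ × ℝ) : ℝ :=
  ∑ k ∈ Finset.range (2 * n), corrCoeff n i k * D (1 + a) (2 * n + i - 2 * k + b) z

/-- The derivative `∂_t^a ∂_x^b` of the comparison field `∂_x^i u + τ w_i`. -/
noncomputable def profile (n : ℕ) (D : ℕ → ℕ → ℝ × ℝ → ℝ) (τ : ℝ) (a b i : ℕ) (z : ℝ × ℝ) : ℝ :=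
  D a (i + b) z + τ * corrector n D a b i z

theorem abs_corrCoeff_le (n i k : ℕ) : |corrCoeff n i k| ≤ 1 := by
  unfold corrCoeff
  split_ifs <;> simp [abs_sgn]

theorem corrector_mid_left {n : ℕ} (hn : 0 < n) (D : ℕ → ℕ → ℝ × ℝ → ℝ) (a b : ℕ) (z : ℝ × ℝ) :
    corrector n D a b (n - 1) z = 0 := by
  refine Finset.sum_eq_zero fun k _ => ?_
  rw [corrCoeff, if_neg (by omega), if_neg (by omega), zero_mul]

theorem corrector_mid (n : ℕ) (D : ℕ → ℕ → ℝ × ℝ → ℝ) (a b : ℕ) (z : ℝ × ℝ) :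
    corrector n D a b n z = 0 := by
  refine Finset.sum_eq_zero fun k _ => ?_
  rw [corrCoeff, if_neg (by omega), if_neg (by omega), zero_mul]

/-- The relation which makes the `τ`-terms in the residuals cancel. -/
theorem corrector_dx_sub {n : ℕ} (D : ℕ → ℕ → ℝ × ℝ → ℝ) {i : ℕ} (hi : 1 ≤ i)
    (hi2 : i < 2 * n) (hin : i ≠ n) (z : ℝ × ℝ) :
    corrector n D 0 1 (i - 1) z - corrector n D 0 0 i z = sgn (2 * n) i * D 1 (2 * n - i) z := by
  rw [corrector, corrector, ← Finset.sum_sub_distrib,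
    Finset.sum_eq_single_of_mem i (Finset.mem_range.2 hi2)]
  · rw [show 2 * n + (i - 1) - 2 * i + 1 = 2 * n - i by omega,
      show 2 * n + i - 2 * i + 0 = 2 * n - i by omega, ← sub_mul]
    congr 1
    rcases lt_or_gt_of_ne hin with h | h
    · rw [corrCoeff, corrCoeff, if_pos (by omega), if_neg (by omega), if_neg (by omega), sub_zero]
    · rw [corrCoeff, corrCoeff, if_neg (by omega), if_neg (by omega), if_neg (by omega),
        if_pos (by omega)]
      ring
  · intro k hk hki
    rw [Finset.mem_range] at hk
    have e : corrCoeff n (i - 1) k = corrCoeff n i k := by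
      unfold corrCoeff
      have h1 : (i - 1 < k ∧ k < n) ↔ (i < k ∧ k < n) := by omega
      have h2 : (n < k ∧ k ≤ i - 1) ↔ (n < k ∧ k ≤ i) := by omega
      simp only [h1, h2]
    rw [e]
    by_cases h0 : corrCoeff n i k = 0
    · simp [h0]
    have : 2 * n + (i - 1) - 2 * k + 1 = 2 * n + i - 2 * k + 0 := by
      unfold corrCoeff at h0
      by_cases h1 : i < k ∧ k < n
      · omega
      · rw [if_neg h1] at h0
        by_cases h2 : n < k ∧ k ≤ i
        · omega
        · rw [if_neg h2] at h0; exact absurd rfl h0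
    rw [this, sub_self]

namespace IsApproxJet

variable {T L : ℝ} {n : ℕ} {f' : ℝ → ℝ} {r : ℕ → ℝ → ℝ} {B δ : ℝ} {D : ℕ → ℕ → ℝ × ℝ → ℝ}

theorem isSmoothPeriodic_profile (J : IsApproxJet T L (2 * n) f' r B δ D) (τ : ℝ) (a b i : ℕ) :
    IsSmoothPeriodic L (profile n D τ a b i) :=
  (J.smooth _ _).add
    ((IsSmoothPeriodic.sum fun _ _ => (J.smooth _ _).const_mul _).const_mul τ)

theorem dt_profile (J : IsApproxJet T L (2 * n) f' r B δ D) (τ : ℝ) (a b i : ℕ) :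
    dt (profile n D τ a b i) = profile n D τ (a + 1) b i := by
  funext ⟨t, x⟩
  have h : ∀ i j, HasDerivAt (fun s => D i j (s, x)) (D (i + 1) j (t, x)) t := fun i j => by
    rw [← J.dt_eq]; exact hasDerivAt_dt (J.smooth i j).smooth t x
  have := (h a (i + b)).fun_add ((HasDerivAt.fun_sum (u := Finset.range (2 * n)) fun k _ =>
    (h (1 + a) (2 * n + i - 2 * k + b)).const_mul (corrCoeff n i k)).const_mul τ)
  exact this.deriv

theorem dx_profile (J : IsApproxJet T L (2 * n) f' r B δ D) (τ : ℝ) (a b i : ℕ) :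
    dx (profile n D τ a b i) = profile n D τ a (b + 1) i := by
  funext ⟨t, x⟩
  have h : ∀ i j, HasDerivAt (fun y => D i j (t, y)) (D i (j + 1) (t, x)) x := fun i j => by
    rw [← J.dx_eq]; exact hasDerivAt_dx (J.smooth i j).smooth t x
  have := (h a (i + b)).fun_add ((HasDerivAt.fun_sum (u := Finset.range (2 * n)) fun k _ =>
    (h (1 + a) (2 * n + i - 2 * k + b)).const_mul (corrCoeff n i k)).const_mul τ)
  exact this.deriv

theorem bound_nonneg (J : IsApproxJet T L (2 * n) f' r B δ D) (hT : 0 ≤ T) : 0 ≤ B :=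
  (abs_nonneg _).trans (J.bound 0 0 (by omega) 0 0 le_rfl hT)

theorem abs_corrector_le (J : IsApproxJet T L (2 * n) f' r B δ D) {a b i : ℕ} (hab : a + b ≤ 1)
    (hi : i < 2 * n) {t : ℝ} (ht : 0 ≤ t) (htT : t ≤ T) (x : ℝ) :
    |corrector n D a b i (t, x)| ≤ 2 * n * B := by
  have hB := J.bound_nonneg (ht.trans htT)
  refine (Finset.abs_sum_le_sum_abs _ _).trans ?_
  have h : ∀ k ∈ Finset.range (2 * n),
      |corrCoeff n i k * D (1 + a) (2 * n + i - 2 * k + b) (t, x)| ≤ B := by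
    intro k _
    rw [abs_mul]
    by_cases h0 : corrCoeff n i k = 0
    · rw [h0, abs_zero, zero_mul]; exact hB
    · have hle : 1 + a + (2 * n + i - 2 * k + b) ≤ 2 * n := by
        unfold corrCoeff at h0
        by_cases h1 : i < k ∧ k < n
        · omega
        · rw [if_neg h1] at h0
          by_cases h2 : n < k ∧ k ≤ i
          · omega
          · rw [if_neg h2] at h0; exact absurd rfl h0
      calc _ ≤ 1 * B := mul_le_mul (abs_corrCoeff_le n i k) (J.bound _ _ hle t x ht htT)
            (abs_nonneg _) zero_le_one
        _ = B := one_mul B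
  refine (Finset.sum_le_card_nsmul _ _ _ h).trans (le_of_eq ?_)
  rw [Finset.card_range, nsmul_eq_mul]; push_cast; ring

theorem abs_profile_sub_le (J : IsApproxJet T L (2 * n) f' r B δ D) {τ : ℝ} (hτ : 0 ≤ τ) {i : ℕ}
    (hi : i < 2 * n) {t : ℝ} (ht : 0 ≤ t) (htT : t ≤ T) (x : ℝ) :
    |profile n D τ 0 0 i (t, x) - D 0 i (t, x)| ≤ 2 * n * B * τ := by
  rw [profile, add_zero, add_sub_cancel_left, abs_mul, abs_of_nonneg hτ, mul_comm]
  exact mul_le_mul_of_nonneg_right (J.abs_corrector_le (by omega) hi ht htT x) hτ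

end IsApproxJet

theorem neg_mul_le_half_sq_add (a b : ℝ) : -(a * b) ≤ a ^ 2 / 2 + b ^ 2 / 2 := by
  nlinarith [sq_nonneg (a + b)]

section Residual

variable {T L : ℝ} {n : ℕ} {f' : ℝ → ℝ} {r : ℕ → ℝ → ℝ} {B δ K A τ : ℝ}
  {D : ℕ → ℕ → ℝ × ℝ → ℝ} {z : ℝ × ℝ}

/-- The profile solves the equation for the zeroth component up to `O(τ + δ)`. This suffices, as the
zeroth component enters the energy without a weight. -/
theorem abs_zeroth_residual_le (hn : 0 < n) (hK : ∀ x y, |f' x - f' y| ≤ K * |x - y|)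
    (hA0 : 0 ≤ A) (hδ : 0 ≤ δ) (hτ : 0 < τ)
    (hres : |D 1 0 z + sigma (2 * n) * D 0 (2 * n) z + f' (D 0 0 z) * D 0 1 z| ≤ δ)
    (hcorr : ∀ a b i, a + b ≤ 1 → i < 2 * n → |corrector n D a b i z| ≤ A)
    (hD : |D 0 0 z| ≤ A) (hPx0 : |profile n D τ 0 1 0 z| ≤ 2 * A) :
    |profile n D τ 1 0 0 z + sigma (2 * n) * profile n D τ 0 1 (2 * n - 1) z
        + f' (profile n D τ 0 0 0 z) * profile n D τ 0 1 0 z|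
      ≤ (1 + 2 * A + 2 * K * A ^ 2 + (|f' 0| + K * A) * A) * (τ + δ) := by
  have hK0 := lipschitz_const_nonneg hK
  set M : ℝ := |f' 0| + K * A with hM
  have hM0 : 0 ≤ M := by positivity
  have e : profile n D τ 1 0 0 z + sigma (2 * n) * profile n D τ 0 1 (2 * n - 1) z
        + f' (profile n D τ 0 0 0 z) * profile n D τ 0 1 0 z
      = (D 1 0 z + sigma (2 * n) * D 0 (2 * n) z + f' (D 0 0 z) * D 0 1 z)
        + τ * corrector n D 1 0 0 z
        + sigma (2 * n) * (τ * corrector n D 0 1 (2 * n - 1) z)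
        + (f' (profile n D τ 0 0 0 z) - f' (D 0 0 z)) * profile n D τ 0 1 0 z
        + f' (D 0 0 z) * (τ * corrector n D 0 1 0 z) := by
    have e1 : profile n D τ 1 0 0 z = D 1 0 z + τ * corrector n D 1 0 0 z := rfl
    have e2 : profile n D τ 0 1 0 z = D 0 1 z + τ * corrector n D 0 1 0 z := by simp [profile]
    have e3 : profile n D τ 0 1 (2 * n - 1) z = D 0 (2 * n) z
        + τ * corrector n D 0 1 (2 * n - 1) z := by
      simp only [profile]; rw [show 2 * n - 1 + 1 = 2 * n by omega]
    rw [e1, e3, e2]; ring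
  have b1 : |τ * corrector n D 1 0 0 z| ≤ τ * A := by
    rw [abs_mul, abs_of_pos hτ]
    exact mul_le_mul_of_nonneg_left (hcorr 1 0 0 (by omega) (by omega)) hτ.le
  have b2 : |sigma (2 * n) * (τ * corrector n D 0 1 (2 * n - 1) z)| ≤ τ * A := by
    rw [abs_mul, abs_sigma, one_mul, abs_mul, abs_of_pos hτ]
    exact mul_le_mul_of_nonneg_left (hcorr 0 1 _ (by omega) (by omega)) hτ.le
  have b3 : |(f' (profile n D τ 0 0 0 z) - f' (D 0 0 z)) * profile n D τ 0 1 0 z|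
      ≤ τ * (2 * K * A ^ 2) := by
    rw [abs_mul]
    have e1 : profile n D τ 0 0 0 z - D 0 0 z = τ * corrector n D 0 0 0 z := by simp [profile]
    have h1 : |profile n D τ 0 0 0 z - D 0 0 z| ≤ τ * A := by
      rw [e1, abs_mul, abs_of_pos hτ]
      exact mul_le_mul_of_nonneg_left (hcorr 0 0 0 (by omega) (by omega)) hτ.le
    have h2 : |f' (profile n D τ 0 0 0 z) - f' (D 0 0 z)| ≤ K * (τ * A) :=
      (hK _ _).trans (mul_le_mul_of_nonneg_left h1 hK0)
    calc _ ≤ K * (τ * A) * (2 * A) := mul_le_mul h2 hPx0 (abs_nonneg _) (by positivity)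
      _ = _ := by ring
  have b4 : |f' (D 0 0 z) * (τ * corrector n D 0 1 0 z)| ≤ τ * (M * A) := by
    have h1 : |f' (D 0 0 z)| ≤ M := by
      have h2 := hK (D 0 0 z) 0
      have h3 := abs_sub_abs_le_abs_sub (f' (D 0 0 z)) (f' 0)
      have h4 := mul_le_mul_of_nonneg_left hD hK0
      rw [sub_zero] at h2
      rw [hM]; linarith
    rw [abs_mul, abs_mul, abs_of_pos hτ]
    calc _ ≤ M * (τ * A) := mul_le_mul h1 (mul_le_mul_of_nonneg_left
          (hcorr 0 1 0 (by omega) (by omega)) hτ.le) (by positivity) hM0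
      _ = _ := by ring
  rw [e]
  refine (abs_add_le _ _).trans ((add_le_add ((abs_add_le _ _).trans (add_le_add
    ((abs_add_le _ _).trans (add_le_add ((abs_add_le _ _).trans (add_le_add hres b1)) b2))
    b3)) b4).trans ?_)
  have h1 : 0 ≤ (2 * A + 2 * K * A ^ 2 + M * A) * δ := mul_nonneg (by positivity) hδ
  linarith [hτ.le]

/-- Away from the middle index, the profile solves the relaxation equations up to `O(τ²)`. This is
what the correction is for: paired with `y k - P k`, whose square only has the weight `τ` in the
energy, a residual `O(τ)` would spoil the rate. -/
theorem residual_eq_of_ne {k : ℕ} (hk : 1 ≤ k) (hk2 : k < 2 * n) (hkn : k ≠ n) :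
    τ * profile n D τ 1 0 k z + sgn (2 * n) k * profile n D τ 0 1 (2 * n - 1 - k) z
      + sgn (2 * n) (2 * n - k) * profile n D τ 0 0 (2 * n - k) z
      = τ ^ 2 * corrector n D 1 0 k z := by
  have h1 := corrector_dx_sub (n := n) D (i := 2 * n - k) (by omega) (by omega) (by omega) z
  rw [show 2 * n - (2 * n - k) = k by omega, sgn_compl hk hk2 hkn] at h1
  simp only [profile, add_zero]
  rw [show 2 * n - 1 - k + 1 = 2 * n - k by omega,
    show 2 * n - 1 - k = 2 * n - k - 1 by omega, sgn_compl hk hk2 hkn]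
  linear_combination τ * sgn (2 * n) k * h1 - τ * D 1 k z * sgn_mul_self (2 * n) k

/-- In the middle equation the residual is only `O(τ)`; it is absorbed by the damping. -/
theorem residual_eq_mid (hn : 0 < n) :
    τ * profile n D τ 1 0 n z + sgn (2 * n) n * profile n D τ 0 1 (2 * n - 1 - n) z
      + sgn (2 * n) (2 * n - n) * profile n D τ 0 0 (2 * n - n) z
      + 2 * profile n D τ 0 0 n z = τ * D 1 n z := by
  simp only [profile, add_zero]
  rw [show 2 * n - n = n by omega, show 2 * n - 1 - n = n - 1 by omega, corrector_mid_left hn,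
    corrector_mid, corrector_mid, show n - 1 + 1 = n by omega, sgn_mid hn]
  ring

theorem neg_sum_residual_le (hn : 0 < n) (hτ : 0 < τ) (hτ1 : τ ≤ 1)
    (hcorr : ∀ a b i, a + b ≤ 1 → i < 2 * n → |corrector n D a b i z| ≤ A)
    (hD : |D 1 n z| ≤ A) (y : ℕ → ℝ) :
    -∑ k ∈ Finset.Ico 1 (2 * n), (y k - profile n D τ 0 0 k z) * (τ * profile n D τ 1 0 k z
        + sgn (2 * n) k * profile n D τ 0 1 (2 * n - 1 - k) z
        + sgn (2 * n) (2 * n - k) * profile n D τ 0 0 (2 * n - k) z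
        + if k = n then 2 * profile n D τ 0 0 n z else 0)
      ≤ τ / 2 * ∑ k ∈ Finset.Ico 1 (2 * n), (y k - profile n D τ 0 0 k z) ^ 2
        + 2 * n * (τ ^ 2 * A ^ 2) + (y n - profile n D τ 0 0 n z) ^ 2 := by
  have hn' : n ∈ Finset.Ico 1 (2 * n) := Finset.mem_Ico.2 ⟨hn, by omega⟩
  have hsq : ∀ a : ℝ, |a| ≤ A → τ ^ 2 * a ^ 2 ≤ τ ^ 2 * A ^ 2 := fun a ha =>
    mul_le_mul_of_nonneg_left (sq_le_sq' (abs_le.1 ha).1 (abs_le.1 ha).2) (sq_nonneg τ)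
  have hterm : ∀ k ∈ Finset.Ico 1 (2 * n), -((y k - profile n D τ 0 0 k z)
      * (τ * profile n D τ 1 0 k z
        + sgn (2 * n) k * profile n D τ 0 1 (2 * n - 1 - k) z
        + sgn (2 * n) (2 * n - k) * profile n D τ 0 0 (2 * n - k) z
        + if k = n then 2 * profile n D τ 0 0 n z else 0))
      ≤ τ / 2 * (y k - profile n D τ 0 0 k z) ^ 2 + τ ^ 2 * A ^ 2
        + if k = n then (y n - profile n D τ 0 0 n z) ^ 2 else 0 := by
    intro k hk
    rw [Finset.mem_Ico] at hk
    by_cases hkn : k = n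
    · subst hkn
      rw [if_pos rfl, if_pos rfl, residual_eq_mid hn]
      generalize y k - profile k D τ 0 0 k z = e
      have h3 := hsq _ hD
      have h4 : 0 ≤ τ / 2 * e ^ 2 := by positivity
      have h5 := neg_mul_le_half_sq_add e (τ * D 1 k z)
      have h6 : 0 ≤ e ^ 2 := sq_nonneg e
      have h7 : 0 ≤ (τ * D 1 k z) ^ 2 := sq_nonneg _
      rw [mul_pow] at h5 h7
      linarith
    · rw [if_neg hkn, if_neg hkn, add_zero, add_zero, residual_eq_of_ne hk.1 hk.2 hkn]
      have h3 := hsq _ (hcorr 1 0 k (by omega) hk.2)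
      generalize y k - profile n D τ 0 0 k z = e
      generalize corrector n D 1 0 k z = w at h3
      have h5 : τ * (τ ^ 2 * w ^ 2) ≤ 1 * (τ ^ 2 * w ^ 2) :=
        mul_le_mul_of_nonneg_right hτ1 (by positivity)
      have h6 := mul_le_mul_of_nonneg_left (neg_mul_le_half_sq_add e (τ * w)) hτ.le
      have h7 : 0 ≤ τ ^ 2 * w ^ 2 := by positivity
      linarith
  rw [← Finset.sum_neg_distrib]
  refine (Finset.sum_le_sum hterm).trans ?_
  rw [Finset.sum_add_distrib, Finset.sum_add_distrib, ← Finset.mul_sum, Finset.sum_ite_eq',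
    if_pos hn', Finset.sum_const, Nat.card_Ico, nsmul_eq_mul]
  have : ((2 * n - 1 : ℕ) : ℝ) ≤ 2 * n := by
    exact_mod_cast Nat.sub_le (2 * n) 1
  have := mul_le_mul_of_nonneg_right this (by positivity : 0 ≤ τ ^ 2 * A ^ 2)
  linarith

end Residual

/-- The production of relative energy is, up to an exact space derivative, bounded by the relative
energy and by `(τ + δ)²`. The constants depend on the jet only through its bound `B`. -/
theorem exists_relative_production_bound {n : ℕ} (hn : 0 < n) {f f' : ℝ → ℝ} {K B : ℝ} (hB : 0 ≤ B)
    (hf : ∀ x, HasDerivAt f (f' x) x) (hK : ∀ x y, |f' x - f' y| ≤ K * |x - y|) :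
    ∃ C₁ C₂ : ℝ, 0 ≤ C₁ ∧ 0 ≤ C₂ ∧ ∀ (T L δ τ : ℝ) (r : ℕ → ℝ → ℝ) (D : ℕ → ℕ → ℝ × ℝ → ℝ),
      IsApproxJet T L (2 * n) f' r B δ D → 0 ≤ δ → 0 < τ → τ ≤ 1 →
      ∀ z : ℝ × ℝ, 0 ≤ z.1 → z.1 ≤ T → ∀ y : ℕ → ℝ,
      -(y n) ^ 2 - y 0 * profile n D τ 1 0 0 z - f (y 0) * profile n D τ 0 1 0 z
      - sigma (2 * n) * y (2 * n - 1) * profile n D τ 0 1 0 z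
      - ∑ j ∈ Finset.Ico 1 (2 * n), (τ * y j * profile n D τ 1 0 j z
          + sgn (2 * n) j * y (2 * n - j - 1) * profile n D τ 0 1 j z
          + sgn (2 * n) j * y (2 * n - j) * profile n D τ 0 0 j z)
      + profile n D τ 0 0 0 z * profile n D τ 1 0 0 z
      + τ * ∑ j ∈ Finset.Ico 1 (2 * n), profile n D τ 0 0 j z * profile n D τ 1 0 j z
      ≤ (-f (profile n D τ 0 0 0 z) * profile n D τ 0 1 0 z
          - ∑ k ∈ Finset.range (2 * n), sgn (2 * n) k * profile n D τ 0 0 k z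
            * profile n D τ 0 1 (2 * n - 1 - k) z)
        + C₁ * energy (2 * n) τ (fun j => y j - profile n D τ 0 0 j z) + C₂ * (τ + δ) ^ 2 := by
  have hK0 := lipschitz_const_nonneg hK
  set A : ℝ := (2 * n + 1) * B with hA
  have hA0 : 0 ≤ A := by positivity
  have hBA : B ≤ A := by
    have : (0 : ℝ) ≤ n * B := by positivity
    linarith
  have hnA : 2 * n * B ≤ A := by linarith
  set Q : ℝ := 1 + 2 * A + 2 * K * A ^ 2 + (|f' 0| + K * A) * A with hQ
  have hQ0 : 0 ≤ Q := by positivity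
  -- `4 K A`: the flux contributes at most `2 K A (y₀ - P₀)²`, and the energy contains half that
  -- square; `1`: from Young's inequality for the residuals
  refine ⟨1 + 4 * K * A, 2 * n * A ^ 2 + Q ^ 2 / 2, by positivity, by positivity, ?_⟩
  rintro T L δ τ r D J hδ hτ hτ1 ⟨t, x⟩ ht htT y
  simp only at ht htT
  have hcorr : ∀ a b i, a + b ≤ 1 → i < 2 * n → |corrector n D a b i (t, x)| ≤ A :=
    fun a b i hab hi => (J.abs_corrector_le hab hi ht htT x).trans hnA
  have hD : ∀ i j, i + j ≤ 2 * n → |D i j (t, x)| ≤ A :=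
    fun i j h => (J.bound i j h t x ht htT).trans hBA
  have hPx0 : |profile n D τ 0 1 0 (t, x)| ≤ 2 * A := by
    refine (abs_add_le _ _).trans ?_
    rw [abs_mul, abs_of_pos hτ, zero_add]
    have h1 := hD 0 1 (by omega)
    have h3 : τ * |corrector n D 0 1 0 (t, x)| ≤ 1 * A :=
      mul_le_mul hτ1 (hcorr 0 1 0 (by omega) (by omega)) (abs_nonneg _) zero_le_one
    linarith
  have hRle := abs_zeroth_residual_le hn hK hA0 hδ hτ (J.residual t x ht htT) hcorr
    (hD 0 0 (by omega)) hPx0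
  rw [← hQ] at hRle
  have hsum := neg_sum_residual_le hn hτ hτ1 hcorr (hD 1 n (by omega)) y
  have hid := relative_production_identity hn τ (f (y 0)) (f (profile n D τ 0 0 0 (t, x))) y
    (fun j => profile n D τ 0 0 j (t, x)) (fun j => profile n D τ 1 0 j (t, x))
    (fun j => profile n D τ 0 1 j (t, x))
  rw [hid]
  have hE : energy (2 * n) τ (fun j => y j - profile n D τ 0 0 j (t, x))
      = (y 0 - profile n D τ 0 0 0 (t, x)) ^ 2 / 2
        + τ / 2 * ∑ k ∈ Finset.Ico 1 (2 * n), (y k - profile n D τ 0 0 k (t, x)) ^ 2 := rfl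
  have hS : 0 ≤ τ / 2 * ∑ k ∈ Finset.Ico 1 (2 * n), (y k - profile n D τ 0 0 k (t, x)) ^ 2 :=
    mul_nonneg (by linarith) (Finset.sum_nonneg fun _ _ => sq_nonneg _)
  have htay : |f (y 0) - f (profile n D τ 0 0 0 (t, x)) - f' (profile n D τ 0 0 0 (t, x))
        * (y 0 - profile n D τ 0 0 0 (t, x))| * |profile n D τ 0 1 0 (t, x)|
      ≤ K * (y 0 - profile n D τ 0 0 0 (t, x)) ^ 2 * (2 * A) :=
    mul_le_mul (taylor_bound_of_lipschitz_deriv hf hK _ _) hPx0 (abs_nonneg _) (by positivity)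
  rw [← abs_mul] at htay
  have htay' := (neg_abs_le _).trans' (neg_le_neg htay)
  have hR2 := sq_le_sq' (abs_le.1 hRle).1 (abs_le.1 hRle).2
  have hR := neg_mul_le_half_sq_add (y 0 - profile n D τ 0 0 0 (t, x))
    (profile n D τ 1 0 0 (t, x) + sigma (2 * n) * profile n D τ 0 1 (2 * n - 1) (t, x)
        + f' (profile n D τ 0 0 0 (t, x)) * profile n D τ 0 1 0 (t, x))
  have h6 := mul_nonneg (mul_nonneg hK0 hA0) hS
  have h7 : τ ^ 2 ≤ (τ + δ) ^ 2 := pow_le_pow_left₀ hτ.le (by linarith) 2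
  have h8 := mul_le_mul_of_nonneg_left h7 (by positivity : (0 : ℝ) ≤ 2 * n * A ^ 2)
  rw [hE]
  linarith

/-! ### The relative energy inequality -/

theorem integral_cyl_time_deriv {T L b : ℝ} (hT : 0 < T) (hb : b < T) {G G' : ℝ × ℝ → ℝ}
    (hG : ∀ t x, HasDerivAt (fun s => G (s, x)) (G' (t, x)) t) (hG' : Continuous G')
    (h0 : ∀ t x, b < t → G (t, x) = 0) :
    ∫ p, G' p ∂(cyl T L) + ∫ x, G (0, x) ∂(space L) = 0 := by
  have hi := integrable_cyl_of_continuous (T := T) (L := L) hG'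
  rw [cyl_eq_prod] at hi ⊢
  rw [integral_prod_symm _ hi]
  have : ∀ x, ∫ t in Ioo 0 T, G' (t, x) = -G (0, x) := fun x => by
    rw [← integral_Ioc_eq_integral_Ioo, ← intervalIntegral.integral_of_le hT.le,
      intervalIntegral.integral_eq_sub_of_hasDerivAt (fun t _ => hG t x)
        ((hG'.comp (Continuous.prodMk_left x)).intervalIntegrable _ _), h0 T x hb, zero_sub]
  simp only [this, integral_neg, neg_add_cancel]

theorem integral_cyl_space_deriv {T L : ℝ} (hL : 0 < L) {G G' : ℝ × ℝ → ℝ}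
    (hG : ∀ t x, HasDerivAt (fun y => G (t, y)) (G' (t, x)) x) (hG' : Continuous G')
    (hper : ∀ t x, G (t, x + L) = G (t, x)) :
    ∫ p, G' p ∂(cyl T L) = 0 := by
  have hi := integrable_cyl_of_continuous (T := T) (L := L) hG'
  rw [cyl_eq_prod] at hi ⊢
  rw [integral_prod _ hi]
  have : ∀ t, ∫ x, G' (t, x) ∂(space L) = 0 := fun t => by
    rw [space, ← integral_Ioc_eq_integral_Ioo, ← intervalIntegral.integral_of_le hL.le,
      intervalIntegral.integral_eq_sub_of_hasDerivAt (fun x _ => hG t x)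
        ((hG'.comp (Continuous.prodMk_right t)).intervalIntegrable _ _)]
    have := hper t 0
    rw [zero_add] at this
    rw [this, sub_self]
  simp only [this, integral_zero]

section Testing

variable {T L τ b : ℝ} {n : ℕ} {f : ℝ → ℝ} {r : ℕ → ℝ → ℝ} {q : ℕ → ℝ × ℝ → ℝ}
  {P : ℕ → ℝ × ℝ → ℝ} {θ : ℝ → ℝ}

theorem isCauchyTest_mul (hθ : ContDiff ℝ smoothOrder θ) (hb : b < T)
    (hθb : ∀ t, b < t → θ t = 0) {φ : ℝ × ℝ → ℝ} (hφ : IsSmoothPeriodic L φ) :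
    IsCauchyTest T L (fun p => θ p.1 * φ p) :=
  ⟨⟨(hθ.comp contDiff_fst).mul hφ.smooth, fun t x => by simp only [hφ.periodic]⟩, b, hb,
    fun t x ht => by simp only [hθb t ht, zero_mul]⟩

theorem hasDerivAt_mul_fst (hθ : ContDiff ℝ smoothOrder θ) {φ : ℝ × ℝ → ℝ}
    (hφ : ContDiff ℝ smoothOrder φ) (t x : ℝ) :
    HasDerivAt (fun s => θ s * φ (s, x)) (deriv θ t * φ (t, x) + θ t * dt φ (t, x)) t :=
  ((hθ.differentiable (by simp) t).hasDerivAt).mul (hasDerivAt_dt hφ t x)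

theorem dt_mul_fst (hθ : ContDiff ℝ smoothOrder θ) {φ : ℝ × ℝ → ℝ}
    (hφ : ContDiff ℝ smoothOrder φ) :
    dt (fun p => θ p.1 * φ p) = fun p => deriv θ p.1 * φ p + θ p.1 * dt φ p := by
  funext ⟨t, x⟩
  exact (hasDerivAt_mul_fst hθ hφ t x).deriv

theorem dx_mul_fst {φ : ℝ × ℝ → ℝ} (hφ : ContDiff ℝ smoothOrder φ) :
    dx (fun p => θ p.1 * φ p) = fun p => θ p.1 * dx φ p := by
  funext ⟨t, x⟩
  exact ((hasDerivAt_dx hφ t x).const_mul (θ t)).deriv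

/-- The chain rule `∂_t (φ² / 2) = φ ∂_t φ`, tested with a cutoff in time. -/
theorem integral_half_sq_test (hT : 0 < T) (hθ : ContDiff ℝ smoothOrder θ) (hb : b < T)
    (hθb : ∀ t, b < t → θ t = 0) {φ : ℝ × ℝ → ℝ} (hφ : ContDiff ℝ smoothOrder φ) :
    ∫ p, (deriv θ p.1 * (φ p ^ 2 / 2) + θ p.1 * (φ p * dt φ p)) ∂(cyl T L)
      + ∫ x, θ 0 * (φ (0, x) ^ 2 / 2) ∂(space L) = 0 := by
  have hφc := hφ.continuous
  have hdc := (contDiff_dt hφ).continuous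
  have hθc := hθ.continuous
  have hθ'c := (contDiff_infty_iff_deriv.1 hθ).2.continuous
  refine integral_cyl_time_deriv (G := fun p => θ p.1 * (φ p ^ 2 / 2)) hT hb (fun t x => ?_)
    (by fun_prop) (fun t x ht => by simp only [hθb t ht, zero_mul])
  have h1 := ((hasDerivAt_dt hφ t x).pow 2).div_const 2
  have h2 := ((hθ.differentiable (by simp) t).hasDerivAt).mul h1
  have h3 : HasDerivAt (fun s => θ s * (φ (s, x) ^ 2 / 2))
      (deriv θ t * (φ (t, x) ^ 2 / 2) + θ t * (φ (t, x) * dt φ (t, x))) t :=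
    h2.congr_deriv (by
      simp only [Pi.pow_apply, Nat.cast_ofNat, show (2 - 1 : ℕ) = 1 from rfl, pow_one]; ring)
  exact h3

theorem IsEntropySolution.integrable (hq : IsEntropySolution T L (2 * n) f τ r q) {j : ℕ}
    (hj : j < 2 * n) : Integrable (q j) (cyl T L) :=
  (hq.memLp j hj).integrable (by norm_num)

/-- The flux grows at most quadratically, so it is integrable along a solution of finite energy. -/
theorem IsEntropySolution.integrable_flux (hn : 0 < n) (hq : IsEntropySolution T L (2 * n) f τ r q)
    {f' : ℝ → ℝ} {K : ℝ} (hf : ∀ x, HasDerivAt f (f' x) x)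
    (hK : ∀ x y, |f' x - f' y| ≤ K * |x - y|) : Integrable (fun p => f (q 0 p)) (cyl T L) := by
  have hfc : Continuous f := continuous_iff_continuousAt.2 fun x => (hf x).continuousAt
  have h0 : 0 < 2 * n := by omega
  have h1 := (hq.memLp 0 h0).integrable_sq
  refine Integrable.mono' (((integrable_const (|f 0|)).add
    ((hq.integrable h0).abs.const_mul |f' 0|)).add (h1.const_mul K))
    (hfc.comp_aestronglyMeasurable (hq.memLp 0 h0).aestronglyMeasurable)
    (Eventually.of_forall fun p => ?_)
  have h2 := taylor_bound_of_lipschitz_deriv hf hK 0 (q 0 p)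
  rw [sub_zero] at h2
  have h3 : f (q 0 p) = (f (q 0 p) - f 0 - f' 0 * q 0 p) + f 0 + f' 0 * q 0 p := by ring
  simp only [Pi.add_apply, Real.norm_eq_abs]
  rw [h3]
  refine (abs_add_three _ _ _).trans ?_
  rw [abs_mul]
  linarith

/-- The relative energy inequality. As the energy is quadratic, `energy (q - P)` is
`energy q - ∑ (q_j P_j - P_j² / 2)` with the weights of the energy; the first part is controlled by
the entropy inequality tested with `θ`, the second by the equations tested with `θ P_j`. -/
theorem IsEntropySolution.relative_energy (hn : 0 < n) (hT : 0 < T)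
    (hq : IsEntropySolution T L (2 * n) f τ r q)
    (hfq : Integrable (fun p => f (q 0 p)) (cyl T L))
    (hr : ∀ j < 2 * n, Integrable (r j) (space L))
    (hr2 : ∀ j < 2 * n, Integrable (fun x => r j x ^ 2) (space L))
    (hP : ∀ j, IsSmoothPeriodic L (P j))
    (hθ : ContDiff ℝ smoothOrder θ) (hb : b < T) (hθb : ∀ t, b < t → θ t = 0)
    (hθ0 : ∀ t, 0 ≤ θ t) :
    0 ≤ ∫ p, (deriv θ p.1 * energy (2 * n) τ (fun j => q j p - P j p)
          + θ p.1 * (-(q n p) ^ 2 - q 0 p * dt (P 0) p - f (q 0 p) * dx (P 0) p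
            - sigma (2 * n) * q (2 * n - 1) p * dx (P 0) p
            - ∑ j ∈ Finset.Ico 1 (2 * n), (τ * q j p * dt (P j) p
              + sgn (2 * n) j * q (2 * n - j - 1) p * dx (P j) p
              + sgn (2 * n) j * q (2 * n - j) p * P j p)
            + P 0 p * dt (P 0) p
            + τ * ∑ j ∈ Finset.Ico 1 (2 * n), P j p * dt (P j) p)) ∂(cyl T L)
        + θ 0 * ∫ x, energy (2 * n) τ (fun j => r j x - P j (0, x)) ∂(space L)
    ∧ Integrable (fun p => deriv θ p.1 * energy (2 * n) τ (fun j => q j p - P j p)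
          + θ p.1 * (-(q n p) ^ 2 - q 0 p * dt (P 0) p - f (q 0 p) * dx (P 0) p
            - sigma (2 * n) * q (2 * n - 1) p * dx (P 0) p
            - ∑ j ∈ Finset.Ico 1 (2 * n), (τ * q j p * dt (P j) p
              + sgn (2 * n) j * q (2 * n - j - 1) p * dx (P j) p
              + sgn (2 * n) j * q (2 * n - j) p * P j p)
            + P 0 p * dt (P 0) p
            + τ * ∑ j ∈ Finset.Ico 1 (2 * n), P j p * dt (P j) p)) (cyl T L) := by
  have hθc := hθ.continuous
  have hθ'c := (contDiff_infty_iff_deriv.1 hθ).2.continuous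
  have hPc : ∀ j, Continuous (P j) := fun j => (hP j).smooth.continuous
  have hPt : ∀ j, Continuous (dt (P j)) := fun j => (contDiff_dt (hP j).smooth).continuous
  have hPx : ∀ j, Continuous (dx (P j)) := fun j => (contDiff_dx (hP j).smooth).continuous
  have hq1 : ∀ j < 2 * n, Integrable (q j) (cyl T L) := fun j hj => hq.integrable hj
  have hq2 : ∀ j < 2 * n, Integrable (fun p => q j p ^ 2) (cyl T L) :=
    fun j hj => (hq.memLp j hj).integrable_sq
  -- the equations and the entropy inequality, tested with `θ P j` and `θ`
  let HE : ℝ × ℝ → ℝ := fun p => energy (2 * n) τ (fun j => q j p) * deriv θ p.1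
    - q n p ^ 2 * θ p.1
  let H0 : ℝ × ℝ → ℝ := fun p => q 0 p * (deriv θ p.1 * P 0 p + θ p.1 * dt (P 0) p)
    + f (q 0 p) * (θ p.1 * dx (P 0) p) + q (2 * n - 1) p * (sigma (2 * n) * (θ p.1 * dx (P 0) p))
    - (deriv θ p.1 * (P 0 p ^ 2 / 2) + θ p.1 * (P 0 p * dt (P 0) p))
  let H : ℕ → ℝ × ℝ → ℝ := fun j p => q j p * (τ * (deriv θ p.1 * P j p + θ p.1 * dt (P j) p))
    + q (2 * n - j - 1) p * (sgn (2 * n) j * (θ p.1 * dx (P j) p))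
    + q (2 * n - j) p * (sgn (2 * n) j * (θ p.1 * P j p))
    - τ * (deriv θ p.1 * (P j p ^ 2 / 2) + θ p.1 * (P j p * dt (P j) p))
  let hE : ℝ → ℝ := fun x => energy (2 * n) τ (fun j => r j x) * θ 0
  let h0 : ℝ → ℝ := fun x => r 0 x * (θ 0 * P 0 (0, x)) - θ 0 * (P 0 (0, x) ^ 2 / 2)
  let h : ℕ → ℝ → ℝ := fun j x => r j x * (τ * (θ 0 * P j (0, x)))
    - τ * (θ 0 * (P j (0, x) ^ 2 / 2))
  have hPc0 : ∀ j, Continuous (fun x => P j (0, x)) :=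
    fun j => (hPc j).comp (Continuous.prodMk_right 0)
  have zi : ∀ j, Integrable (fun p => deriv θ p.1 * (P j p ^ 2 / 2) + θ p.1 * (P j p * dt (P j) p))
      (cyl T L) := fun j => integrable_cyl_of_continuous (by
    have := hPc j; have := hPt j; fun_prop)
  have zi0 : ∀ j, Integrable (fun x => θ 0 * (P j (0, x) ^ 2 / 2)) (space L) := fun j =>
    integrable_space_of_continuous (by have := hPc0 j; fun_prop)
  have e0 : 0 < 2 * n := by omega
  have iA0 : Integrable (fun p => q 0 p * (deriv θ p.1 * P 0 p + θ p.1 * dt (P 0) p)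
    + f (q 0 p) * (θ p.1 * dx (P 0) p)
    + q (2 * n - 1) p * (sigma (2 * n) * (θ p.1 * dx (P 0) p))) (cyl T L) := by
    have := hPc 0; have := hPt 0; have := hPx 0
    exact ((integrable_cyl_mul_continuous (hq1 0 e0) (by fun_prop)).add
      (integrable_cyl_mul_continuous hfq (by fun_prop))).add
      (integrable_cyl_mul_continuous (hq1 (2 * n - 1) (by omega)) (by fun_prop))
  have iA : ∀ j ∈ Finset.Ico 1 (2 * n), Integrable (fun p =>
    q j p * (τ * (deriv θ p.1 * P j p + θ p.1 * dt (P j) p))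
    + q (2 * n - j - 1) p * (sgn (2 * n) j * (θ p.1 * dx (P j) p))
    + q (2 * n - j) p * (sgn (2 * n) j * (θ p.1 * P j p))) (cyl T L) := by
    intro j hj
    rw [Finset.mem_Ico] at hj
    have := hPc j; have := hPt j; have := hPx j
    exact ((integrable_cyl_mul_continuous (hq1 j hj.2) (by fun_prop)).add
      (integrable_cyl_mul_continuous (hq1 _ (by omega)) (by fun_prop))).add
      (integrable_cyl_mul_continuous (hq1 _ (by omega)) (by fun_prop))
  have ia0 : Integrable (fun x => r 0 x * (θ 0 * P 0 (0, x))) (space L) :=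
    integrable_space_mul_continuous (hr 0 e0) (by have := hPc0 0; fun_prop)
  have ia : ∀ j ∈ Finset.Ico 1 (2 * n), Integrable (fun x => r j x * (τ * (θ 0 * P j (0, x))))
      (space L) := fun j hj => integrable_space_mul_continuous (hr j (Finset.mem_Ico.1 hj).2)
      (by have := hPc0 j; fun_prop)
  have iH0 : Integrable H0 (cyl T L) := iA0.sub (zi 0)
  have iH : ∀ j ∈ Finset.Ico 1 (2 * n), Integrable (H j) (cyl T L) :=
    fun j hj => (iA j hj).sub ((zi j).const_mul τ)
  have ih0 : Integrable h0 (space L) := ia0.sub (zi0 0)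
  have ih : ∀ j ∈ Finset.Ico 1 (2 * n), Integrable (h j) (space L) :=
    fun j hj => (ia j hj).sub ((zi0 j).const_mul τ)
  have iHE : Integrable HE (cyl T L) := by
    refine Integrable.sub ?_ (integrable_cyl_mul_continuous (hq2 n (by omega)) (by fun_prop))
    refine integrable_cyl_mul_continuous ?_ (by fun_prop)
    exact ((hq2 0 e0).div_const 2).add ((integrable_finsetSum _ fun j hj =>
      hq2 j (Finset.mem_Ico.1 hj).2).const_mul (τ / 2))
  have ihE : Integrable hE (space L) := by
    refine Integrable.mul_const ?_ _
    exact ((hr2 0 e0).div_const 2).add ((integrable_finsetSum _ fun j hj =>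
      hr2 j (Finset.mem_Ico.1 hj).2).const_mul (τ / 2))
  have EE : 0 ≤ ∫ p, HE p ∂(cyl T L) + ∫ x, hE x ∂(space L) := by
    have h1 := hq.entropy (fun p => θ p.1 * 1)
      (isCauchyTest_mul hθ hb hθb ⟨contDiff_const, fun _ _ => rfl⟩)
      (fun p => by simpa using hθ0 p.1)
    rw [dt_mul_fst hθ (φ := fun _ => 1) contDiff_const, dx_mul_fst (φ := fun _ => 1)
      contDiff_const] at h1
    have d1 : dt (fun _ => (1 : ℝ)) = fun _ => 0 := by funext z; simp [dt]
    have d2 : dx (fun _ => (1 : ℝ)) = fun _ => 0 := by funext z; simp [dx]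
    rw [d1, d2, show 2 * n / 2 = n by omega] at h1
    simpa only [mul_one, mul_zero, add_zero] using h1
  have E0 : ∫ p, H0 p ∂(cyl T L) + ∫ x, h0 x ∂(space L) = 0 := by
    have h1 := hq.equation_zero _ (isCauchyTest_mul hθ hb hθb (hP 0))
    rw [dt_mul_fst hθ (hP 0).smooth, dx_mul_fst (hP 0).smooth] at h1
    have h2 := integral_half_sq_test (L := L) hT hθ hb hθb (hP 0).smooth
    rw [integral_sub iA0 (zi 0), integral_sub ia0 (zi0 0)]
    have h3 : ∀ p, q 0 p * (deriv θ p.1 * P 0 p + θ p.1 * dt (P 0) p)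
        + f (q 0 p) * (θ p.1 * dx (P 0) p) + sigma (2 * n) * q (2 * n - 1) p
          * (θ p.1 * dx (P 0) p)
        = q 0 p * (deriv θ p.1 * P 0 p + θ p.1 * dt (P 0) p)
        + f (q 0 p) * (θ p.1 * dx (P 0) p)
        + q (2 * n - 1) p * (sigma (2 * n) * (θ p.1 * dx (P 0) p)) := fun p => by ring
    simp only [h3] at h1
    linarith
  have Ej : ∀ j ∈ Finset.Ico 1 (2 * n),
      ∫ p, H j p ∂(cyl T L) + ∫ x, h j x ∂(space L) = 0 := by
    intro j hj
    have hj' := Finset.mem_Ico.1 hj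
    have h1 := hq.equation j hj'.1 hj'.2 _ (isCauchyTest_mul hθ hb hθb (hP j))
    rw [dt_mul_fst hθ (hP j).smooth, dx_mul_fst (hP j).smooth] at h1
    have h2 := integral_half_sq_test (L := L) hT hθ hb hθb (hP j).smooth
    rw [integral_sub (iA j hj) ((zi j).const_mul τ), integral_sub (ia j hj) ((zi0 j).const_mul τ),
      integral_const_mul τ, integral_const_mul τ]
    have h3 : ∀ p, τ * q j p * (deriv θ p.1 * P j p + θ p.1 * dt (P j) p)
        + sgn (2 * n) j * q (2 * n - j - 1) p * (θ p.1 * dx (P j) p)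
        + sgn (2 * n) j * q (2 * n - j) p * (θ p.1 * P j p)
        = q j p * (τ * (deriv θ p.1 * P j p + θ p.1 * dt (P j) p))
    + q (2 * n - j - 1) p * (sgn (2 * n) j * (θ p.1 * dx (P j) p))
    + q (2 * n - j) p * (sgn (2 * n) j * (θ p.1 * P j p)) := fun p => by ring
    have h4 : ∀ x, τ * r j x * (θ 0 * P j (0, x)) = r j x * (τ * (θ 0 * P j (0, x))) :=
      fun x => by ring
    simp only [h3, h4] at h1
    linear_combination h1 - τ * h2
  have Es : ∫ p, (∑ j ∈ Finset.Ico 1 (2 * n), H j p) ∂(cyl T L)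
      + ∫ x, (∑ j ∈ Finset.Ico 1 (2 * n), h j x) ∂(space L) = 0 := by
    rw [integral_finsetSum _ iH, integral_finsetSum _ ih, ← Finset.sum_add_distrib]
    exact Finset.sum_eq_zero Ej
  have iHs : Integrable (fun p => ∑ j ∈ Finset.Ico 1 (2 * n), H j p) (cyl T L) :=
    integrable_finsetSum _ iH
  have ihs : Integrable (fun x => ∑ j ∈ Finset.Ico 1 (2 * n), h j x) (space L) :=
    integrable_finsetSum _ ih
  have key : ∀ p, HE p - H0 p - ∑ j ∈ Finset.Ico 1 (2 * n), H j p
      = deriv θ p.1 * energy (2 * n) τ (fun j => q j p - P j p)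
          + θ p.1 * (-(q n p) ^ 2 - q 0 p * dt (P 0) p - f (q 0 p) * dx (P 0) p
            - sigma (2 * n) * q (2 * n - 1) p * dx (P 0) p
            - ∑ j ∈ Finset.Ico 1 (2 * n), (τ * q j p * dt (P j) p
              + sgn (2 * n) j * q (2 * n - j - 1) p * dx (P j) p
              + sgn (2 * n) j * q (2 * n - j) p * P j p)
            + P 0 p * dt (P 0) p
            + τ * ∑ j ∈ Finset.Ico 1 (2 * n), P j p * dt (P j) p) := by
    intro p
    have s1 : ∑ j ∈ Finset.Ico 1 (2 * n), H j p
        = deriv θ p.1 * (τ / 2 * ∑ j ∈ Finset.Ico 1 (2 * n), q j p ^ 2)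
          - deriv θ p.1 * (τ / 2 * ∑ j ∈ Finset.Ico 1 (2 * n), (q j p - P j p) ^ 2)
          + θ p.1 * ∑ j ∈ Finset.Ico 1 (2 * n), (τ * q j p * dt (P j) p
              + sgn (2 * n) j * q (2 * n - j - 1) p * dx (P j) p
              + sgn (2 * n) j * q (2 * n - j) p * P j p)
          - θ p.1 * (τ * ∑ j ∈ Finset.Ico 1 (2 * n), P j p * dt (P j) p) := by
      simp only [Finset.mul_sum, ← Finset.sum_add_distrib, ← Finset.sum_sub_distrib]
      exact Finset.sum_congr rfl fun j _ => by ring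
    rw [s1]
    simp only [HE, H0, energy]
    ring
  have key0 : ∀ x, hE x - h0 x - ∑ j ∈ Finset.Ico 1 (2 * n), h j x
      = θ 0 * energy (2 * n) τ (fun j => r j x - P j (0, x)) := by
    intro x
    have s1 : ∑ j ∈ Finset.Ico 1 (2 * n), h j x
        = θ 0 * (τ / 2 * ∑ j ∈ Finset.Ico 1 (2 * n), r j x ^ 2)
          - θ 0 * (τ / 2 * ∑ j ∈ Finset.Ico 1 (2 * n), (r j x - P j (0, x)) ^ 2) := by
      simp only [Finset.mul_sum, ← Finset.sum_sub_distrib]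
      exact Finset.sum_congr rfl fun j _ => by ring
    rw [s1]
    simp only [hE, h0, energy]
    ring
  have i1 : Integrable (fun p => HE p - H0 p) (cyl T L) := iHE.sub iH0
  have i2 : Integrable (fun x => hE x - h0 x) (space L) := ihE.sub ih0
  refine ⟨?_, ?_⟩
  · rw [← integral_const_mul]
    simp only [← key, ← key0]
    rw [integral_sub i1 iHs, integral_sub iHE iH0, integral_sub i2 ihs, integral_sub ihE ih0]
    linarith
  · simp only [← key]
    exact i1.sub iHs

end Testing

/-- The exact part of the production integrates to zero: it is the space derivative of
`-F(P₀) - ½ ∑ sgn_k P_k P_{2n-1-k}` with `F' = f`, by the symmetry of the signs. -/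
theorem integral_production_profile {T L : ℝ} {n : ℕ} (hL : 0 < L) {f : ℝ → ℝ}
    (hfc : Continuous f) {P : ℕ → ℝ × ℝ → ℝ} (hP : ∀ j, IsSmoothPeriodic L (P j)) {θ : ℝ → ℝ}
    (hθ : Continuous θ) :
    ∫ p, θ p.1 * (-f (P 0 p) * dx (P 0) p - ∑ k ∈ Finset.range (2 * n),
      sgn (2 * n) k * P k p * dx (P (2 * n - 1 - k)) p) ∂(cyl T L) = 0 := by
  have hPc : ∀ j, Continuous (P j) := fun j => (hP j).smooth.continuous
  have hPx : ∀ j, Continuous (dx (P j)) := fun j => (contDiff_dx (hP j).smooth).continuous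
  have hF : ∀ a, HasDerivAt (fun a => ∫ s in (0 : ℝ)..a, f s) (f a) a := fun a =>
    intervalIntegral.integral_hasDerivAt_right (hfc.intervalIntegrable _ _)
      hfc.aestronglyMeasurable.stronglyMeasurableAtFilter hfc.continuousAt
  refine integral_cyl_space_deriv (G := fun p => θ p.1 * (-(∫ s in (0 : ℝ)..P 0 p, f s)
    - (∑ k ∈ Finset.range (2 * n), sgn (2 * n) k * (P k p * P (2 * n - 1 - k) p)) / 2)) hL
    (fun t x => ?_) ?_ (fun t x => by simp only [fun j => (hP j).periodic t x])
  · have hd : ∀ j, HasDerivAt (fun y => P j (t, y)) (dx (P j) (t, x)) x :=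
      fun j => hasDerivAt_dx (hP j).smooth t x
    have h1 : HasDerivAt (fun y => ∫ s in (0 : ℝ)..P 0 (t, y), f s)
        (f (P 0 (t, x)) * dx (P 0) (t, x)) x := (hF _).comp x (hd 0)
    have h2 := HasDerivAt.fun_sum (u := Finset.range (2 * n)) fun k _ =>
      ((hd k).fun_mul (hd (2 * n - 1 - k))).const_mul (sgn (2 * n) k)
    refine ((h1.fun_neg.fun_sub (h2.div_const 2)).const_mul (θ t)).congr_deriv ?_
    have h3 := sum_range_refl (m := 2 * n)
      (fun j k => sgn (2 * n) j * (dx (P j) (t, x) * P k (t, x)))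
    have h4 : ∑ k ∈ Finset.range (2 * n), sgn (2 * n) (2 * n - 1 - k)
          * (dx (P (2 * n - 1 - k)) (t, x) * P k (t, x))
        = ∑ k ∈ Finset.range (2 * n), sgn (2 * n) k * P k (t, x)
          * dx (P (2 * n - 1 - k)) (t, x) := by
      refine Finset.sum_congr rfl fun k hk => ?_
      rw [sgn_reflect (Finset.mem_range.1 hk)]; ring
    have h5 : ∑ k ∈ Finset.range (2 * n), sgn (2 * n) k * (dx (P k) (t, x)
          * P (2 * n - 1 - k) (t, x) + P k (t, x) * dx (P (2 * n - 1 - k)) (t, x))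
        = ∑ k ∈ Finset.range (2 * n), sgn (2 * n) k * (dx (P k) (t, x) * P (2 * n - 1 - k) (t, x))
          + ∑ k ∈ Finset.range (2 * n), sgn (2 * n) k * P k (t, x)
          * dx (P (2 * n - 1 - k)) (t, x) := by
      rw [← Finset.sum_add_distrib]
      exact Finset.sum_congr rfl fun k _ => by ring
    rw [h5, h3, h4]
    ring
  · have := hPc 0; have := hPx 0
    refine (hθ.comp continuous_fst).mul (Continuous.sub (by fun_prop) ?_)
    exact continuous_finsetSum _ fun k _ => (continuous_const.mul (hPc k)).mul (hPx _)

theorem IsEntropySolution.integrable_energy_sub {T L τ : ℝ} {n : ℕ} {f : ℝ → ℝ} {r : ℕ → ℝ → ℝ}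
    {q : ℕ → ℝ × ℝ → ℝ} {P : ℕ → ℝ × ℝ → ℝ} (hn : 0 < n)
    (hq : IsEntropySolution T L (2 * n) f τ r q) (hP : ∀ j, Continuous (P j)) :
    Integrable (fun p => energy (2 * n) τ (fun j => q j p - P j p)) (cyl T L) := by
  have h : ∀ j < 2 * n, Integrable (fun p => (q j p - P j p) ^ 2) (cyl T L) := by
    intro j hj
    have h1 := ((hq.memLp j hj).integrable_sq.sub
      ((integrable_cyl_mul_continuous (hq.integrable hj) (hP j)).const_mul 2)).add
      (integrable_cyl_of_continuous (T := T) (L := L) ((hP j).pow 2))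
    refine h1.congr (Eventually.of_forall fun p => ?_)
    simp only [Pi.add_apply, Pi.sub_apply, Pi.pow_apply]
    ring
  exact ((h 0 (by omega)).div_const 2).add ((integrable_finsetSum _ fun j hj =>
    h j (Finset.mem_Ico.1 hj).2).const_mul (τ / 2))

theorem energy_nonneg {m : ℕ} {τ : ℝ} (hτ : 0 ≤ τ) (y : ℕ → ℝ) : 0 ≤ energy m τ y :=
  add_nonneg (by positivity) (mul_nonneg (by linarith) (Finset.sum_nonneg fun _ _ => sq_nonneg _))

/-! ### From the weak differential inequality to a bound for almost every time -/

section Cutoff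

/-- A smooth nonincreasing cutoff in time, equal to `1` up to `t₀` and to `0` from `t₀ + ε` on,
whose derivative is minus a bump. -/
noncomputable def cutoff (ε t₀ t : ℝ) : ℝ := ∫ s in t..t₀ + ε, bump ε (s - t₀)

variable {ε t₀ : ℝ}

theorem hasDerivAt_cutoff (ε t₀ t : ℝ) : HasDerivAt (cutoff ε t₀) (-bump ε (t - t₀)) t := by
  have hc : Continuous fun s => bump ε (s - t₀) :=
    (bump_contDiff ε).continuous.comp (continuous_id.sub continuous_const)
  exact intervalIntegral.integral_hasDerivAt_left (hc.intervalIntegrable _ _)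
      hc.aestronglyMeasurable.stronglyMeasurableAtFilter hc.continuousAt

theorem contDiff_cutoff (ε t₀ : ℝ) : ContDiff ℝ smoothOrder (cutoff ε t₀) := by
  rw [contDiff_infty_iff_deriv]
  refine ⟨fun t => (hasDerivAt_cutoff ε t₀ t).differentiableAt, ?_⟩
  have : deriv (cutoff ε t₀) = fun t => -bump ε (t - t₀) :=
    funext fun t => (hasDerivAt_cutoff ε t₀ t).deriv
  rw [this]
  exact ((bump_contDiff ε).comp (contDiff_id.sub contDiff_const)).neg

theorem cutoff_antitone (hε : 0 < ε) : Antitone (cutoff ε t₀) := by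
  refine antitone_of_deriv_nonpos (fun t => (hasDerivAt_cutoff ε t₀ t).differentiableAt)
    fun t => ?_
  rw [(hasDerivAt_cutoff ε t₀ t).deriv]
  linarith [bump_nonneg hε (t - t₀)]

theorem cutoff_eq_zero (hε : 0 < ε) {t : ℝ} (ht : t₀ + ε ≤ t) : cutoff ε t₀ t = 0 := by
  rw [cutoff, intervalIntegral.integral_symm, neg_eq_zero]
  refine intervalIntegral.integral_zero_ae (Eventually.of_forall fun s hs => ?_)
  rw [uIoc_of_le ht] at hs
  exact bump_eq_zero hε (Or.inr (by linarith [hs.1]))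

theorem cutoff_eq_one (hε : 0 < ε) {t : ℝ} (ht : t ≤ t₀) : cutoff ε t₀ t = 1 := by
  rw [cutoff, intervalIntegral.integral_comp_sub_right (fun s => bump ε s),
    intervalIntegral.integral_of_le (by linarith), integral_Ioc_eq_integral_Ioo,
    setIntegral_bump hε (by linarith) (by linarith)]

theorem cutoff_nonneg (hε : 0 < ε) (t : ℝ) : 0 ≤ cutoff ε t₀ t := by
  rcases le_total (t₀ + ε) t with h | h
  · rw [cutoff_eq_zero hε h]
  · rw [← cutoff_eq_zero (t₀ := t₀) hε le_rfl]; exact cutoff_antitone hε h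

theorem cutoff_le_one (hε : 0 < ε) (t : ℝ) : cutoff ε t₀ t ≤ 1 := by
  rcases le_total t t₀ with h | h
  · rw [cutoff_eq_one hε h]
  · rw [← cutoff_eq_one (t₀ := t₀) hε le_rfl]; exact cutoff_antitone hε h

end Cutoff

/-- Grönwall's inequality for a merely integrable `h` which satisfies `h' ≤ C h + c`, `h(0) ≤ h₀`,
on `[0, T')` in the sense of distributions. The test function `e^{-Ct}` times a cutoff absorbs the
linear term; when the cutoff steepens at `t₀`, Lebesgue's differentiation theorem gives the bound at
almost every `t₀`. -/
theorem ae_le_of_weak_differential_inequality {T T' C c h₀ : ℝ} (hC : 0 ≤ C) (hc : 0 ≤ c)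
    (hT : 0 < T) {h : ℝ → ℝ} (hh : IntegrableOn h (Ioo 0 T))
    (hineq : ∀ (θ : ℝ → ℝ) (b : ℝ), ContDiff ℝ smoothOrder θ → b < T' → (∀ t, b < t → θ t = 0) →
      (∀ t, 0 ≤ θ t) →
      0 ≤ (∫ t in Ioo 0 T, (deriv θ t * h t + θ t * (C * h t + c))) + θ 0 * h₀) :
    ∀ᵐ t ∂(volume.restrict (Ioo 0 T)), t < T' → Real.exp (-C * t) * h t ≤ c * T + h₀ := by
  obtain ⟨Cb, hCb0, hCb, -⟩ := exists_baseBump_bound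
  have hexp : Continuous fun t => Real.exp (-C * t) := by fun_prop
  have hg : IntegrableOn (fun t => h t * Real.exp (-C * t)) (Ioo 0 T) :=
    IntegrableOn.mul_continuousOn_of_subset hh hexp.continuousOn measurableSet_Ioo
      isCompact_Icc Ioo_subset_Icc_self
  have hloc : LocallyIntegrable ((Ioo 0 T).indicator fun t => h t * Real.exp (-C * t)) volume :=
    ((integrable_indicator_iff measurableSet_Ioo).2 hg).locallyIntegrable
  have h1 : ∀ᵐ t ∂(volume.restrict (Ioo 0 T)), _ := ae_restrict_of_ae
    (ae_tendsto_integral_mul_kernel volume hloc (2 * Cb))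
  filter_upwards [h1, ae_restrict_mem measurableSet_Ioo] with t₀ ht₀ hmem ht₀T
  have hlim := tendsto_one_div_succ_nhdsGT
  have hsmall : ∀ᶠ n : ℕ in atTop, 1 / ((n : ℝ) + 1) < T' - t₀ :=
    (tendsto_nhdsWithin_iff.1 hlim).1.eventually_lt_const (by linarith)
  have h2 := ht₀ (fun n => 1 / ((n : ℝ) + 1)) (fun n t => bump (1 / ((n : ℝ) + 1)) (t - t₀)) hlim ?_
  · rw [indicator_of_mem hmem, mul_comm] at h2
    refine le_of_tendsto h2 ?_
    filter_upwards [hsmall] with n hn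
    have hε : (0 : ℝ) < 1 / ((n : ℝ) + 1) := by positivity
    set ε := 1 / ((n : ℝ) + 1)
    have hθs : ContDiff ℝ smoothOrder fun t => Real.exp (-C * t) * cutoff ε t₀ t :=
      (Real.contDiff_exp.comp (contDiff_const.mul contDiff_id)).mul (contDiff_cutoff ε t₀)
    have hd : ∀ t, deriv (fun t => Real.exp (-C * t) * cutoff ε t₀ t) t
        = -C * (Real.exp (-C * t) * cutoff ε t₀ t) - Real.exp (-C * t) * bump ε (t - t₀) := by
      intro t
      have e1 : HasDerivAt (fun t => Real.exp (-C * t)) (Real.exp (-C * t) * (-C * 1)) t :=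
        ((hasDerivAt_id t).const_mul (-C)).exp
      have := (e1.mul (hasDerivAt_cutoff ε t₀ t)).deriv
      refine Eq.trans this ?_
      ring
    have h3 := hineq _ (t₀ + ε) hθs (by linarith)
      (fun t ht => by simp only [cutoff_eq_zero hε ht.le, mul_zero])
      (fun t => mul_nonneg (Real.exp_pos _).le (cutoff_nonneg hε t))
    simp only [mul_zero, Real.exp_zero, one_mul, cutoff_eq_one hε hmem.1.le] at h3
    have i1 : IntegrableOn (fun t => c * (Real.exp (-C * t) * cutoff ε t₀ t)) (Ioo 0 T) :=
      (((hθs.continuous.continuousOn (s := Icc 0 T)).integrableOn_Icc).mono_set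
        Ioo_subset_Icc_self).const_mul c
    have i2 : IntegrableOn (fun t => h t * Real.exp (-C * t) * bump ε (t - t₀)) (Ioo 0 T) :=
      IntegrableOn.mul_continuousOn_of_subset hg ((bump_contDiff ε).continuous.comp
        (continuous_id.sub continuous_const)).continuousOn measurableSet_Ioo
        isCompact_Icc Ioo_subset_Icc_self
    have e2 : ∀ t, deriv (fun t => Real.exp (-C * t) * cutoff ε t₀ t) t * h t
          + Real.exp (-C * t) * cutoff ε t₀ t * (C * h t + c)
        = c * (Real.exp (-C * t) * cutoff ε t₀ t)
          - h t * Real.exp (-C * t) * bump ε (t - t₀) := fun t => by rw [hd]; ring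
    simp only [e2] at h3
    rw [integral_sub i1 i2] at h3
    have e3 : ∫ t, (Ioo 0 T).indicator (fun t => h t * Real.exp (-C * t)) t * bump ε (t - t₀)
        = ∫ t in Ioo 0 T, h t * Real.exp (-C * t) * bump ε (t - t₀) := by
      rw [← integral_indicator measurableSet_Ioo]
      refine integral_congr_ae (Eventually.of_forall fun t => ?_)
      by_cases ht : t ∈ Ioo 0 T <;> simp [ht]
    rw [e3]
    have h4 : ∫ t in Ioo 0 T, c * (Real.exp (-C * t) * cutoff ε t₀ t) ≤ c * T := by
      have : ∫ t in Ioo 0 T, c * (Real.exp (-C * t) * cutoff ε t₀ t)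
          ≤ ∫ t in Ioo 0 T, c := by
        refine setIntegral_mono_on i1 (integrableOn_const (by simp)) measurableSet_Ioo
          fun t ht => ?_
        have h5 : Real.exp (-C * t) ≤ 1 := Real.exp_le_one_iff.2 (by
          have := mul_nonneg hC ht.1.le; linarith)
        have h6 : Real.exp (-C * t) * cutoff ε t₀ t ≤ 1 * 1 :=
          mul_le_mul h5 (cutoff_le_one hε t) (cutoff_nonneg hε t) zero_le_one
        nlinarith
      refine this.trans (le_of_eq ?_)
      rw [setIntegral_const, Measure.real, Real.volume_Ioo, sub_zero, ENNReal.toReal_ofReal hT.le,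
        smul_eq_mul, mul_comm]
    linarith
  · refine Eventually.of_forall fun n => ?_
    have hε : (0 : ℝ) < 1 / ((n : ℝ) + 1) := by positivity
    set ε := 1 / ((n : ℝ) + 1)
    have hvol : (volume : Measure ℝ).real (Metric.closedBall t₀ ε) = 2 * ε := by
      rw [Measure.real, Real.volume_closedBall, ENNReal.toReal_ofReal (by positivity)]
    refine ⟨((bump_contDiff ε).continuous.comp
      (continuous_id.sub continuous_const)).aestronglyMeasurable, fun t => ?_, fun t ht => ?_, ?_⟩
    · rw [hvol, abs_of_nonneg (bump_nonneg hε _)]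
      refine (bump_le hε hCb _).trans (le_of_eq ?_)
      field_simp
    · rw [Metric.mem_closedBall, Real.dist_eq] at ht
      refine bump_eq_zero hε ?_
      by_contra! h'
      exact ht (abs_le.2 ⟨by linarith [h'.1], by linarith [h'.2]⟩)
    · rw [integral_sub_right_eq_self (fun t => bump ε t), integral_bump hε]

/-! ### The bound for the relative energy -/

theorem space_real_univ {L : ℝ} (hL : 0 < L) : (space L).real univ = L := by
  rw [space, measureReal_restrict_apply_univ, Measure.real, Real.volume_Ioo, sub_zero,
    ENNReal.toReal_ofReal hL.le]

theorem energy_le_of_abs_le {n : ℕ} {τ M : ℝ} (hn : 0 < n) (hτ1 : τ ≤ 1) {y : ℕ → ℝ}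
    (hy : ∀ j < 2 * n, |y j| ≤ M) : energy (2 * n) τ y ≤ (1 + n) * M ^ 2 := by
  have h : ∀ j < 2 * n, y j ^ 2 ≤ M ^ 2 := fun j hj =>
    sq_le_sq' (abs_le.1 (hy j hj)).1 (abs_le.1 (hy j hj)).2
  have h1 := h 0 (by omega)
  have h2 : ∑ j ∈ Finset.Ico 1 (2 * n), y j ^ 2 ≤ 2 * n * M ^ 2 := by
    refine (Finset.sum_le_card_nsmul _ _ _ fun j hj => h j (Finset.mem_Ico.1 hj).2).trans ?_
    rw [Nat.card_Ico, nsmul_eq_mul]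
    refine mul_le_mul_of_nonneg_right ?_ (sq_nonneg M)
    exact_mod_cast Nat.sub_le (2 * n) 1
  have h3 : 0 ≤ ∑ j ∈ Finset.Ico 1 (2 * n), y j ^ 2 := Finset.sum_nonneg fun _ _ => sq_nonneg _
  have h4 := mul_le_mul_of_nonneg_right hτ1 h3
  have h5 := sq_nonneg M
  rw [energy]
  linarith

namespace IsApproxJet

variable {T L : ℝ} {n : ℕ} {f' : ℝ → ℝ} {r : ℕ → ℝ → ℝ} {B δ : ℝ} {D : ℕ → ℕ → ℝ × ℝ → ℝ}

/-- Initial fields close to a bounded smooth function are square integrable. -/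
theorem integrable_initial_sq (J : IsApproxJet T L (2 * n) f' r B δ D) (hT : 0 ≤ T)
    (hr : ∀ j < 2 * n, Integrable (r j) (space L)) {j : ℕ} (hj : j < 2 * n) :
    Integrable (fun x => r j x ^ 2) (space L) := by
  refine Integrable.mono' (integrable_const ((δ + B) ^ 2))
    ((hr j hj).aestronglyMeasurable.pow 2) ?_
  filter_upwards [J.initial j hj] with x hx
  have h1 := J.bound 0 j (by omega) 0 x le_rfl hT
  have h2 : |r j x| ≤ δ + B := by
    have := abs_sub_abs_le_abs_sub (r j x) (D 0 j (0, x))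
    linarith
  rw [Real.norm_eq_abs, abs_of_nonneg (sq_nonneg _)]
  exact sq_le_sq' (abs_le.1 h2).1 (abs_le.1 h2).2

theorem integral_initial_energy_le (J : IsApproxJet T L (2 * n) f' r B δ D) (hn : 0 < n)
    (hT : 0 ≤ T) (hL : 0 < L) {τ : ℝ} (hδ : 0 ≤ δ) (hτ : 0 ≤ τ) (hτ1 : τ ≤ 1) :
    ∫ x, energy (2 * n) τ (fun j => r j x - profile n D τ 0 0 j (0, x)) ∂(space L)
      ≤ L * (1 + n) * (1 + 2 * n * B) ^ 2 * (τ + δ) ^ 2 := by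
  have hB := J.bound_nonneg hT
  have hae : ∀ᵐ x ∂(space L), energy (2 * n) τ
      (fun j => r j x - profile n D τ 0 0 j (0, x))
      ≤ (1 + n) * ((1 + 2 * n * B) * (τ + δ)) ^ 2 := by
    have h1 : ∀ᵐ x ∂(space L), ∀ j < 2 * n, |r j x - D 0 j (0, x)| ≤ δ :=
      ae_all_iff.2 fun j => by
        by_cases hj : j < 2 * n
        · filter_upwards [J.initial j hj] with x hx _ using hx
        · exact Eventually.of_forall fun x h => absurd h hj
    filter_upwards [h1] with x hx
    refine energy_le_of_abs_le hn hτ1 fun j hj => ?_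
    have h2 := J.abs_profile_sub_le hτ hj le_rfl hT x
    have h3 := hx j hj
    have h4 := abs_sub_le (r j x) (D 0 j (0, x)) (profile n D τ 0 0 j (0, x))
    rw [abs_sub_comm (D 0 j (0, x))] at h4
    have h5 : 0 ≤ 2 * n * B * δ := by positivity
    linarith
  refine (integral_mono_of_nonneg (Eventually.of_forall fun x => energy_nonneg hτ _)
    (integrable_const _) hae).trans (le_of_eq ?_)
  rw [integral_const, space_real_univ hL, smul_eq_mul]
  ring

end IsApproxJet

/-- The relative energy with respect to the corrected profile is `O((τ + δ)²)`, with a constant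
which depends on the jet only through its bound `B`. -/
theorem IsEntropySolution.exists_energy_bound {T L K B : ℝ} {n : ℕ} {f f' : ℝ → ℝ} (hn : 0 < n)
    (hT : 0 < T) (hL : 0 < L) (hB : 0 ≤ B) (hf : ∀ x, HasDerivAt f (f' x) x)
    (hK : ∀ x y, |f' x - f' y| ≤ K * |x - y|) :
    ∃ C : ℝ, 0 ≤ C ∧ ∀ (T' δ τ : ℝ) (r : ℕ → ℝ → ℝ) (D : ℕ → ℕ → ℝ × ℝ → ℝ)
      (q : ℕ → ℝ × ℝ → ℝ), 0 < T' → T' ≤ T → IsApproxJet T' L (2 * n) f' r B δ D → 0 ≤ δ →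
      0 < τ → τ ≤ 1 → (∀ j < 2 * n, Integrable (r j) (space L)) →
      IsEntropySolution T L (2 * n) f τ r q →
      ∀ᵐ t ∂(volume.restrict (Ioo 0 T)), t < T' →
        Integrable (fun x => energy (2 * n) τ
          (fun j => q j (t, x) - profile n D τ 0 0 j (t, x))) (space L) ∧
        ∫ x, energy (2 * n) τ (fun j => q j (t, x) - profile n D τ 0 0 j (t, x)) ∂(space L)
          ≤ C * (τ + δ) ^ 2 := by
  obtain ⟨C₁, C₂, hC₁, hC₂, hprod⟩ := exists_relative_production_bound hn hB hf hK
  refine ⟨Real.exp (C₁ * T) * (C₂ * L * T + L * (1 + n) * (1 + 2 * n * B) ^ 2), by positivity,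
    fun T' δ τ r D q hT' hTT' J hδ hτ hτ1 hr hq => ?_⟩
  have hfc : Continuous f := continuous_iff_continuousAt.2 fun x => (hf x).continuousAt
  have hP := J.isSmoothPeriodic_profile τ 0 0
  set E : ℝ × ℝ → ℝ := fun p => energy (2 * n) τ (fun j => q j p - profile n D τ 0 0 j p) with hE
  set h : ℝ → ℝ := fun t => ∫ x, E (t, x) ∂(space L) with hh
  set h₀ := ∫ x, energy (2 * n) τ (fun j => r j x - profile n D τ 0 0 j (0, x)) ∂(space L)
    with hh₀
  have hEi : Integrable E (cyl T L) :=
    hq.integrable_energy_sub hn fun j => (hP j).smooth.continuous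
  have hEi' : Integrable E ((volume.restrict (Ioo 0 T)).prod (space L)) := by
    rwa [← cyl_eq_prod]
  have hhi : IntegrableOn h (Ioo 0 T) := hEi'.integral_prod_left
  have hineq : ∀ (θ : ℝ → ℝ) (b : ℝ), ContDiff ℝ smoothOrder θ → b < T' →
      (∀ t, b < t → θ t = 0) → (∀ t, 0 ≤ θ t) →
      0 ≤ (∫ t in Ioo 0 T, (deriv θ t * h t + θ t * (C₁ * h t + C₂ * (τ + δ) ^ 2 * L)))
        + θ 0 * h₀ := by
    intro θ b hθ hb hθb hθ0
    have hθc := hθ.continuous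
    have hθ'c := (contDiff_infty_iff_deriv.1 hθ).2.continuous
    obtain ⟨R1, R2⟩ := hq.relative_energy hn hT (hq.integrable_flux hn hf hK) hr
      (fun j hj => J.integrable_initial_sq hT'.le hr hj) hP hθ (hb.trans_le hTT') hθb hθ0
    simp only [J.dt_profile, J.dx_profile, zero_add] at R1 R2
    have hflux := integral_production_profile (T := T) (n := n) hL hfc hP hθc
    have iflux : Integrable (fun p : ℝ × ℝ => θ p.1 * (-f (profile n D τ 0 0 0 p)
        * dx (profile n D τ 0 0 0) p - ∑ k ∈ Finset.range (2 * n), sgn (2 * n) k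
          * profile n D τ 0 0 k p * dx (profile n D τ 0 0 (2 * n - 1 - k)) p)) (cyl T L) := by
      refine integrable_cyl_of_continuous ((hθc.comp continuous_fst).mul
        (Continuous.sub ?_ (continuous_finsetSum _ fun k _ =>
          (continuous_const.mul (hP k).smooth.continuous).mul
            (contDiff_dx (hP _).smooth).continuous)))
      exact (hfc.comp (hP 0).smooth.continuous).neg.mul (contDiff_dx (hP 0).smooth).continuous
    have i3 : Integrable (fun p : ℝ × ℝ => E p * (deriv θ p.1 + θ p.1 * C₁)
        + θ p.1 * (C₂ * (τ + δ) ^ 2)) (cyl T L) :=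
      (integrable_cyl_mul_continuous hEi (by fun_prop)).add
        (integrable_cyl_of_continuous (by fun_prop))
    simp only [J.dx_profile, zero_add] at hflux iflux
    have hle := integral_mono_ae R2 (i3.add iflux) (by
      filter_upwards [ae_cyl_mem T L] with p hp
      simp only [Pi.add_apply]
      -- after the time `b < T'` the test function vanishes and no bound on the profile is needed
      rcases lt_or_ge b p.1 with hbp | hbp
      · rw [hθb _ hbp]
        exact le_of_eq (by ring)
      · have h1 := mul_le_mul_of_nonneg_left (hprod T' L δ τ r D J hδ hτ hτ1 p hp.1.1.le
          (hbp.trans hb.le) fun j => q j p) (hθ0 p.1)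
        simp only [hE]
        linarith)
    have h4 : ∫ p, (E p * (deriv θ p.1 + θ p.1 * C₁) + θ p.1 * (C₂ * (τ + δ) ^ 2)) ∂(cyl T L)
        = ∫ t in Ioo 0 T, (deriv θ t * h t + θ t * (C₁ * h t + C₂ * (τ + δ) ^ 2 * L)) := by
      rw [cyl_eq_prod] at i3 ⊢
      rw [integral_prod _ i3]
      refine integral_congr_ae ?_
      filter_upwards [hEi'.prod_right_ae] with t ht
      rw [integral_add (ht.mul_const _) (integrable_const _), integral_mul_const, integral_const,
        space_real_univ hL, smul_eq_mul]
      ring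
    simp only [Pi.add_apply] at hle
    rw [integral_add i3 iflux, h4, hflux, add_zero] at hle
    linarith
  filter_upwards [ae_le_of_weak_differential_inequality hC₁ (by positivity) hT hhi hineq,
    hEi'.prod_right_ae, ae_restrict_mem measurableSet_Ioo] with t ht hti htm htT
  refine ⟨hti, ?_⟩
  have h1 := ht htT
  have h2 := J.integral_initial_energy_le hn hT'.le hL hδ hτ.le hτ1
  have h3 : h t = Real.exp (C₁ * t) * (Real.exp (-C₁ * t) * h t) := by
    rw [← mul_assoc, ← Real.exp_add]; simp
  have h4 : Real.exp (C₁ * t) ≤ Real.exp (C₁ * T) :=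
    Real.exp_le_exp.2 (mul_le_mul_of_nonneg_left htm.2.le hC₁)
  change h t ≤ _
  have h5 : 0 ≤ (C₂ * L * T + L * (1 + n) * (1 + 2 * n * B) ^ 2) * (τ + δ) ^ 2 := by positivity
  rw [h3]
  calc _ ≤ Real.exp (C₁ * t)
        * ((C₂ * L * T + L * (1 + n) * (1 + 2 * n * B) ^ 2) * (τ + δ) ^ 2) := by
        refine mul_le_mul_of_nonneg_left ?_ (Real.exp_pos _).le
        linarith
    _ ≤ Real.exp (C₁ * T)
        * ((C₂ * L * T + L * (1 + n) * (1 + 2 * n * B) ^ 2) * (τ + δ) ^ 2) :=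
        mul_le_mul_of_nonneg_right h4 h5
    _ = _ := by ring

/-! ### From the relative energy to the norms -/

/-- A bound for the `L²` norm by a majorant of the square. Measurability of `g` is not needed. -/
theorem eLpNorm_two_le_of_sq_le {α : Type*} [MeasurableSpace α] {μ : Measure α} {g G : α → ℝ}
    {M : ℝ} (hM : 0 ≤ M) (hG : Integrable G μ) (hg : ∀ᵐ x ∂μ, g x ^ 2 ≤ G x)
    (hint : ∫ x, G x ∂μ ≤ M ^ 2) : eLpNorm g 2 μ ≤ ENNReal.ofReal M := by
  have h1 : ∫⁻ x, ‖g x‖ₑ ^ (2 : ℝ) ∂μ ≤ ENNReal.ofReal (M ^ 2) := by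
    calc ∫⁻ x, ‖g x‖ₑ ^ (2 : ℝ) ∂μ ≤ ∫⁻ x, ENNReal.ofReal (G x) ∂μ := by
          refine lintegral_mono_ae ?_
          filter_upwards [hg] with x hx
          rw [ENNReal.rpow_two, Real.enorm_eq_ofReal_abs, ← ENNReal.ofReal_pow (abs_nonneg _),
            sq_abs]
          exact ENNReal.ofReal_le_ofReal hx
      _ = ENNReal.ofReal (∫ x, G x ∂μ) :=
          (ofReal_integral_eq_lintegral_ofReal hG
            (hg.mono fun x hx => (sq_nonneg _).trans hx)).symm
      _ ≤ _ := ENNReal.ofReal_le_ofReal hint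
  rw [eLpNorm_eq_lintegral_rpow_enorm_toReal (by norm_num) (by norm_num), ENNReal.toReal_ofNat]
  refine (ENNReal.rpow_le_rpow h1 (by norm_num)).trans (le_of_eq ?_)
  rw [ENNReal.ofReal_rpow_of_nonneg (sq_nonneg M) (by norm_num), ← Real.sqrt_eq_rpow,
    Real.sqrt_sq hM]

/-- A bound on `(0, T - ε)` with a loss `ε`, for all small `ε`, gives the bound without loss. -/
theorem normLinfL2_le_of_lt {T L S τ : ℝ} {g : ℝ × ℝ → ℝ}
    (h : ∀ᶠ ε in 𝓝[>] (0 : ℝ), ∀ᵐ t ∂(volume.restrict (Ioo 0 T)), t < T - ε →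
      eLpNorm (fun x => g (t, x)) 2 (space L) ≤ ENNReal.ofReal (S * (τ + ε))) :
    normLinfL2 T L g ≤ ENNReal.ofReal (S * τ) := by
  have hlim := tendsto_one_div_succ_nhdsGT
  have hlim0 := (tendsto_nhdsWithin_iff.1 hlim).1
  obtain ⟨N, hN⟩ := eventually_atTop.1 (hlim.eventually h)
  refine essSup_le_of_ae_le _ ?_
  have hall : ∀ᵐ t ∂(volume.restrict (Ioo 0 T)), ∀ k ≥ N,
      t < T - 1 / ((k : ℝ) + 1) → eLpNorm (fun x => g (t, x)) 2 (space L)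
        ≤ ENNReal.ofReal (S * (τ + 1 / ((k : ℝ) + 1))) :=
    ae_all_iff.2 fun k => ae_all_iff.2 fun hk => hN k hk
  filter_upwards [hall, ae_restrict_mem measurableSet_Ioo] with t ht htm
  have h1 : Tendsto (fun k : ℕ => ENNReal.ofReal (S * (τ + 1 / ((k : ℝ) + 1)))) atTop
      (𝓝 (ENNReal.ofReal (S * (τ + 0)))) :=
    ENNReal.tendsto_ofReal ((hlim0.const_add τ).const_mul S)
  rw [add_zero] at h1
  refine ge_of_tendsto h1 ?_
  filter_upwards [eventually_ge_atTop N,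
    hlim0.eventually_lt_const (sub_pos.2 htm.2)] with k hk hk2
  exact ht k hk (by linarith)

theorem sq_le_two_mul_energy_zero {m : ℕ} {τ : ℝ} (hτ : 0 ≤ τ) (y : ℕ → ℝ) :
    1 * y 0 ^ 2 ≤ 2 * energy m τ y := by
  have : 0 ≤ τ * ∑ j ∈ Finset.Ico 1 m, y j ^ 2 :=
    mul_nonneg hτ (Finset.sum_nonneg fun _ _ => sq_nonneg _)
  rw [energy]; linarith

theorem mul_sq_le_two_mul_energy {m j : ℕ} {τ : ℝ} (hτ : 0 ≤ τ) (hj : j ∈ Finset.Ico 1 m)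
    (y : ℕ → ℝ) : τ * y j ^ 2 ≤ 2 * energy m τ y := by
  have h1 := mul_le_mul_of_nonneg_left
    (Finset.single_le_sum (f := fun j => y j ^ 2) (fun _ _ => sq_nonneg _) hj) hτ
  have h2 := sq_nonneg (y 0)
  rw [energy]; linarith

/-- The error in one component whose square has at least the weight `w / 2` in the energy. The
mollified jet is used at scales `ε → 0` for fixed `τ`. -/
theorem exists_normLinfL2_component_bound {T L : ℝ} {n : ℕ} (hn : 0 < n) (hT : 0 < T) (hL : 0 < L)
    {f : ℝ → ℝ} (hf : IsAdmissibleFlux f) {u : ℝ × ℝ → ℝ} (hu : MemSobolevInf T L (2 * n) u)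
    {u₀ : ℝ → ℝ} (hsol : IsLimitSolution T L (2 * n) f u u₀) {du₀ : ℕ → ℝ → ℝ}
    (hdu₀ : ∀ j < 2 * n, HasSpaceWeakDeriv L j u₀ (du₀ j)) :
    ∃ S : ℝ, 0 ≤ S ∧ ∀ τ : ℝ, 0 < τ → τ ≤ 1 → ∀ q : ℕ → ℝ × ℝ → ℝ,
      IsEntropySolution T L (2 * n) f τ du₀ q → ∀ j < 2 * n, ∀ v, HasWeakDeriv T L 0 j u v →
      ∀ w : ℝ, 0 < w → w ≤ 1 → (∀ y : ℕ → ℝ, w * y j ^ 2 ≤ 2 * energy (2 * n) τ y) →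
      normLinfL2 T L (fun p => v p - q j p) ≤ ENNReal.ofReal (S / Real.sqrt w * τ) := by
  obtain ⟨f', K, hf', hK⟩ := hf.exists_deriv
  obtain ⟨B, C, hB, hC, hjet⟩ := exists_isApproxJet (by omega) hT hL hf' hK hu hsol hdu₀
  obtain ⟨C₃, hC₃, henergy⟩ := IsEntropySolution.exists_energy_bound hn hT hL hB hf' hK
  set A : ℝ := C + 2 * n * B with hA
  have hA0 : 0 ≤ A := by positivity
  set C₄ : ℝ := 4 * (C₃ * (1 + C) ^ 2) + 2 * (L * A ^ 2) with hC₄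
  have hC₄0 : 0 ≤ C₄ := by positivity
  refine ⟨Real.sqrt C₄, Real.sqrt_nonneg _, fun τ hτ hτ1 q hq j hj v hv w hw hw1 hwy =>
    normLinfL2_le_of_lt ?_⟩
  have hsmall : ∀ᶠ ε in 𝓝[>] (0 : ℝ), ε < min L T :=
    (tendsto_id'.2 nhdsWithin_le_nhds).eventually_lt_const (lt_min hL hT)
  filter_upwards [hsmall, self_mem_nhdsWithin] with ε hε hε0
  rw [mem_Ioi] at hε0
  obtain ⟨D, J, hDv⟩ := hjet ε hε0 hε
  have hT' : 0 < T - ε := sub_pos.2 (hε.trans_le (min_le_right _ _))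
  have hclose := hDv j hj v hv
  rw [cyl_eq_prod] at hclose
  filter_upwards [henergy (T - ε) (C * ε) τ du₀ D q hT' (by linarith) J (by positivity) hτ hτ1
    (fun j hj => (hdu₀ j hj).integrable_right) hq, Measure.ae_ae_of_ae_prod hclose,
    ae_restrict_mem measurableSet_Ioo] with t ht htx htm htT
  obtain ⟨hEi, hEle⟩ := ht htT
  set E : ℝ → ℝ := fun x => energy (2 * n) τ (fun j => q j (t, x) - profile n D τ 0 0 j (t, x))
  refine eLpNorm_two_le_of_sq_le (G := fun x => 4 / w * E x + 2 * (A * (τ + ε)) ^ 2)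
    (by positivity) ((hEi.const_mul _).add (integrable_const _)) ?_ ?_
  · filter_upwards [htx] with x hx
    have h1 := hx htT.le
    have h2 := J.abs_profile_sub_le hτ.le hj htm.1.le htT.le x
    have h3 := abs_sub_le (v (t, x)) (D 0 j (t, x)) (profile n D τ 0 0 j (t, x))
    rw [abs_sub_comm (D 0 j (t, x))] at h3
    have h4 : |v (t, x) - profile n D τ 0 0 j (t, x)| ≤ A * (τ + ε) := by
      have e1 : 0 ≤ C * τ := by positivity
      have e2 : 0 ≤ 2 * n * B * ε := by positivity
      rw [hA]; linarith
    have h5 := sq_le_sq' (abs_le.1 h4).1 (abs_le.1 h4).2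
    have h6 : (q j (t, x) - profile n D τ 0 0 j (t, x)) ^ 2 ≤ 2 / w * E x := by
      rw [div_mul_eq_mul_div, le_div_iff₀ hw, mul_comm]
      exact hwy fun j => q j (t, x) - profile n D τ 0 0 j (t, x)
    have h7 : 4 / w * E x = 2 * (2 / w * E x) := by ring
    rw [h7]
    linarith [sq_nonneg ((v (t, x) - profile n D τ 0 0 j (t, x))
      + (q j (t, x) - profile n D τ 0 0 j (t, x)))]
  · rw [integral_add (hEi.const_mul _) (integrable_const _), integral_const_mul, integral_const,
      space_real_univ hL, smul_eq_mul, mul_pow (_ / _), div_pow, Real.sq_sqrt hC₄0,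
      Real.sq_sqrt hw.le]
    have h1 : (τ + C * ε) ^ 2 ≤ (1 + C) ^ 2 * (τ + ε) ^ 2 := by
      rw [← mul_pow]
      refine pow_le_pow_left₀ (by positivity) ?_ 2
      have : 0 ≤ C * τ := by positivity
      linarith
    have h2 : 2 * (A * (τ + ε)) ^ 2 ≤ 2 * (A * (τ + ε)) ^ 2 / w :=
      le_div_self (by positivity) hw hw1
    calc _ ≤ 4 / w * (C₃ * ((1 + C) ^ 2 * (τ + ε) ^ 2)) + L * (2 * (A * (τ + ε)) ^ 2 / w) := by
          refine add_le_add (mul_le_mul_of_nonneg_left (hEle.trans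
            (mul_le_mul_of_nonneg_left h1 hC₃)) (by positivity))
            (mul_le_mul_of_nonneg_left h2 hL.le)
      _ = _ := by rw [hC₄]; ring

end HypApprox

theorem theorem3p3 (m : ℕ) (hm : Even m) (hm0 : 0 < m) (T L : ℝ) (hT : 0 < T) (hL : 0 < L)
    (f : ℝ → ℝ) (hf : HypApprox.IsAdmissibleFlux f)
    -- the solution `u` of the limit equation and its initial value `u₀`
    (u : ℝ × ℝ → ℝ) (hu : HypApprox.MemSobolevInf T L m u)
    (u₀ : ℝ → ℝ) (hu₀ : HypApprox.MemSpaceSobolevInf L m u₀)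
    (hsol : HypApprox.IsLimitSolution T L m f u u₀)
    -- `du j = ∂_x^j u` and `du₀ j = ∂_x^j u₀`
    (du : ℕ → ℝ × ℝ → ℝ) (hdu : ∀ j < m, HypApprox.HasWeakDeriv T L 0 j u (du j))
    (du₀ : ℕ → ℝ → ℝ) (hdu₀ : ∀ j < m, HypApprox.HasSpaceWeakDeriv L j u₀ (du₀ j)) :
    ∃ C τ₀ : ℝ, 0 < C ∧ 0 < τ₀ ∧ ∀ τ : ℝ, 0 < τ → τ ≤ τ₀ →
      ∀ q : ℕ → ℝ × ℝ → ℝ, HypApprox.IsEntropySolution T L m f τ du₀ q →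
        HypApprox.normLinfL2 T L (fun p => u p - q 0 p)
          + ∑ j ∈ Finset.Ico 1 m,
              ENNReal.ofReal (Real.sqrt τ) * HypApprox.normLinfL2 T L (fun p => du j p - q j p)
          ≤ ENNReal.ofReal (C * τ) := by
  obtain ⟨n, rfl⟩ := hm
  rw [← two_mul] at *
  have hn : 0 < n := by omega
  obtain ⟨S, hS, hbound⟩ :=
    HypApprox.exists_normLinfL2_component_bound hn hT hL hf hu hsol hdu₀
  refine ⟨2 * n * S + 1, 1, by positivity, one_pos, fun τ hτ hτ1 q hq => ?_⟩
  have h0 : HypApprox.normLinfL2 T L (fun p => u p - q 0 p) ≤ ENNReal.ofReal (S * τ) := by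
    simpa using hbound τ hτ hτ1 q hq 0 hm0 u
      (HypApprox.hasWeakDeriv_zero (hdu 0 hm0).integrable_left) 1 one_pos le_rfl
      (HypApprox.sq_le_two_mul_energy_zero hτ.le)
  have hj : ∀ j ∈ Finset.Ico 1 (2 * n), ENNReal.ofReal (Real.sqrt τ)
      * HypApprox.normLinfL2 T L (fun p => du j p - q j p) ≤ ENNReal.ofReal (S * τ) := by
    intro j hj
    have hj2 := (Finset.mem_Ico.1 hj).2
    have h1 := hbound τ hτ hτ1 q hq j hj2 (du j) (hdu j hj2) τ hτ hτ1
      (HypApprox.mul_sq_le_two_mul_energy hτ.le hj)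
    have h2 := Real.sqrt_pos.2 hτ
    calc _ ≤ ENNReal.ofReal (Real.sqrt τ) * ENNReal.ofReal (S / Real.sqrt τ * τ) := by gcongr
      _ = ENNReal.ofReal (S * τ) := by
          rw [← ENNReal.ofReal_mul h2.le]
          congr 1
          field_simp
  calc _ ≤ ENNReal.ofReal (S * τ) + ∑ j ∈ Finset.Ico 1 (2 * n), ENNReal.ofReal (S * τ) :=
        add_le_add h0 (Finset.sum_le_sum hj)
    _ = ENNReal.ofReal (2 * n * S * τ) := by
        have h3 : 0 ≤ S * τ := by positivity
        rw [Finset.sum_const, Nat.card_Ico, ← one_nsmul (ENNReal.ofReal (S * τ)), smul_smul,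
          mul_one, ← add_nsmul, show 1 + (2 * n - 1) = 2 * n by omega, nsmul_eq_mul,
          ← ENNReal.ofReal_natCast, ← ENNReal.ofReal_mul (by positivity)]
        congr 1
        push_cast; ring
    _ ≤ ENNReal.ofReal ((2 * n * S + 1) * τ) := by
        refine ENNReal.ofReal_le_ofReal ?_
        linarith
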